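/- Let $I\subset\mathbb R$ be a nonempty open interval. Write $\mathbf w\cdot\mathbf n=\sum_j w_jn_j$ for the bilinear dot product on $\mathbb C^3$. Let $\mathcal H$ be the set of fields $\mathbf v(\mathbf x)=\sum_{\mathbf n\in S}\mathbf v_{\mathbf n}e^{i\mathbf n\cdot\mathbf x}$ on $\mathbb R^3$ with $S\subset\mathbb R^3\setminus\{\mathbf 0\}$ finite and symmetric ($-S=S$), $\mathbf v_{\mathbf n}\in\mathbb C^3\setminus\{\mathbf 0\}$, $\mathbf v_{-\mathbf n}=\overline{\mathbf v_{\mathbf n}}$ and $\mathbf n\cdot\mathbf v_{\mathbf n}=0$ for all $\mathbf n\in S$; the set $S$ is called the Fourier support of $\mathbf v$. Let $\mathcal H_I$ be the set of fields $\mathbf u(t,\mathbf x)=\sum_{\mathbf n\in S}\mathbf u_{\mathbf n}(t)e^{i\mathbf n\cdot\mathbf x}$ on $I\times\mathbb R^3$ with $S\subset\mathbb R^3\setminus\{\mathbf 0\}$ finite and symmetric, and, for every $\mathbf n\in S$, $\mathbf u_{\mathbf n}:I\to\mathbb C^3$ not identically zero, $\mathbf u_{-\mathbf n}=\overline{\mathbf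 u_{\mathbf n}}$ and $\mathbf n\cdot\mathbf u_{\mathbf n}=0$ on $I$; put $\mathbf u_{\mathbf n}=\mathbf 0$ for $\mathbf n\notin S$. For $\mathbf n\ne\mathbf 0$ let $\hat{\mathbb P}_{\mathbf n}$ be the orthogonal projection of $\mathbb C^3$ onto $\{\mathbf w:\mathbf n\cdot\mathbf w=0\}$. We say that $\mathbf u\in\mathcal H_I$ solves the projected Euler system on $I$ if, for all $\mathbf n\in S\cup\big[(S+S)\setminus\{\mathbf 0\}\big]$, the function $\mathbf u_{\mathbf n}$ is differentiable on $I$ and $$\partial_t\mathbf u_{\mathbf n}+\frac i2\,\hat{\mathbb P}_{\mathbf n}\sum_{\substack{\mathbf n_1,\mathbf n_2\in S\\ \mathbf n_1+\mathbf n_2=\mathbf n}}\big[(\mathbf u_{\mathbf n_1}\cdot\mathbf n_2)\mathbf u_{\mathbf n_2}+(\mathbf u_{\mathbf n_2}\cdot\mathbf n_1)\mathbf u_{\mathbf n_1}\big]=\mathbf 0\qquad\text{on } I .$$ **Theorem.** A field $\mathbf u\in\mathcal H_I$ with Fourier support $S$ solves the projected Euler system on $I$ if and only if it is independent of time, so that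 $\mathbf u=\mathbf u(\mathbf x)\in\mathcal H$ with Fourier support $S$, and satisfies one of the following. 1. $S$ is a subset of a line passing through the origin. 2. $S$ has two linearly independent points and is a subset of a plane $P$ containing the origin, and one of the following holds: - (a) $\mathbf u(\mathbf x)$ is perpendicular to $P$ for every $\mathbf x$; - (b) $\mathbf u(\mathbf x)=\mathbf u^\parallel(\mathbf x)+u^\perp(\mathbf x)\mathbf e^\perp$, where $\mathbf e^\perp$ is a unit normal vector to $P$; $\mathbf u^\parallel\in\mathcal H$ is parallel to $P$ everywhere, and its Fourier support contains at least four points and is a subset of a circle on $P$ centered at the origin with some radius $\lambda>0$; and $u^\perp(\mathbf x)=Q(\omega(\mathbf x))-\langle Q(\omega)\rangle$, where $\omega:\mathbb R^3\to\mathbb R$ is defined by $\nabla\times\mathbf u^\parallel=\lambda\,\omega\,\mathbf e^\perp$, $Q$ is a polynomial with real coefficients, and $\langle Q(\omega)\rangle$ denotes the zero mode (mean value) of the trigonometric polynomial $Q(\omega(\mathbf x))$. 3. $S$ has three linearly independent points and is a subset of a sphere centered at the origin, and $\mathbf u(\mathbf x)$ is a Beltrami flow, i.e. $\nabla\times\mathbf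 u=\mu\,\mathbf u$ for some $\mu\in\mathbb C$. -/

import Mathlib

/-- Real three-dimensional Euclidean space, both the physical space and the space of frequencies. -/
abbrev E3 := EuclideanSpace ℝ (Fin 3)

/-- `ℂ³` with its Hermitian structure; Fourier coefficient vectors live here. -/
abbrev C3 := EuclideanSpace ℂ (Fin 3)

/-- The `ℂ`-bilinear dot product `w · n` of a complex vector with a real frequency. -/
noncomputable def cdot (w : C3) (n : E3) : ℂ := ∑ i, w i * (n i : ℂ)

/-- The character `x ↦ e^{i n · x}` of frequency `n`. -/
noncomputable def fourierChar3 (n x : E3) : ℂ :=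
  Complex.exp (Complex.I * ((inner ℝ n x : ℝ) : ℂ))

/-- `S` is a finite symmetric set of nonzero frequencies. -/
structure IsFrequencySet (S : Finset E3) : Prop where
  zero_notMem : (0 : E3) ∉ S
  symm : ∀ n ∈ S, -n ∈ S

/-- The vector field `v` is the real-valued, mean-zero, divergence-free field
`v(x) = ∑_{n ∈ S} b_n e^{i n · x}` with Fourier support exactly `S`; coefficients outside `S`
are zero by convention. The class `ℋ` consists of the `v` for which such `S`, `b` exist. -/
structure IsFiniteModeField (S : Finset E3) (b : E3 → C3) (v : E3 → E3) : Prop where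
  freq : IsFrequencySet S
  coeff_ne_zero : ∀ n ∈ S, b n ≠ 0
  coeff_eq_zero : ∀ n, n ∉ S → b n = 0
  conj : ∀ n ∈ S, ∀ i, b (-n) i = starRingEnd ℂ (b n i)
  div_free : ∀ n ∈ S, cdot (b n) n = 0
  expansion : ∀ x i, ((v x i : ℝ) : ℂ) = ∑ n ∈ S, b n i * fourierChar3 n x

/-- The space-time field `u` on `I × ℝ³` is
`u(t,x) = ∑_{n ∈ S} a_n(t) e^{i n · x}`, real-valued, mean-zero and divergence-free, with Fourier
support `S` (no coefficient function `a_n`, `n ∈ S`, vanishes identically on `I`); coefficients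
outside `S` are zero by convention. The class `ℋ_I` consists of the `u` for which such `S`, `a`
exist. Nothing is required for times outside `I`. -/
structure IsFiniteModeFlow (I : Set ℝ) (S : Finset E3) (a : ℝ → E3 → C3) (u : ℝ → E3 → E3) :
    Prop where
  freq : IsFrequencySet S
  coeff_ne_zero : ∀ n ∈ S, ∃ t ∈ I, a t n ≠ 0
  coeff_eq_zero : ∀ t ∈ I, ∀ n, n ∉ S → a t n = 0
  conj : ∀ t ∈ I, ∀ n ∈ S, ∀ i, a t (-n) i = starRingEnd ℂ (a t n i)
  div_free : ∀ t ∈ I, ∀ n ∈ S, cdot (a t n) n = 0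
  expansion : ∀ t ∈ I, ∀ x i, ((u t x i : ℝ) : ℂ) = ∑ n ∈ S, a t n i * fourierChar3 n x

/-- The subspace `{w ∈ ℂ³ : n · w = 0}`. -/
noncomputable def divFreePlane (n : E3) : Submodule ℂ C3 where
  carrier := {w | cdot w n = 0}
  add_mem' := by
    intro w z hw hz
    simp only [Set.mem_ofPred_eq, cdot] at hw hz ⊢
    simp [add_mul, Finset.sum_add_distrib, hw, hz]
  zero_mem' := by simp [cdot]
  smul_mem' := by
    intro c w hw
    simp only [Set.mem_ofPred_eq, cdot] at hw ⊢
    simp [mul_assoc, ← Finset.mul_sum, hw]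

/-- The Helmholtz projection on the Fourier side: the orthogonal projection of `ℂ³` onto
`{w : n · w = 0}`. -/
noncomputable def helmholtzProj (n : E3) (w : C3) : C3 := (divFreePlane n).starProjection w

open scoped Classical in
/-- The sum over `n₁, n₂ ∈ S` with `n₁ + n₂ = n` of
`(b_{n₁} · n₂) b_{n₂} + (b_{n₂} · n₁) b_{n₁}`. -/
noncomputable def interactionSum (S : Finset E3) (b : E3 → C3) (n : E3) : C3 :=
  ∑ n₁ ∈ S, ∑ n₂ ∈ S,
    if n₁ + n₂ = n then cdot (b n₁) n₂ • b n₂ + cdot (b n₂) n₁ • b n₁ else 0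

/-- The projected Euler system: for all `t ∈ I` and all `n ∈ S ∪ ((S + S) \ {0})`,
`∂ₜ a_n + (i/2) P_n ∑_{n₁ + n₂ = n} [(a_{n₁} · n₂) a_{n₂} + (a_{n₂} · n₁) a_{n₁}] = 0`,
including that each `a_n` is differentiable on `I`. -/
def SolvesProjectedEuler (I : Set ℝ) (S : Finset E3) (a : ℝ → E3 → C3) : Prop :=
  ∀ t ∈ I, ∀ n : E3, (n ∈ S ∨ (n ≠ 0 ∧ ∃ n₁ ∈ S, ∃ n₂ ∈ S, n₁ + n₂ = n)) →
    HasDerivAt (fun s => a s n)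
      (-((Complex.I / 2) • helmholtzProj n (interactionSum S (a t) n))) t

/-- The partial derivative `∂_j f_k` at `x` of a vector field. -/
noncomputable def partialD (j k : Fin 3) (f : E3 → E3) (x : E3) : ℝ :=
  fderiv ℝ (fun y => f y k) x (EuclideanSpace.single j 1)

/-- The curl `∇ × f`. -/
noncomputable def curl3 (f : E3 → E3) (x : E3) : E3 :=
  !₂[partialD 1 2 f x - partialD 2 1 f x,
     partialD 2 0 f x - partialD 0 2 f x,
     partialD 0 1 f x - partialD 1 0 f x]

/-- A Beltrami flow: an eigenfield of the curl operator. -/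
def IsBeltrami (v : E3 → E3) : Prop :=
  ∃ l : ℂ, ∀ x i, ((curl3 v x i : ℝ) : ℂ) = l * ((v x i : ℝ) : ℂ)

/-- `c` is the zero mode (mean value) of the trigonometric polynomial `f`. -/
def HasZeroMode (f : E3 → ℝ) (c : ℝ) : Prop :=
  ∃ (T : Finset E3) (g : E3 → ℂ), (0 : E3) ∈ T ∧
    (∀ x, (f x : ℂ) = ∑ n ∈ T, g n * fourierChar3 n x) ∧ (c : ℂ) = g 0

/-- The support lies on a line through the origin. -/
def IsLineSupport (S : Finset E3) : Prop :=
  ∃ L : Submodule ℝ E3, Module.finrank ℝ L = 1 ∧ ∀ n ∈ S, n ∈ L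

/-- `v = v∥ + v⊥ e⊥` with `e⊥` a unit normal of `P`; `v∥` is a finite-mode field parallel to `P`
with at least four frequencies, all on a circle in `P` of radius `r` about the origin; and
`v⊥ = Q(ω) - ⟨Q(ω)⟩` with `∇ × v∥ = r ω e⊥` and `Q` a real polynomial. -/
def IsVorticityPolynomialFlow (P : Submodule ℝ E3) (v : E3 → E3) : Prop :=
  ∃ (e : E3) (vpar : E3 → E3) (vperp : E3 → ℝ) (T : Finset E3) (d : E3 → C3) (r : ℝ)
    (ω : E3 → ℝ) (Q : Polynomial ℝ) (c : ℝ),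
    e ∈ Pᗮ ∧ ‖e‖ = 1 ∧
    (∀ x, v x = vpar x + vperp x • e) ∧
    IsFiniteModeField T d vpar ∧ (∀ x, vpar x ∈ P) ∧
    0 < r ∧ (∀ n ∈ T, n ∈ P ∧ ‖n‖ = r) ∧ 4 ≤ T.card ∧
    (∀ x, curl3 vpar x = (r * ω x) • e) ∧
    HasZeroMode (fun x => Q.eval (ω x)) c ∧
    (∀ x, vperp x = Q.eval (ω x) - c)

/-- The planar case: `S` spans a plane `P`, and `v` is perpendicular to `P` everywhere or
its normal component is a polynomial of the vorticity of its parallel component. -/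
def IsPlanarCase (S : Finset E3) (v : E3 → E3) : Prop :=
  (∃ n₁ ∈ S, ∃ n₂ ∈ S, LinearIndependent ℝ ![n₁, n₂]) ∧
  ∃ P : Submodule ℝ E3, Module.finrank ℝ P = 2 ∧ (∀ n ∈ S, n ∈ P) ∧
    ((∀ x, v x ∈ Pᗮ) ∨ IsVorticityPolynomialFlow P v)

/-- The nonplanar case: three linearly independent frequencies, support on a sphere about the
origin, Beltrami flow. -/
def IsBeltramiCase (S : Finset E3) (v : E3 → E3) : Prop :=
  (∃ n₁ ∈ S, ∃ n₂ ∈ S, ∃ n₃ ∈ S, LinearIndependent ℝ ![n₁, n₂, n₃]) ∧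
  (∃ r : ℝ, 0 < r ∧ ∀ n ∈ S, ‖n‖ = r) ∧ IsBeltrami v

/-! The quadratic term is rigid at the boundary of the convex hull of the support. A sum of two
boundary frequencies lies outside the support and has very few representations, so the requirement
that the interaction be a gradient there becomes an explicit algebraic equation for a few
coefficients.

To use this for a time-dependent field, take a time at which the number of nonzero coefficients plus
the number of nonzero pairings `cdot (a t n) m` is maximal. Both vanishing patterns are then
constant nearby (`exists_patternFlow`), so at frequencies outside the active support the time
derivative is zero and the interaction is balanced.

If the support spans space, the sums along an edge `p q` of the hull involve that edge alone
(`edge_alternative`). The resulting `edge_relation` says that the ratio of the two circular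
components of the polarization is parallel transported along the arc from `p` to `q`. Around a facet
its phase changes by twice the area of the radial projection of the facet to the sphere. Some facet
lies in a quarter space (`exists_facet_quarter`), so this phase is strictly between 0 and 2π
(`holonomy_contradiction`). Hence the ratio cannot exist at all vertices, and some edge has a
circularly polarized end point (`exists_null_edge`). The edge alternative then gives `n × b n = κ b
n` at both ends, and a uniquely represented sum (`exists_unique_sum`) spreads this to the whole
support (`exists_helical_of_spanning`): the field is Beltrami and all frequencies have the same
norm.

If the support spans a plane with unit normal `e`, write each amplitude as an in-plane part `alpha`
and a normal part `β`. A nonzero `alpha` lives on a circle (`planarSupport_circle`), so it is a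
steady planar flow. The normal part is then transported linearly by a fixed operator, and since it
stays in a finite set of frequencies, so do all iterates of the operator applied to it. A
leading-term analysis at the edge of the hull (`exists_convPoly_aux`) shows that only polynomials in
the stream function behave this way. On a circle the stream function is a multiple of the vorticity.

Conversely, every classified field has a gradient interaction at every nonzero frequency. This gives
the converse implication and also steadiness: a pattern flow is classified, hence constant, and
connectedness of the interval extends the constancy (`steady_of_solvesProjectedEuler`). Uniqueness
of Fourier coefficients translates between fields and coefficients. -/

/-! ### Vector algebra and the Helmholtz projection -/

/-- The cross product on `E3`. -/
noncomputable def cross3 (m n : E3) : E3 :=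
  !₂[m 1 * n 2 - m 2 * n 1, m 2 * n 0 - m 0 * n 2, m 0 * n 1 - m 1 * n 0]

@[simp] lemma cross3_zero (m n : E3) : cross3 m n 0 = m 1 * n 2 - m 2 * n 1 := rfl
@[simp] lemma cross3_one (m n : E3) : cross3 m n 1 = m 2 * n 0 - m 0 * n 2 := rfl
@[simp] lemma cross3_two (m n : E3) : cross3 m n 2 = m 0 * n 1 - m 1 * n 0 := rfl

lemma inner_eq3 (m n : E3) : inner ℝ m n = m 0 * n 0 + m 1 * n 1 + m 2 * n 2 := by
  simp [PiLp.inner_apply, Fin.sum_univ_three, mul_comm]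

lemma cdot_eq3 (w : C3) (n : E3) : cdot w n = w 0 * (n 0 : ℂ) + w 1 * (n 1 : ℂ) + w 2 * (n 2 : ℂ) := by
  simp [cdot, Fin.sum_univ_three]

lemma ext3 {m n : E3} (h0 : m 0 = n 0) (h1 : m 1 = n 1) (h2 : m 2 = n 2) : m = n := by
  ext i; fin_cases i <;> assumption

lemma extC3 {m n : C3} (h0 : m 0 = n 0) (h1 : m 1 = n 1) (h2 : m 2 = n 2) : m = n := by
  ext i; fin_cases i <;> assumption

lemma cdot_add_left (w z : C3) (n : E3) : cdot (w + z) n = cdot w n + cdot z n := by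
  simp [cdot_eq3]; ring

lemma cdot_sub_left (w z : C3) (n : E3) : cdot (w - z) n = cdot w n - cdot z n := by
  simp [cdot_eq3]; ring

lemma cdot_smul_left (c : ℂ) (w : C3) (n : E3) : cdot (c • w) n = c * cdot w n := by
  simp [cdot_eq3]; ring

@[simp] lemma cdot_zero_left (n : E3) : cdot 0 n = 0 := by simp [cdot_eq3]

@[simp] lemma cdot_zero_right (w : C3) : cdot w 0 = 0 := by simp [cdot_eq3]

lemma cdot_neg_left (w : C3) (n : E3) : cdot (-w) n = - cdot w n := by
  simp [cdot_eq3]; ring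

lemma cdot_add_right (w : C3) (m n : E3) : cdot w (m + n) = cdot w m + cdot w n := by
  simp [cdot_eq3]; ring

lemma cdot_sub_right (w : C3) (m n : E3) : cdot w (m - n) = cdot w m - cdot w n := by
  simp [cdot_eq3]; ring

lemma cdot_neg_right (w : C3) (n : E3) : cdot w (-n) = - cdot w n := by
  simp [cdot_eq3]; ring

lemma cdot_smul_right (w : C3) (c : ℝ) (n : E3) : cdot w (c • n) = c * cdot w n := by
  simp [cdot_eq3]; ring

lemma cdot_sum_left {ι : Type*} (s : Finset ι) (w : ι → C3) (n : E3) :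
    cdot (∑ i ∈ s, w i) n = ∑ i ∈ s, cdot (w i) n := by
  classical
  induction s using Finset.induction_on with
  | empty => simp
  | insert a s ha ih => rw [Finset.sum_insert ha, Finset.sum_insert ha, cdot_add_left, ih]

/-- A real vector as a complex one. -/
noncomputable def toC (n : E3) : C3 := WithLp.toLp 2 fun i => (n i : ℂ)

@[simp] lemma toC_apply (n : E3) (i : Fin 3) : toC n i = (n i : ℂ) := rfl

lemma cdot_toC (m n : E3) : cdot (toC m) n = ((inner ℝ m n : ℝ) : ℂ) := by
  rw [cdot_eq3, inner_eq3]; push_cast; rfl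

lemma cross3_neg_right (a n : E3) : cross3 a (-n) = - cross3 a n := by
  apply ext3 <;> simp <;> ring

@[simp] lemma cross3_zero_right (a : E3) : cross3 a 0 = 0 := by
  apply ext3 <;> simp

lemma inner_cross3_left (a b : E3) : inner ℝ (cross3 a b) a = 0 := by
  simp [inner_eq3]; ring

lemma inner_cross3_right (a b : E3) : inner ℝ (cross3 a b) b = 0 := by
  simp [inner_eq3]; ring

lemma inner_cross3_cross3 (a b c d : E3) : inner ℝ (cross3 a b) (cross3 c d) =
    inner ℝ a c * inner ℝ b d - inner ℝ a d * inner ℝ b c := by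
  simp [inner_eq3]; ring

/-- Expansion of a vector in the basis `a, b, a × b`, with denominators cleared. -/
lemma cross3_basis_expansion (a b d : E3) :
    (inner ℝ (cross3 a b) (cross3 a b)) • d =
      (inner ℝ d a * inner ℝ b b - inner ℝ d b * inner ℝ a b) • a +
      (inner ℝ d b * inner ℝ a a - inner ℝ d a * inner ℝ a b) • b +
      (inner ℝ (cross3 a b) d) • cross3 a b := by
  simp only [inner_eq3]
  apply ext3 <;> simp <;> ring

lemma cross3_basis_expansionC (a b : E3) (w : C3) :
    ((inner ℝ (cross3 a b) (cross3 a b) : ℝ) : ℂ) • w =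
      (cdot w a * ((inner ℝ b b : ℝ) : ℂ) - cdot w b * ((inner ℝ a b : ℝ) : ℂ)) • toC a +
      (cdot w b * ((inner ℝ a a : ℝ) : ℂ) - cdot w a * ((inner ℝ a b : ℝ) : ℂ)) • toC b +
      (cdot w (cross3 a b)) • toC (cross3 a b) := by
  simp only [inner_eq3, cdot_eq3]
  apply extC3 <;> simp <;> ring

lemma eq_zero_of_cdot_eq_zero {a b : E3} (hab : cross3 a b ≠ 0) {w : C3} (ha : cdot w a = 0)
    (hb : cdot w b = 0) (hc : cdot w (cross3 a b) = 0) : w = 0 := by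
  have h := cross3_basis_expansionC a b w
  rw [ha, hb, hc] at h
  have h2 : ((inner ℝ (cross3 a b) (cross3 a b) : ℝ) : ℂ) ≠ 0 := by
    exact_mod_cast inner_self_ne_zero.mpr hab
  simpa [h2, inner_self_ne_zero.mpr hab, hab] using h

lemma cross3_eq_zero_iff {a b : E3} (ha : a ≠ 0) : cross3 a b = 0 ↔ ∃ c : ℝ, b = c • a := by
  constructor
  · intro h
    have hE : (inner ℝ a a : ℝ) • b = (inner ℝ a b : ℝ) • a := by
      have h0 : a 1 * b 2 - a 2 * b 1 = 0 := by rw [← cross3_zero, h]; rfl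
      have h1 : a 2 * b 0 - a 0 * b 2 = 0 := by rw [← cross3_one, h]; rfl
      have h2 : a 0 * b 1 - a 1 * b 0 = 0 := by rw [← cross3_two, h]; rfl
      simp only [inner_eq3]
      apply ext3 <;> simp
      · linear_combination a 2 * h1 - a 1 * h2
      · linear_combination a 0 * h2 - a 2 * h0
      · linear_combination a 1 * h0 - a 0 * h1
    refine ⟨inner ℝ a b / inner ℝ a a, ?_⟩
    have ha' : (inner ℝ a a : ℝ) ≠ 0 := inner_self_ne_zero.mpr ha
    rw [div_eq_inv_mul, mul_smul, ← hE, smul_smul, inv_mul_cancel₀ ha', one_smul]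
  · rintro ⟨c, rfl⟩
    apply ext3 <;> simp <;> ring

/-- In the plane `e^⊥` a divergence-free amplitude at frequency `n` has an in-plane component along
`e × n` and a normal component. -/
lemma cdot_planar {e n : E3} (he : ‖e‖ = 1) (hen : inner ℝ e n = 0) (hn : n ≠ 0) {w : C3}
    (hw : cdot w n = 0) (m : E3) :
    cdot w m = cdot w (cross3 e n) / ((‖n‖ ^ 2 : ℝ) : ℂ) * ((inner ℝ (cross3 e n) m : ℝ) : ℂ) +
      cdot w e * ((inner ℝ e m : ℝ) : ℂ) := by
  have h := cross3_basis_expansion e n m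
  have hee : inner ℝ e e = (1 : ℝ) := by rw [real_inner_self_eq_norm_sq, he]; norm_num
  have hc : inner ℝ (cross3 e n) (cross3 e n) = ‖n‖ ^ 2 := by
    rw [inner_cross3_cross3, hee, hen, real_inner_self_eq_norm_sq, real_inner_comm, hen]; ring
  rw [hc, hen, hee, real_inner_self_eq_norm_sq] at h
  have h2 := congrArg (cdot w) h
  simp only [cdot_add_right, cdot_smul_right, hw] at h2
  have hn2 : ((‖n‖ ^ 2 : ℝ) : ℂ) ≠ 0 := by
    exact_mod_cast pow_ne_zero 2 (norm_ne_zero_iff.mpr hn)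
  field_simp
  rw [real_inner_comm e m] at h2
  rw [mul_comm, h2]
  push_cast
  ring

lemma helmholtzProj_eq {n : E3} (hn : n ≠ 0) (w : C3) :
    helmholtzProj n w = w - (cdot w n / ((‖n‖ ^ 2 : ℝ) : ℂ)) • toC n := by
  have hn2 : ((‖n‖ ^ 2 : ℝ) : ℂ) ≠ 0 := by
    exact_mod_cast pow_ne_zero 2 (norm_ne_zero_iff.mpr hn)
  apply Submodule.eq_starProjection_of_mem_of_inner_eq_zero
  · show cdot _ n = 0
    rw [cdot_sub_left, cdot_smul_left, cdot_toC, real_inner_self_eq_norm_sq]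
    field_simp
    simp
  · intro z hz
    have hz' : cdot z n = 0 := hz
    rw [sub_sub_cancel, inner_smul_left]
    have : inner ℂ (toC n) z = cdot z n := by
      simp [PiLp.inner_apply, cdot_eq3, Fin.sum_univ_three]
    rw [this, hz', mul_zero]

lemma cdot_helmholtzProj {n : E3} (hn : n ≠ 0) (w : C3) {y : E3} (hy : inner ℝ n y = 0) :
    cdot (helmholtzProj n w) y = cdot w y := by
  rw [helmholtzProj_eq hn, cdot_sub_left, cdot_smul_left, cdot_toC, hy]; simp

lemma cdot_helmholtzProj_self {n : E3} (hn : n ≠ 0) (w : C3) :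
    cdot (helmholtzProj n w) n = 0 := by
  have hn2 : ((‖n‖ ^ 2 : ℝ) : ℂ) ≠ 0 := by
    exact_mod_cast pow_ne_zero 2 (norm_ne_zero_iff.mpr hn)
  rw [helmholtzProj_eq hn, cdot_sub_left, cdot_smul_left, cdot_toC, real_inner_self_eq_norm_sq]
  field_simp
  simp

lemma helmholtzProj_smul_toC {n : E3} (hn : n ≠ 0) (c : ℂ) : helmholtzProj n (c • toC n) = 0 := by
  have hn2 : ((‖n‖ ^ 2 : ℝ) : ℂ) ≠ 0 := by
    exact_mod_cast pow_ne_zero 2 (norm_ne_zero_iff.mpr hn)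
  rw [helmholtzProj_eq hn, cdot_smul_left, cdot_toC, real_inner_self_eq_norm_sq]
  rw [mul_div_assoc, div_self hn2, mul_one, sub_self]

lemma norm_cross3_of_perp {e n : E3} (he : ‖e‖ = 1) (hen : inner ℝ e n = 0) :
    inner ℝ (cross3 e n) (cross3 e n) = ‖n‖ ^ 2 := by
  rw [inner_cross3_cross3, real_inner_self_eq_norm_sq, he, hen, real_inner_self_eq_norm_sq,
    real_inner_comm, hen]; ring

lemma cross3_ne_zero_of_perp {e n : E3} (he : ‖e‖ = 1) (hen : inner ℝ e n = 0) (hn : n ≠ 0) :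
    cross3 e n ≠ 0 := by
  intro h
  have := norm_cross3_of_perp he hen
  rw [h, inner_zero_left] at this
  exact hn (by simpa using this.symm)

lemma helmholtzProj_eq_zero_of_planar {e n : E3} (he : ‖e‖ = 1) (hen : inner ℝ e n = 0)
    (hn : n ≠ 0) {w : C3} (h1 : cdot w e = 0) (h2 : cdot w (cross3 e n) = 0) :
    helmholtzProj n w = 0 := by
  apply eq_zero_of_cdot_eq_zero (cross3_ne_zero_of_perp he hen hn)
  · rw [cdot_helmholtzProj hn _ (by rw [real_inner_comm]; exact hen), h1]
  · exact cdot_helmholtzProj_self hn w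
  · rw [cdot_helmholtzProj hn _ (by rw [real_inner_comm]; exact inner_cross3_right _ _), h2]

/-! ### Sums over representations and their planar components -/

/-- Sum of `g n₁ n₂` over the representations `N = n₁ + n₂` with `n₁ ∈ S`, `n₂ ∈ T`. -/
noncomputable def pairSum (S T : Finset E3) (g : E3 → E3 → ℂ) (N : E3) : ℂ :=
  open scoped Classical in ∑ n₁ ∈ S, ∑ n₂ ∈ T, if n₁ + n₂ = N then g n₁ n₂ else 0

lemma pairSum_congr {S T : Finset E3} {g h : E3 → E3 → ℂ} {N : E3}
    (H : ∀ m ∈ S, ∀ n ∈ T, m + n = N → g m n = h m n) : pairSum S T g N = pairSum S T h N := by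
  classical
  unfold pairSum
  refine Finset.sum_congr rfl fun m hm => Finset.sum_congr rfl fun n hn => ?_
  split_ifs with h
  · exact H m hm n hn h
  · rfl

lemma pairSum_eq_zero {S T : Finset E3} {g : E3 → E3 → ℂ} {N : E3}
    (H : ∀ m ∈ S, ∀ n ∈ T, m + n = N → g m n = 0) : pairSum S T g N = 0 := by
  rw [pairSum_congr H]; simp [pairSum]

lemma pairSum_add (S T : Finset E3) (g h : E3 → E3 → ℂ) (N : E3) :
    pairSum S T (fun m n => g m n + h m n) N = pairSum S T g N + pairSum S T h N := by
  classical
  unfold pairSum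
  simp only [← Finset.sum_add_distrib]
  refine Finset.sum_congr rfl fun m _ => Finset.sum_congr rfl fun n _ => ?_
  split_ifs <;> simp

lemma pairSum_mul_left (S T : Finset E3) (c : ℂ) (g : E3 → E3 → ℂ) (N : E3) :
    pairSum S T (fun m n => c * g m n) N = c * pairSum S T g N := by
  classical
  unfold pairSum
  simp only [Finset.mul_sum]
  refine Finset.sum_congr rfl fun m _ => Finset.sum_congr rfl fun n _ => ?_
  split_ifs <;> simp

lemma pairSum_swap (S T : Finset E3) (g : E3 → E3 → ℂ) (N : E3) :
    pairSum S T g N = pairSum T S (fun m n => g n m) N := by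
  classical
  unfold pairSum
  rw [Finset.sum_comm]
  refine Finset.sum_congr rfl fun m _ => Finset.sum_congr rfl fun n _ => ?_
  rw [add_comm]

lemma pairSum_antisymm {S : Finset E3} {g : E3 → E3 → ℂ} {N : E3}
    (H : ∀ m ∈ S, ∀ n ∈ S, g n m = - g m n) : pairSum S S g N = 0 := by
  have h1 := pairSum_swap S S g N
  have h2 : pairSum S S (fun m n => g n m) N = pairSum S S (fun m n => (-1) * g m n) N :=
    pairSum_congr fun m hm n hn _ => by rw [H m hm n hn]; ring
  rw [h2, pairSum_mul_left] at h1
  linear_combination h1 / 2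

/-- The tool for boundary frequencies: when one representation survives, balance at `p + q` becomes
an equation for the coefficients at `p` and `q` only. -/
lemma pairSum_eq_single {S T : Finset E3} {g : E3 → E3 → ℂ} {p q : E3} (hp : p ∈ S) (hq : q ∈ T)
    (H : ∀ m ∈ S, ∀ n ∈ T, m + n = p + q → m = p ∧ n = q ∨ g m n = 0) :
    pairSum S T g (p + q) = g p q := by
  classical
  unfold pairSum
  rw [Finset.sum_eq_single p, Finset.sum_eq_single q]
  · simp
  · intro n _ hnq
    rw [if_neg]; intro h; exact hnq (add_left_cancel h)
  · exact fun h => absurd hq h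
  · intro m hm hmp
    refine Finset.sum_eq_zero fun n hn => ?_
    split_ifs with h
    · rcases H m hm n hn h with h' | h'
      · exact absurd h'.1 hmp
      · exact h'
    · rfl
  · exact fun h => absurd hp h

/-- Only the terms in subsets `S' ⊆ S`, `T' ⊆ T` contribute. -/
lemma pairSum_subset {S T S' T' : Finset E3} {g : E3 → E3 → ℂ} {N : E3} (hS : S' ⊆ S)
    (hT : T' ⊆ T)
    (H : ∀ m ∈ S, ∀ n ∈ T, m + n = N → (m ∈ S' ∧ n ∈ T') ∨ g m n = 0) :
    pairSum S T g N = pairSum S' T' g N := by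
  classical
  unfold pairSum
  rw [← Finset.sum_subset hS]
  · refine Finset.sum_congr rfl fun m hm => ?_
    rw [← Finset.sum_subset hT]
    intro n hn hn'
    split_ifs with h
    · rcases H m (hS hm) n hn h with h' | h'
      · exact absurd h'.2 hn'
      · exact h'
    · rfl
  · intro m hm hm'
    refine Finset.sum_eq_zero fun n hn => ?_
    split_ifs with h
    · rcases H m hm n hn h with h' | h'
      · exact absurd h'.1 hm'
      · exact h'
    · rfl

lemma cdot_interactionSum (S : Finset E3) (b : E3 → C3) (N y : E3) :
    cdot (interactionSum S b N) y =
      pairSum S S (fun m n => cdot (b m) n * cdot (b n) y + cdot (b n) m * cdot (b m) y) N := by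
  classical
  unfold interactionSum pairSum
  rw [cdot_sum_left]
  refine Finset.sum_congr rfl fun m _ => ?_
  rw [cdot_sum_left]
  refine Finset.sum_congr rfl fun n _ => ?_
  split_ifs <;> simp [cdot_add_left, cdot_smul_left]

lemma cdot_interactionSum' (S : Finset E3) (b : E3 → C3) (N y : E3) :
    cdot (interactionSum S b N) y = 2 * pairSum S S (fun m n => cdot (b m) n * cdot (b n) y) N := by
  rw [cdot_interactionSum, pairSum_add,
    pairSum_swap S S (fun m n => cdot (b n) m * cdot (b m) y)]
  ring

/-- The in-plane component of the amplitude `b n`, for the plane with unit normal `e`. -/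
noncomputable def alpha (e : E3) (b : E3 → C3) (n : E3) : ℂ :=
  cdot (b n) (cross3 e n) / ((‖n‖ ^ 2 : ℝ) : ℂ)

/-- The signed area `⟨e × m, n⟩`. -/
noncomputable def brk (e m n : E3) : ℝ := inner ℝ (cross3 e m) n

lemma brk_swap (e m n : E3) : brk e n m = - brk e m n := by
  simp [brk, inner_eq3]; ring

@[simp] lemma brk_self (e m : E3) : brk e m m = 0 := by
  simp [brk, inner_eq3]; ring

lemma brk_add_right (e m n n' : E3) : brk e m (n + n') = brk e m n + brk e m n' := by
  simp [brk, inner_add_right]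

lemma brk_sub_right (e m n n' : E3) : brk e m (n - n') = brk e m n - brk e m n' := by
  simp [brk, inner_sub_right]

lemma brk_smul_right (e m n : E3) (c : ℝ) : brk e m (c • n) = c * brk e m n := by
  simp [brk, inner_smul_right]

lemma brk_neg_right (e m n : E3) : brk e m (-n) = - brk e m n := by
  simp [brk]

@[simp] lemma brk_zero_right (e m : E3) : brk e m 0 = 0 := by
  simp [brk]

/-- Transport by the planar flow with in-plane amplitudes `a`, acting on coefficients. -/
noncomputable def Lop (e : E3) (S : Finset E3) (a : E3 → ℂ) (f : E3 → ℂ) (N : E3) : ℂ :=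
  pairSum S S (fun m n => a m * (brk e m n : ℂ) * f n) N

lemma cdot_eq_alpha {e : E3} {b : E3 → C3} {n : E3} (he : ‖e‖ = 1) (hen : inner ℝ e n = 0)
    (hn : n ≠ 0) (hb : cdot (b n) n = 0) (m : E3) :
    cdot (b n) m = alpha e b n * (brk e n m : ℂ) + cdot (b n) e * ((inner ℝ e m : ℝ) : ℂ) :=
  cdot_planar he hen hn hb m

/-- A stream function is constant along its own flow; the bracket is antisymmetric. -/
lemma Lop_self (e : E3) (S : Finset E3) (a : E3 → ℂ) (N : E3) : Lop e S a a N = 0 := by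
  apply pairSum_antisymm
  intro m _ n _
  rw [brk_swap]; push_cast; ring

/-- The components of the interaction sum of a planar set of frequencies. -/
lemma interactionSum_planar {e : E3} {S : Finset E3} {b : E3 → C3} (he : ‖e‖ = 1)
    (hS : ∀ n ∈ S, inner ℝ e n = 0) (h0 : (0 : E3) ∉ S) (hb : ∀ n ∈ S, cdot (b n) n = 0) (N : E3) :
    cdot (interactionSum S b N) e = 2 * Lop e S (alpha e b) (fun n => cdot (b n) e) N ∧
    cdot (interactionSum S b N) (cross3 e N) =
      2 * Lop e S (alpha e b) (fun n => ((‖n‖ ^ 2 : ℝ) : ℂ) * alpha e b n) N := by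
  have hne : ∀ n ∈ S, n ≠ 0 := fun n hn h => h0 (h ▸ hn)
  have key : ∀ m ∈ S, ∀ n ∈ S, cdot (b m) n = alpha e b m * (brk e m n : ℂ) := by
    intro m hm n hn
    rw [cdot_eq_alpha he (hS m hm) (hne m hm) (hb m hm), hS n hn]; simp
  constructor
  · rw [cdot_interactionSum']
    congr 1
    apply pairSum_congr
    intro m hm n hn _
    rw [key m hm n hn]
  · rw [cdot_interactionSum']
    congr 1
    -- The expansion of `⟨n, N⟩` with `N = m + n` contains `⟨m, n⟩` besides `‖n‖ ^ 2`. This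
    -- symmetric factor meets the antisymmetric bracket and cancels, which leaves the vorticity form
    -- of the equation.
    have hz : pairSum S S (fun m n => alpha e b m * (brk e m n : ℂ) * alpha e b n *
        ((inner ℝ m n : ℝ) : ℂ)) N = 0 := by
      apply pairSum_antisymm
      intro m _ n _
      rw [brk_swap, real_inner_comm]; push_cast; ring
    rw [Lop, ← add_zero (pairSum S S (fun m n => alpha e b m * _ * _) N), ← hz, ← pairSum_add]
    apply pairSum_congr
    intro m hm n hn hN
    have h3 : ∀ y, inner ℝ e y = 0 → cdot (b n) (cross3 e y) =
        alpha e b n * ((inner ℝ n y : ℝ) : ℂ) := by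
      intro y hy
      rw [cdot_eq_alpha he (hS n hn) (hne n hn) (hb n hn), brk, inner_cross3_cross3,
        real_inner_self_eq_norm_sq, he, hy, real_inner_comm (cross3 e y), inner_cross3_left]
      simp
    rw [key m hm n hn, h3 N (by rw [← hN, inner_add_right, hS m hm, hS n hn, add_zero]), ← hN,
      inner_add_right, real_inner_self_eq_norm_sq, real_inner_comm n m]
    push_cast
    ring

lemma pairSum_eq_pair {S : Finset E3} {g : E3 → E3 → ℂ} {p q : E3} (hp : p ∈ S) (hq : q ∈ S)
    (hpq : p ≠ q)
    (H : ∀ m ∈ S, ∀ n ∈ S, m + n = p + q → (m = p ∧ n = q) ∨ (m = q ∧ n = p) ∨ g m n = 0) :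
    pairSum S S g (p + q) = g p q + g q p := by
  classical
  have h1 : pairSum S S g (p + q) =
      pairSum S S (fun m n => (if m = p then g m n else 0) + (if m = p then 0 else g m n)) (p + q) :=
    pairSum_congr fun m _ n _ _ => by split_ifs <;> simp
  rw [h1, pairSum_add, pairSum_eq_single hp hq]
  · rw [if_pos rfl, add_comm p q, pairSum_eq_single hq hp]
    · rw [if_neg hpq.symm]
    · intro m hm n hn hmn
      rcases H m hm n hn (by rw [hmn, add_comm]) with h | h | h
      · right; simp [h.1]
      · exact Or.inl h
      · right; simp [h]
  · intro m hm n hn hmn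
    by_cases hmp : m = p
    · left; refine ⟨hmp, ?_⟩; rw [hmp] at hmn; exact add_left_cancel hmn
    · right; simp [hmp]

lemma brk_ne_zero {e Θ m n : E3} (he : ‖e‖ = 1) (hm : inner ℝ e m = 0) (hn : inner ℝ e n = 0)
    (hΘm : inner ℝ Θ m = 1) (hΘn : inner ℝ Θ n = 1) (hmn : m ≠ n) : brk e m n ≠ 0 := by
  intro h
  have hx := cross3_basis_expansion e m n
  rw [norm_cross3_of_perp he hm, real_inner_comm, hn, hm] at hx
  unfold brk at h
  rw [h] at hx
  have hee : inner ℝ e e = (1 : ℝ) := by rw [real_inner_self_eq_norm_sq, he]; norm_num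
  rw [hee] at hx
  simp only [zero_mul, mul_zero, sub_zero, zero_smul, mul_one, zero_add, add_zero] at hx
  have hΘ := congrArg (fun v => inner ℝ Θ v) hx
  simp only [inner_smul_right, hΘm, hΘn, mul_one] at hΘ
  have hm0 : ‖m‖ ^ 2 ≠ 0 := by
    intro h0
    have : m = 0 := by simpa using h0
    rw [this] at hΘm; simp at hΘm
  rw [← hΘ] at hx
  exact hmn (smul_right_injective _ hm0 hx).symm

/-! ### Frequencies on an edge of the convex hull -/

/-- The affine parameter on the line through `p` and `q`. -/
noncomputable def lineParam (p q n : E3) : ℝ := inner ℝ (q - p) (n - p) / ‖q - p‖ ^ 2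

lemma lineParam_segment {p q n : E3} (hpq : p ≠ q) (hn : n ∈ segment ℝ p q) :
    n = p + lineParam p q n • (q - p) ∧ 0 ≤ lineParam p q n ∧ lineParam p q n ≤ 1 := by
  rw [segment_eq_image'] at hn
  obtain ⟨t, ⟨ht0, ht1⟩, rfl⟩ := hn
  have h : ‖q - p‖ ^ 2 ≠ 0 := pow_ne_zero 2 (norm_ne_zero_iff.mpr (sub_ne_zero.mpr hpq.symm))
  have : lineParam p q (p + t • (q - p)) = t := by
    unfold lineParam
    rw [add_sub_cancel_left, inner_smul_right, real_inner_self_eq_norm_sq, mul_div_assoc, div_self h,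
      mul_one]
  rw [this]
  exact ⟨rfl, ht0, ht1⟩

lemma lineParam_left (p q : E3) : lineParam p q p = 0 := by simp [lineParam]

lemma lineParam_right {p q : E3} (hpq : p ≠ q) : lineParam p q q = 1 := by
  have h : ‖q - p‖ ^ 2 ≠ 0 := pow_ne_zero 2 (norm_ne_zero_iff.mpr (sub_ne_zero.mpr hpq.symm))
  rw [lineParam, real_inner_self_eq_norm_sq, div_self h]

lemma lineParam_inj {p q m n : E3} (hpq : p ≠ q) (hm : m ∈ segment ℝ p q)
    (hn : n ∈ segment ℝ p q) (h : lineParam p q m = lineParam p q n) : m = n := by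
  rw [(lineParam_segment hpq hm).1, (lineParam_segment hpq hn).1, h]

lemma lineParam_add {p q m n m' n' : E3} (h : m + n = m' + n') :
    lineParam p q m + lineParam p q n = lineParam p q m' + lineParam p q n' := by
  unfold lineParam
  rw [← add_div, ← add_div, ← inner_add_right, ← inner_add_right]
  congr 2
  rw [sub_add_sub_comm, sub_add_sub_comm, h]

lemma sq_norm_lineParam {p q n : E3} (hpq : p ≠ q) (hn : n ∈ segment ℝ p q) :
    ‖n‖ ^ 2 = ‖p‖ ^ 2 + 2 * lineParam p q n * inner ℝ p (q - p) +
      lineParam p q n ^ 2 * ‖q - p‖ ^ 2 := by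
  conv_lhs => rw [(lineParam_segment hpq hn).1]
  rw [norm_add_sq_real, inner_smul_right, norm_smul, mul_pow]
  simp; ring

/-- Along an edge the in-plane part lives on at most two points, and these have equal norm. -/
lemma edge_alpha_support {e Θ p q : E3} {E : Finset E3} {a : E3 → ℂ} (he : ‖e‖ = 1)
    (hpq : p ≠ q) (hE : ∀ n ∈ E, n ∈ segment ℝ p q) (heE : ∀ n ∈ E, inner ℝ e n = 0)
    (hΘ : ∀ n ∈ E, inner ℝ Θ n = 1)
    (hJ : ∀ m ∈ E, ∀ n ∈ E, Lop e E a (fun n => ((‖n‖ ^ 2 : ℝ) : ℂ) * a n) (m + n) = 0)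
    {m n : E3} (hm : m ∈ E) (hn : n ∈ E) (ham : a m ≠ 0) (han : a n ≠ 0) (hmn : m ≠ n) :
    ‖m‖ = ‖n‖ ∧ ∀ k ∈ E, a k ≠ 0 → k = m ∨ k = n := by
  classical
  set t := lineParam p q with ht
  set T := E.filter (fun k => a k ≠ 0) with hT
  have hTE : ∀ {k}, k ∈ T → k ∈ E := fun h => (Finset.mem_filter.mp h).1
  have hTa : ∀ {k}, k ∈ T → a k ≠ 0 := fun h => (Finset.mem_filter.mp h).2
  have hmT : m ∈ T := Finset.mem_filter.mpr ⟨hm, ham⟩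
  have hnT : n ∈ T := Finset.mem_filter.mpr ⟨hn, han⟩
  have hinj : ∀ {x y}, x ∈ T → y ∈ T → t x = t y → x = y := fun hx hy h =>
    lineParam_inj hpq (hE _ (hTE hx)) (hE _ (hTE hy)) h
  -- two elements whose sum is represented only once have equal norm
  have key : ∀ x ∈ T, ∀ y ∈ T, x ≠ y →
      (∀ k ∈ T, ∀ l ∈ T, t k + t l = t x + t y → (k = x ∧ l = y) ∨ (k = y ∧ l = x)) →
      ‖x‖ ^ 2 = ‖y‖ ^ 2 := by
    intro x hx y hy hxy H
    have h := hJ x (hTE hx) y (hTE hy)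
    unfold Lop at h
    rw [pairSum_eq_pair (hTE hx) (hTE hy) hxy] at h
    · rw [brk_swap e x y] at h
      have hb : (brk e x y : ℂ) ≠ 0 := by
        exact_mod_cast brk_ne_zero he (heE _ (hTE hx)) (heE _ (hTE hy)) (hΘ _ (hTE hx))
          (hΘ _ (hTE hy)) hxy
      have h' : (a x * a y * (brk e x y : ℂ)) * (((‖y‖ ^ 2 : ℝ) : ℂ) - ((‖x‖ ^ 2 : ℝ) : ℂ)) = 0 := by
        rw [← h]; push_cast; ring
      have h2 := (mul_eq_zero.mp h').resolve_left
        (mul_ne_zero (mul_ne_zero (hTa hx) (hTa hy)) hb)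
      have h3 := sub_eq_zero.mp h2
      exact_mod_cast h3.symm
    · intro k hk l hl hkl
      by_cases hak : a k = 0
      · right; right; simp [hak]
      by_cases hal : a l = 0
      · right; right; simp [hal]
      rcases H k (Finset.mem_filter.mpr ⟨hk, hak⟩) l (Finset.mem_filter.mpr ⟨hl, hal⟩)
        (lineParam_add hkl) with h | h
      · exact Or.inl h
      · exact Or.inr (Or.inl h)
  -- The sum of the two lowest points of the support has no other unordered representation within
  -- it, and likewise for the two highest points, so `key` applies to both pairs.
  obtain ⟨x0, hx0, hx0min⟩ := T.exists_min_image t ⟨m, hmT⟩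
  obtain ⟨y0, hy0, hy0max⟩ := T.exists_max_image t ⟨m, hmT⟩
  have hne : ∀ x : E3, (T.erase x).Nonempty := by
    intro x
    by_cases h : m = x
    · exact ⟨n, Finset.mem_erase.mpr ⟨fun h' => hmn (h.trans h'.symm), hnT⟩⟩
    · exact ⟨m, Finset.mem_erase.mpr ⟨h, hmT⟩⟩
  obtain ⟨x1, hx1, hx1min⟩ := (T.erase x0).exists_min_image t (hne x0)
  obtain ⟨y1, hy1, hy1max⟩ := (T.erase y0).exists_max_image t (hne y0)
  obtain ⟨hx10, hx1⟩ := Finset.mem_erase.mp hx1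
  obtain ⟨hy10, hy1⟩ := Finset.mem_erase.mp hy1
  have hx01 : t x0 < t x1 := lt_of_le_of_ne (hx0min _ hx1) fun h => hx10 (hinj hx0 hx1 h).symm
  have hy01 : t y1 < t y0 := lt_of_le_of_ne (hy0max _ hy1) fun h => hy10 (hinj hy1 hy0 h)
  have hx1' : ∀ k ∈ T, k ≠ x0 → t x1 ≤ t k := fun k hk h => hx1min k (Finset.mem_erase.mpr ⟨h, hk⟩)
  have hy1' : ∀ k ∈ T, k ≠ y0 → t k ≤ t y1 := fun k hk h => hy1max k (Finset.mem_erase.mpr ⟨h, hk⟩)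
  have hnx : ‖x0‖ ^ 2 = ‖x1‖ ^ 2 := by
    refine key x0 hx0 x1 hx1 hx10.symm fun k hk l hl hkl => ?_
    by_cases hk0 : k = x0
    · left; refine ⟨hk0, hinj hl hx1 ?_⟩; rw [hk0] at hkl; linarith
    · right
      have h1 := hx1' k hk hk0
      have h2 := hx0min l hl
      exact ⟨hinj hk hx1 (by linarith), hinj hl hx0 (by linarith)⟩
  have hny : ‖y1‖ ^ 2 = ‖y0‖ ^ 2 := by
    refine key y1 hy1 y0 hy0 hy10 fun k hk l hl hkl => ?_
    by_cases hk0 : k = y0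
    · right; refine ⟨hk0, hinj hl hy1 ?_⟩; rw [hk0] at hkl; linarith
    · left
      have h1 := hy1' k hk hk0
      have h2 := hy0max l hl
      exact ⟨hinj hk hy1 (by linarith), hinj hl hy0 (by linarith)⟩
  rw [sq_norm_lineParam hpq (hE _ (hTE hx0)), sq_norm_lineParam hpq (hE _ (hTE hx1))] at hnx
  rw [sq_norm_lineParam hpq (hE _ (hTE hy0)), sq_norm_lineParam hpq (hE _ (hTE hy1))] at hny
  simp only [← ht] at hnx hny
  have hA : 0 < ‖q - p‖ ^ 2 := by
    have := norm_pos_iff.mpr (sub_ne_zero.mpr hpq.symm); positivity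
  -- The squared norm is a strictly convex quadratic in the affine parameter. Equal values put the
  -- midpoint of a pair at its vertex, so the lowest and the highest pair have the same parameter
  -- sum and must coincide.
  have hex : 2 * inner ℝ p (q - p) + (t x0 + t x1) * ‖q - p‖ ^ 2 = 0 := by
    have : (t x1 - t x0) * (2 * inner ℝ p (q - p) + (t x0 + t x1) * ‖q - p‖ ^ 2) = 0 := by
      linear_combination -hnx
    exact (mul_eq_zero.mp this).resolve_left (by linarith)
  have hey : 2 * inner ℝ p (q - p) + (t y1 + t y0) * ‖q - p‖ ^ 2 = 0 := by
    have : (t y0 - t y1) * (2 * inner ℝ p (q - p) + (t y1 + t y0) * ‖q - p‖ ^ 2) = 0 := by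
      linear_combination -hny
    exact (mul_eq_zero.mp this).resolve_left (by linarith)
  have hs : t x0 + t x1 = t y1 + t y0 := by
    have : (t x0 + t x1 - (t y1 + t y0)) * ‖q - p‖ ^ 2 = 0 := by linear_combination hex - hey
    have := (mul_eq_zero.mp this).resolve_right hA.ne'
    linarith
  have h1 := hx0min y1 hy1
  have h2 := hy0max x1 hx1
  have hxy : x1 = y0 := hinj hx1 hy0 (by linarith)
  have hall : ∀ k ∈ T, k = x0 ∨ k = x1 := by
    intro k hk
    by_cases h : k = x0
    · exact Or.inl h
    · right
      have h3 := hx1' k hk h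
      have h4 := hy0max k hk
      rw [← hxy] at h4
      exact hinj hk hx1 (by linarith)
  have hnorm : ‖x0‖ = ‖x1‖ := by
    have h : ‖x0‖ ^ 2 = ‖x1‖ ^ 2 := by
      rw [sq_norm_lineParam hpq (hE _ (hTE hx0)), sq_norm_lineParam hpq (hE _ (hTE hx1))]
      exact hnx
    exact (sq_eq_sq₀ (norm_nonneg _) (norm_nonneg _)).mp h
  rcases hall m hmT with rfl | rfl <;> rcases hall n hnT with rfl | rfl
  · exact absurd rfl hmn
  · exact ⟨hnorm, fun k hk hak => hall k (Finset.mem_filter.mpr ⟨hk, hak⟩)⟩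
  · exact ⟨hnorm.symm, fun k hk hak => (hall k (Finset.mem_filter.mpr ⟨hk, hak⟩)).symm⟩
  · exact absurd rfl hmn

/-- `p`, `q` are the end points of an edge of the convex hull of `S` (not seen edge-on from `0`). -/
def IsEdge (S : Finset E3) (p q : E3) : Prop :=
  p ∈ S ∧ q ∈ S ∧ p ≠ q ∧ ∃ Θ : E3, inner ℝ Θ p = 1 ∧ inner ℝ Θ q = 1 ∧
    ∀ n ∈ S, n ∈ segment ℝ p q ∨ inner ℝ Θ n < 1

lemma IsEdge.symm {S : Finset E3} {p q : E3} (h : IsEdge S p q) : IsEdge S q p := by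
  obtain ⟨hp, hq, hpq, Θ, h1, h2, h3⟩ := h
  exact ⟨hq, hp, hpq.symm, Θ, h2, h1, fun n hn => by rw [segment_symm]; exact h3 n hn⟩

lemma inner_eq_one_of_segment {Θ p q n : E3} (hp : inner ℝ Θ p = 1) (hq : inner ℝ Θ q = 1)
    (hn : n ∈ segment ℝ p q) : inner ℝ Θ n = 1 := by
  obtain ⟨a, b, _, _, hab, rfl⟩ := hn
  rw [inner_add_right, inner_smul_right, inner_smul_right, hp, hq]; linarith

lemma inner_eq_zero_of_segment {Θ p q n : E3} (hp : inner ℝ Θ p = 0) (hq : inner ℝ Θ q = 0)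
    (hn : n ∈ segment ℝ p q) : inner ℝ Θ n = 0 := by
  obtain ⟨a, b, _, _, hab, rfl⟩ := hn
  rw [inner_add_right, inner_smul_right, inner_smul_right, hp, hq]; simp

/-- The quadratic interaction is a gradient at all frequencies outside `S`. -/
def OuterBalanced (S : Finset E3) (b : E3 → C3) : Prop :=
  ∀ N, N ≠ 0 → N ∉ S → helmholtzProj N (interactionSum S b N) = 0

lemma interactionSum_subset {S E : Finset E3} {b : E3 → C3} {N : E3} (hE : E ⊆ S)
    (H : ∀ m ∈ S, ∀ n ∈ S, m + n = N → m ∈ E ∧ n ∈ E) :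
    interactionSum S b N = interactionSum E b N := by
  classical
  unfold interactionSum
  rw [← Finset.sum_subset hE]
  · refine Finset.sum_congr rfl fun m hm => ?_
    rw [← Finset.sum_subset hE]
    intro n hn hn'
    rw [if_neg]
    exact fun h => hn' (H m (hE hm) n hn h).2
  · intro m hm hm'
    refine Finset.sum_eq_zero fun n hn => ?_
    rw [if_neg]
    exact fun h => hm' (H m hm n hn h).1

/-- The alternative along an edge: either both end points are polarized along the normal of the
plane through the edge and the origin, or the edge has only its two end points as frequencies, they
have equal norm and proportional amplitudes. -/
lemma edge_alternative {S : Finset E3} {b : E3 → C3} (h0 : (0 : E3) ∉ S) (hb : ∀ n ∈ S, b n ≠ 0)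
    (hdiv : ∀ n ∈ S, cdot (b n) n = 0) (hS : OuterBalanced S b) {p q e : E3} (hpq : IsEdge S p q)
    (he : ‖e‖ = 1) (hep : inner ℝ e p = 0) (heq : inner ℝ e q = 0) :
    (alpha e b p = 0 ∧ alpha e b q = 0) ∨
    (alpha e b p ≠ 0 ∧ alpha e b q ≠ 0 ∧ ‖p‖ = ‖q‖ ∧
      alpha e b p * cdot (b q) e = alpha e b q * cdot (b p) e ∧
      ∃ Θ : E3, inner ℝ Θ p = 1 ∧ inner ℝ Θ q = 1 ∧
        ∀ n ∈ S, n ≠ p → n ≠ q → inner ℝ Θ n < 1) := by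
  classical
  wlog hap : alpha e b p ≠ 0 generalizing p q with W
  · by_cases haq : alpha e b q = 0
    · exact Or.inl ⟨not_not.mp hap, haq⟩
    · rcases W hpq.symm heq hep haq with h | ⟨h1, h2, h3, h4, Θ, h5, h6, h7⟩
      · exact absurd h.1 haq
      · exact Or.inr ⟨h2, h1, h3.symm, h4.symm, Θ, h6, h5, fun n hn hn1 hn2 => h7 n hn hn2 hn1⟩
  right
  obtain ⟨hpS, hqS, hne, Θ, hΘp, hΘq, hΘ⟩ := hpq
  set E := S.filter (fun n => n ∈ segment ℝ p q) with hEdef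
  have hES : E ⊆ S := Finset.filter_subset _ _
  have hEseg : ∀ n ∈ E, n ∈ segment ℝ p q := fun n hn => (Finset.mem_filter.mp hn).2
  have hEΘ : ∀ n ∈ E, inner ℝ Θ n = 1 := fun n hn => inner_eq_one_of_segment hΘp hΘq (hEseg n hn)
  have hEe : ∀ n ∈ E, inner ℝ e n = 0 := fun n hn => inner_eq_zero_of_segment hep heq (hEseg n hn)
  have hle : ∀ n ∈ S, inner ℝ Θ n ≤ 1 := fun n hn => by
    rcases hΘ n hn with h | h
    · exact (inner_eq_one_of_segment hΘp hΘq h).le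
    · exact h.le
  have hpE : p ∈ E := Finset.mem_filter.mpr ⟨hpS, left_mem_segment ℝ p q⟩
  have hqE : q ∈ E := Finset.mem_filter.mpr ⟨hqS, right_mem_segment ℝ p q⟩
  -- A sum of two edge frequencies lies on the level `Θ = 2`, above all of `S`, and every
  -- representation of it uses edge frequencies only.
  have hL : ∀ m ∈ E, ∀ n ∈ E,
      Lop e E (alpha e b) (fun n => cdot (b n) e) (m + n) = 0 ∧
      Lop e E (alpha e b) (fun n => ((‖n‖ ^ 2 : ℝ) : ℂ) * alpha e b n) (m + n) = 0 := by
    intro m hm n hn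
    have hN : inner ℝ Θ (m + n) = 2 := by rw [inner_add_right, hEΘ m hm, hEΘ n hn]; norm_num
    have hN0 : m + n ≠ 0 := by intro h; rw [h] at hN; simp at hN
    have hNS : m + n ∉ S := fun h => by have := hle _ h; linarith
    have h := hS _ hN0 hNS
    rw [interactionSum_subset hES] at h
    · have h1 := interactionSum_planar (b := b) he hEe (fun h => h0 (hES h))
        (fun n hn => hdiv n (hES hn)) (m + n)
      have hen : inner ℝ e (m + n) = 0 := by rw [inner_add_right, hEe m hm, hEe n hn, add_zero]
      have h2 := cdot_helmholtzProj hN0 (interactionSum E b (m + n)) (y := e)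
        (by rw [real_inner_comm]; exact hen)
      have h3 := cdot_helmholtzProj hN0 (interactionSum E b (m + n)) (y := cross3 e (m + n))
        (by rw [real_inner_comm]; exact inner_cross3_right _ _)
      rw [h, cdot_zero_left] at h2 h3
      rw [h1.1] at h2
      rw [h1.2] at h3
      exact ⟨by simpa using h2.symm, by simpa using h3.symm⟩
    · intro k hk l hl hkl
      have h1 : inner ℝ Θ k + inner ℝ Θ l = 2 := by rw [← inner_add_right, hkl, hN]
      have hk1 := hle k hk
      have hl1 := hle l hl
      constructor
      · refine Finset.mem_filter.mpr ⟨hk, (hΘ k hk).resolve_right (by linarith)⟩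
      · refine Finset.mem_filter.mpr ⟨hl, (hΘ l hl).resolve_right (by linarith)⟩
  have hJ : ∀ m ∈ E, ∀ n ∈ E, _ := fun m hm n hn => (hL m hm n hn).2
  set t := lineParam p q with ht
  have hinj : ∀ {x y}, x ∈ E → y ∈ E → t x = t y → x = y := fun hx hy h =>
    lineParam_inj hne (hEseg _ hx) (hEseg _ hy) h
  have htp : t p = 0 := lineParam_left p q
  have htq : t q = 1 := lineParam_right hne
  have ht01 : ∀ n ∈ E, 0 ≤ t n ∧ t n ≤ 1 := fun n hn => (lineParam_segment hne (hEseg n hn)).2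
  have hbe : ∀ n ∈ E, alpha e b n = 0 → cdot (b n) e ≠ 0 := by
    intro n hn ha hbz
    have hn0 : n ≠ 0 := fun h => h0 (h ▸ hES hn)
    refine hb n (hES hn) (eq_zero_of_cdot_eq_zero (cross3_ne_zero_of_perp he (hEe n hn) hn0) hbz
      (hdiv n (hES hn)) ?_)
    have := (div_eq_zero_iff.mp ha).resolve_right
      (by exact_mod_cast pow_ne_zero 2 (norm_ne_zero_iff.mpr hn0))
    exact this
  have hbrk : ∀ {x y}, x ∈ E → y ∈ E → x ≠ y → (brk e x y : ℂ) ≠ 0 := by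
    intro x y hx hy hxy
    exact_mod_cast brk_ne_zero he (hEe _ hx) (hEe _ hy) (hEΘ _ hx) (hEΘ _ hy) hxy
  -- `p'` is the edge frequency nearest to `p`, so `p + p'` is represented only by this pair. If
  -- `p'` had no in-plane part, its nonzero normal part would violate the relation obtained.
  obtain ⟨p', hp', hp'min⟩ := (E.erase p).exists_min_image t
    ⟨q, Finset.mem_erase.mpr ⟨hne.symm, hqE⟩⟩
  obtain ⟨hp'p, hp'E⟩ := Finset.mem_erase.mp hp'
  have hrel : alpha e b p * cdot (b p') e = alpha e b p' * cdot (b p) e := by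
    have h := (hL p hpE p' hp'E).1
    unfold Lop at h
    rw [pairSum_eq_pair hpE hp'E hp'p.symm] at h
    · rw [brk_swap e p p'] at h
      have h' : (brk e p p' : ℂ) * (alpha e b p * cdot (b p') e - alpha e b p' * cdot (b p) e) = 0 := by
        rw [← h]; push_cast; ring
      exact sub_eq_zero.mp ((mul_eq_zero.mp h').resolve_left (hbrk hpE hp'E hp'p.symm))
    · intro k hk l hl hkl
      have hs : t k + t l = t p + t p' := lineParam_add hkl
      by_cases hk0 : k = p
      · left; refine ⟨hk0, ?_⟩; rw [hk0] at hkl; exact add_left_cancel hkl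
      · right; left
        have h1 := hp'min k (Finset.mem_erase.mpr ⟨hk0, hk⟩)
        have h2 := (ht01 l hl).1
        exact ⟨hinj hk hp'E (by linarith), hinj hl hpE (by linarith)⟩
  have hap' : alpha e b p' ≠ 0 := by
    intro h
    rw [h, zero_mul] at hrel
    exact (mul_ne_zero hap (hbe p' hp'E h)) hrel
  obtain ⟨hnorm, hsupp⟩ := edge_alpha_support he hne hEseg hEe hEΘ hJ hpE hp'E hap hap' hp'p.symm
  -- Otherwise `q` has no in-plane part, because `p` and `p'` exhaust the in-plane support. The sum
  -- `p' + q` then receives a single nonzero contribution.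
  have hp'q : p' = q := by
    by_contra hp'q
    have haq : alpha e b q = 0 := by
      by_contra haq
      rcases hsupp q hqE haq with h | h
      · exact hne h.symm
      · exact hp'q h.symm
    have h := (hL p' hp'E q hqE).1
    unfold Lop at h
    rw [pairSum_eq_single hp'E hqE] at h
    · exact mul_ne_zero (mul_ne_zero hap' (hbrk hp'E hqE hp'q)) (hbe q hqE haq) h
    · intro k hk l hl hkl
      have hs : t k + t l = t p' + t q := lineParam_add hkl
      by_cases hak : alpha e b k = 0
      · right; simp [hak]
      · left
        rcases hsupp k hk hak with rfl | rfl
        · exfalso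
          have h1 := (ht01 l hl).2
          have h2 : t p' = 0 := le_antisymm (by linarith) (ht01 p' hp'E).1
          exact hp'p (hinj hp'E hpE (by rw [h2, htp]))
        · exact ⟨rfl, add_left_cancel hkl⟩
  subst hp'q
  refine ⟨hap, hap', hnorm, hrel, Θ, hΘp, hΘq, fun n hn hnp hnq => ?_⟩
  refine (hΘ n hn).resolve_left fun hseg => ?_
  have hnE : n ∈ E := Finset.mem_filter.mpr ⟨hn, hseg⟩
  have h1 := hp'min n (Finset.mem_erase.mpr ⟨hnp, hnE⟩)
  exact hnq (hinj hnE hqE (le_antisymm (by rw [htq]; exact (ht01 n hnE).2) h1))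

/-! ### Uniquely represented sums -/

/-- If a symmetric part `R` of `V` avoids the end points of an edge `A B` of `V`, then some sum of
an end point and a nonparallel element of `R` leaves `V` and is uniquely represented. -/
lemma exists_unique_sum {V R : Finset E3} (hRV : R ⊆ V) (hsymm : ∀ n ∈ R, -n ∈ R)
    (hR0 : (0 : E3) ∉ R) (hR : R.Nonempty) {A B Θ : E3} (hA : A ∉ R) (hAB : A ≠ B)
    (hΘA : inner ℝ Θ A = 1) (hΘB : inner ℝ Θ B = 1)
    (hΘ : ∀ n ∈ V, n ≠ A → n ≠ B → inner ℝ Θ n < 1) :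
    ∃ m ∈ R, ∃ a, (a = A ∨ a = B) ∧ (∀ c : ℝ, m ≠ c • a) ∧ a + m ∉ V ∧ a + m ≠ 0 ∧
      ∀ k ∈ V, ∀ l ∈ R, k + l = a + m → k = a ∧ l = m := by
  classical
  by_contra! hcon
  have hle : ∀ n ∈ V, inner ℝ Θ n ≤ 1 := fun n hn => by
    by_cases h1 : n = A
    · rw [h1, hΘA]
    by_cases h2 : n = B
    · rw [h2, hΘB]
    exact (hΘ n hn h1 h2).le
  -- With `m` on the highest level `h` of `R`, the sum `A + m` or `B + m` can only be rewritten with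
  -- `A` or `B` and another element of that level, which reduces the question to the direction `B -
  -- A`.
  obtain ⟨m0, hm0, hm0max⟩ := R.exists_max_image (fun n => inner ℝ Θ n) hR
  set h := inner ℝ Θ m0 with hh
  have hh0 : 0 ≤ h := by
    have := hm0max _ (hsymm m0 hm0)
    simp only [inner_neg_right] at this
    linarith
  set M := R.filter (fun n => inner ℝ Θ n = h) with hM
  have hMR : ∀ {n}, n ∈ M → n ∈ R := fun hn => (Finset.mem_filter.mp hn).1
  have hMh : ∀ {n}, n ∈ M → inner ℝ Θ n = h := fun hn => (Finset.mem_filter.mp hn).2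
  have hm0M : m0 ∈ M := Finset.mem_filter.mpr ⟨hm0, rfl⟩
  set l := fun n : E3 => inner ℝ (B - A) n with hl
  have hd : 0 < l B - l A := by
    simp only [hl]
    rw [← inner_sub_right, real_inner_self_eq_norm_sq]
    have := norm_pos_iff.mpr (sub_ne_zero.mpr hAB.symm)
    positivity
  -- representations of `A + m` and `B + m` for `m ∈ M`
  have hrep : ∀ a, inner ℝ Θ a = 1 → ∀ m ∈ M, ∀ k ∈ V, ∀ r ∈ R, k + r = a + m →
      (k = A ∨ k = B) ∧ r ∈ M := by
    intro a ha m hm k hk r hr hkr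
    have h1 : inner ℝ Θ k + inner ℝ Θ r = 1 + h := by
      rw [← inner_add_right, hkr, inner_add_right, ha, hMh hm]
    have h2 := hle k hk
    have h3 := hm0max r hr
    refine ⟨?_, Finset.mem_filter.mpr ⟨hr, by linarith⟩⟩
    by_contra! h4
    have := hΘ k hk h4.1 h4.2
    linarith
  have hadd : ∀ {x y z w : E3}, x + y = z + w → l x + l y = l z + l w := by
    intro x y z w hx
    simp only [hl, ← inner_add_right, hx]
  have hl0 : h = 0 → ∀ n ∈ M, -n ∈ M := by
    intro h0 n hn
    refine Finset.mem_filter.mpr ⟨hsymm n (hMR hn), ?_⟩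
    rw [inner_neg_right, hMh hn, h0, neg_zero]
  -- extreme elements of `M`
  obtain ⟨m1, hm1, hm1min⟩ := M.exists_min_image l ⟨m0, hm0M⟩
  obtain ⟨m2, hm2, hm2max⟩ := M.exists_max_image l ⟨m0, hm0M⟩
  have hl1 : h = 0 → l m1 ≤ 0 := fun h0 => by
    have := hm1min _ (hl0 h0 m1 hm1)
    simp only [hl, inner_neg_right] at this ⊢; linarith
  have hl2 : h = 0 → 0 ≤ l m2 := fun h0 => by
    have := hm2max _ (hl0 h0 m2 hm2)
    simp only [hl, inner_neg_right] at this ⊢; linarith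
  have hne0 : ∀ a, inner ℝ Θ a = 1 → ∀ m ∈ M, a + m ≠ 0 := by
    intro a ha m hm h'
    have : inner ℝ Θ (a + m) = 1 + h := by rw [inner_add_right, ha, hMh hm]
    rw [h', inner_zero_right] at this
    linarith
  have hnV : ∀ a, inner ℝ Θ a = 1 → ∀ m ∈ M, a + m ∈ V → h = 0 ∧ (a + m = A ∨ a + m = B) := by
    intro a ha m hm h'
    have h1 : inner ℝ Θ (a + m) = 1 + h := by rw [inner_add_right, ha, hMh hm]
    have h2 := hle _ h'
    refine ⟨by linarith, ?_⟩
    by_contra! h4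
    have := hΘ _ h' h4.1 h4.2
    linarith
  have hsm : ∀ a, inner ℝ Θ a = 1 → ∀ m ∈ M, (∃ c : ℝ, m = c • a) → m = h • a := by
    rintro a ha m hm ⟨c, rfl⟩
    have := hMh hm
    rw [inner_smul_right, ha, mul_one] at this
    rw [this]
  -- A second representation of `A + m1` would use `B` and an element below the lowest one. The sum
  -- is therefore unique, and the contradiction assumption leaves only the parallel case. The same
  -- holds for `B + m2`.
  have hmA : m1 = h • A := by
    apply hsm A hΘA m1 hm1
    by_contra! hpar
    obtain ⟨k, hk, r, hr, hkr, hne⟩ := hcon m1 (hMR hm1) A (Or.inl rfl) hpar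
      (by
        intro h'
        obtain ⟨h0, h4 | h4⟩ := hnV A hΘA m1 hm1 h'
        · exact hR0 ((add_eq_left.mp h4) ▸ hMR hm1)
        · have := hl1 h0
          have h5 : l A + l m1 = l B := by simp only [hl, ← inner_add_right, h4]
          linarith) (hne0 A hΘA m1 hm1)
    obtain ⟨hk' | hk', hrM⟩ := hrep A hΘA m1 hm1 k hk r hr hkr
    · exact hne hk' (by rw [hk'] at hkr; exact add_left_cancel hkr)
    · have h1 := hadd hkr
      have h2 := hm1min r hrM
      rw [hk'] at h1
      linarith
  have hmB : m2 = h • B := by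
    apply hsm B hΘB m2 hm2
    by_contra! hpar
    obtain ⟨k, hk, r, hr, hkr, hne⟩ := hcon m2 (hMR hm2) B (Or.inr rfl) hpar
      (by
        intro h'
        obtain ⟨h0, h4 | h4⟩ := hnV B hΘB m2 hm2 h'
        · have := hl2 h0
          have h5 : l B + l m2 = l A := by simp only [hl, ← inner_add_right, h4]
          linarith
        · exact hR0 ((add_eq_left.mp h4) ▸ hMR hm2)) (hne0 B hΘB m2 hm2)
    obtain ⟨hk' | hk', hrM⟩ := hrep B hΘB m2 hm2 k hk r hr hkr
    · have h1 := hadd hkr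
      have h2 := hm2max r hrM
      rw [hk'] at h1
      linarith
    · exact hne hk' (by rw [hk'] at hkr; exact add_left_cancel hkr)
  have hhpos : 0 < h := by
    refine lt_of_le_of_ne hh0 fun h' => hR0 ?_
    rw [← h', zero_smul] at hmA
    exact hmA ▸ hMR hm1
  have hh1 : h < 1 := by
    refine lt_of_le_of_ne (hle _ (hRV hm0)) fun h' => hA ?_
    rw [h', one_smul] at hmA
    exact hmA ▸ hMR hm1
  have hm12 : m2 ≠ m1 := by
    rw [hmA, hmB]
    intro h'
    exact hAB (smul_right_injective _ hhpos.ne' h').symm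
  -- The second lowest element `m3` is not parallel to `A`. A rival `B + r = A + m3` forces `r =
  -- m1`, so `m3` exceeds `m1` by the full gap `l B - l A`. But `m3` is at most `m2 = h • B`, which
  -- exceeds `m1 = h • A` by only `h < 1` times that gap.
  obtain ⟨m3, hm3, hm3min⟩ := (M.erase m1).exists_min_image l
    ⟨m2, Finset.mem_erase.mpr ⟨hm12, hm2⟩⟩
  obtain ⟨hm31, hm3M⟩ := Finset.mem_erase.mp hm3
  have hpar : ∀ c : ℝ, m3 ≠ c • A := fun c hc =>
    hm31 ((hsm A hΘA m3 hm3M ⟨c, hc⟩).trans hmA.symm)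
  obtain ⟨k, hk, r, hr, hkr, hne⟩ := hcon m3 (hMR hm3M) A (Or.inl rfl) hpar
    (fun h' => hhpos.ne' (hnV A hΘA m3 hm3M h').1) (hne0 A hΘA m3 hm3M)
  obtain ⟨hk' | hk', hrM⟩ := hrep A hΘA m3 hm3M k hk r hr hkr
  · exact hne hk' (by rw [hk'] at hkr; exact add_left_cancel hkr)
  · have h1 := hadd hkr
    rw [hk'] at h1
    have hr1 : r = m1 := by
      by_contra hr1
      have := hm3min r (Finset.mem_erase.mpr ⟨hr1, hrM⟩)
      linarith
    have h2 := hm3min m2 (Finset.mem_erase.mpr ⟨hm12, hm2⟩)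
    have h3 : l m2 = h * l B := by rw [hmB]; simp only [hl, inner_smul_right]
    have h4 : l m1 = h * l A := by rw [hmA]; simp only [hl, inner_smul_right]
    rw [hr1] at h1
    nlinarith

/-! ### Supporting functionals, hull chains and facets -/

/-- Take the least ratio `h v / d v` over the points with `d v > 0`. With `h` the slack of a
supporting functional, this is the amount by which it can be rotated in the direction `d` before it
meets a further point. -/
lemma exists_tangent {ι : Type*} (V : Finset ι) (h d : ι → ℝ) (hh : ∀ v ∈ V, 0 ≤ h v)
    (hd : ∃ v ∈ V, 0 < d v) :
    ∃ t, 0 ≤ t ∧ (∀ v ∈ V, t * d v ≤ h v) ∧ ∃ v ∈ V, 0 < d v ∧ h v = t * d v := by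
  classical
  obtain ⟨v, hv, hvd⟩ := hd
  obtain ⟨w, hw, hmin⟩ := (V.filter (fun v => 0 < d v)).exists_min_image (fun v => h v / d v)
    ⟨v, Finset.mem_filter.mpr ⟨hv, hvd⟩⟩
  obtain ⟨hwV, hwd⟩ := Finset.mem_filter.mp hw
  refine ⟨h w / d w, div_nonneg (hh w hwV) hwd.le, fun u hu => ?_, w, hwV, hwd, by field_simp⟩
  by_cases hud : 0 < d u
  · exact (le_div_iff₀ hud).mp (hmin u (Finset.mem_filter.mpr ⟨hu, hud⟩))
  · exact (mul_nonpos_of_nonneg_of_nonpos (div_nonneg (hh w hwV) hwd.le) (not_lt.mp hud)).trans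
      (hh u hu)

/-- Induction along the upper hull of a finite planar point set. -/
lemma upper_hull_induction {ι : Type*} (V : Finset ι) (f g : ι → ℝ) (P : ι → Prop)
    (step : ∀ p ∈ V, ∀ q ∈ V, P p → g p < g q →
      (∃ s : ℝ, (∀ v ∈ V, f v + s * g v ≤ f p + s * g p) ∧ f q + s * g q = f p + s * g p ∧
        ∀ v ∈ V, f v + s * g v = f p + s * g p → g p ≤ g v ∧ g v ≤ g q) → P q)
    (b : ι) (hb : b ∈ V) (hPb : P b) (hbg : ∀ v ∈ V, g b ≤ g v)
    (hbf : ∀ v ∈ V, g v = g b → f v ≤ f b) :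
    ∃ T ∈ V, P T ∧ (∀ v ∈ V, g v ≤ g T) ∧ ∀ v ∈ V, g v = g T → f v ≤ f T := by
  classical
  -- Gift wrapping, by induction on the number of points beyond `b`. The invariant says that `b` is
  -- topmost on its vertical line and is either leftmost or the far end of a supporting line with
  -- parameter `s0`. In the latter case the next parameter exceeds `s0`, so the points to the left
  -- stay below the new line.
  have main : ∀ n : ℕ, ∀ b ∈ V, P b → (V.filter (fun v => g b < g v)).card = n →
      ((∀ v ∈ V, g v = g b → f v ≤ f b) ∧ ((∀ v ∈ V, g b ≤ g v) ∨
        ∃ s0 : ℝ, ∀ v ∈ V, f v + s0 * g v ≤ f b + s0 * g b ∧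
          (f v + s0 * g v = f b + s0 * g b → g v ≤ g b))) →
      ∃ T ∈ V, P T ∧ (∀ v ∈ V, g v ≤ g T) ∧ ∀ v ∈ V, g v = g T → f v ≤ f T := by
    intro n
    induction n using Nat.strong_induction_on with
    | _ n ih =>
    intro b hb hPb hcard hinv
    by_cases hemp : ∀ v ∈ V, g v ≤ g b
    · exact ⟨b, hb, hPb, hemp, hinv.1⟩
    push Not at hemp
    obtain ⟨v0, hv0, hgv0⟩ := hemp
    set W := V.filter (fun v => g b < g v) with hW
    obtain ⟨w, hw, hwmin⟩ := W.exists_min_image (fun v => (f b - f v) / (g v - g b))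
      ⟨v0, Finset.mem_filter.mpr ⟨hv0, hgv0⟩⟩
    obtain ⟨hwV, hwg⟩ := Finset.mem_filter.mp hw
    set s := (f b - f w) / (g w - g b) with hs
    have hws : f w + s * g w = f b + s * g b := by
      have : g w - g b ≠ 0 := by linarith
      rw [hs]; field_simp; ring
    have hsW : ∀ v ∈ V, g b < g v → f v + s * g v ≤ f b + s * g b := by
      intro v hv hvg
      have h1 := hwmin v (Finset.mem_filter.mpr ⟨hv, hvg⟩)
      have h2 := (le_div_iff₀ (by linarith : 0 < g v - g b)).mp h1
      linarith
    have hsL : ∀ v ∈ V, g v < g b → f v + s * g v < f b + s * g b := by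
      intro v hv hvg
      rcases hinv.2 with h | ⟨s0, h⟩
      · exact absurd (h v hv) (not_le.mpr hvg)
      · have h1 := (h v hv).1
        have h2 := (h w hwV).1
        have h3 : f w + s0 * g w ≠ f b + s0 * g b := fun h' => by
          have := (h w hwV).2 h'; linarith
        have h4 : f w + s0 * g w < f b + s0 * g b := lt_of_le_of_ne h2 h3
        have h5 : s0 < s := by nlinarith
        nlinarith
    have hsE : ∀ v ∈ V, g v = g b → f v + s * g v ≤ f b + s * g b := by
      intro v hv hvg
      have := hinv.1 v hv hvg
      rw [hvg]; linarith
    have hsle : ∀ v ∈ V, f v + s * g v ≤ f b + s * g b := by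
      intro v hv
      rcases lt_trichotomy (g v) (g b) with h | h | h
      · exact (hsL v hv h).le
      · exact hsE v hv h
      · exact hsW v hv h
    -- The farthest point on the new supporting line is chosen, so that the whole edge is traversed
    -- in one step.
    obtain ⟨q, hq, hqmax⟩ := (V.filter (fun v => f v + s * g v = f b + s * g b)).exists_max_image g
      ⟨w, Finset.mem_filter.mpr ⟨hwV, hws⟩⟩
    obtain ⟨hqV, hqs⟩ := Finset.mem_filter.mp hq
    have hgq : g b < g q := lt_of_lt_of_le hwg (hqmax w (Finset.mem_filter.mpr ⟨hwV, hws⟩))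
    have hqtie : ∀ v ∈ V, f v + s * g v = f b + s * g b → g b ≤ g v ∧ g v ≤ g q := by
      intro v hv hvs
      refine ⟨?_, hqmax v (Finset.mem_filter.mpr ⟨hv, hvs⟩)⟩
      by_contra hlt
      exact (hsL v hv (not_le.mp hlt)).ne hvs
    have hPq := step b hb q hqV hPb hgq ⟨s, hsle, hqs, hqtie⟩
    refine ih _ ?_ q hqV hPq rfl ⟨?_, Or.inr ⟨s, fun v hv => ⟨?_, ?_⟩⟩⟩
    · rw [← hcard]
      apply Finset.card_lt_card
      refine ⟨fun v hv => ?_, fun h => ?_⟩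
      · obtain ⟨h1, h2⟩ := Finset.mem_filter.mp hv
        exact Finset.mem_filter.mpr ⟨h1, hgq.trans h2⟩
      · exact lt_irrefl _ (Finset.mem_filter.mp (h (Finset.mem_filter.mpr ⟨hqV, hgq⟩))).2
    · intro v hv hvg
      have := hsle v hv
      rw [← hqs, hvg] at this
      linarith
    · rw [hqs]; exact hsle v hv
    · rw [hqs]; exact fun h => (hqtie v hv h).2
  exact main _ b hb hPb rfl ⟨hbf, Or.inl hbg⟩

/-- Tilt `θ` to `θ + ε N`. A small `ε` keeps the points off the face below level 1, and on the face
the tilt singles out the zero set of `N`. -/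
lemma isEdge_of_face {S : Finset E3} {θ N p q : E3} (hp : p ∈ S) (hq : q ∈ S) (hpq : p ≠ q)
    (hθ : ∀ n ∈ S, inner ℝ θ n ≤ (1 : ℝ)) (hθp : inner ℝ θ p = (1 : ℝ)) (hθq : inner ℝ θ q = (1 : ℝ))
    (hN : ∀ n ∈ S, inner ℝ θ n = (1 : ℝ) → inner ℝ N n ≤ (0 : ℝ)) (hNp : inner ℝ N p = (0 : ℝ))
    (hNq : inner ℝ N q = (0 : ℝ))
    (hseg : ∀ n ∈ S, inner ℝ θ n = (1 : ℝ) → inner ℝ N n = (0 : ℝ) → n ∈ segment ℝ p q) :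
    IsEdge S p q := by
  classical
  have hε : ∃ ε : ℝ, 0 < ε ∧ ∀ n ∈ S, inner ℝ θ n < (1 : ℝ) →
      ε * inner ℝ N n < 1 - inner ℝ θ n := by
    have hev : ∀ n ∈ S, ∀ᶠ ε : ℝ in nhdsWithin 0 (Set.Ioi 0), inner ℝ θ n < (1 : ℝ) →
        ε * inner ℝ N n < 1 - inner ℝ θ n := by
      intro n _
      by_cases h : inner ℝ θ n < (1 : ℝ)
      · have hc : Filter.Tendsto (fun ε : ℝ => ε * inner ℝ N n) (nhds 0) (nhds (0 * inner ℝ N n)) :=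
          (continuous_id.mul continuous_const).tendsto 0
        rw [zero_mul] at hc
        have := (hc.mono_left (nhdsWithin_le_nhds (s := Set.Ioi 0))).eventually
          (gt_mem_nhds (by linarith : (0 : ℝ) < 1 - inner ℝ θ n))
        exact this.mono fun ε hε _ => hε
      · exact Filter.Eventually.of_forall fun ε h' => absurd h' h
    have hall := (Filter.eventually_all_finset S).mpr hev
    obtain ⟨ε, h1, h2⟩ := (hall.and self_mem_nhdsWithin).exists
    exact ⟨ε, h2, h1⟩
  obtain ⟨ε, hε0, hε⟩ := hε
  refine ⟨hp, hq, hpq, θ + ε • N, ?_, ?_, fun n hn => ?_⟩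
  · rw [inner_add_left, real_inner_smul_left, hθp, hNp]; ring
  · rw [inner_add_left, real_inner_smul_left, hθq, hNq]; ring
  · rw [inner_add_left, real_inner_smul_left]
    rcases lt_or_eq_of_le (hθ n hn) with h | h
    · right
      have := hε n hn h
      linarith
    · rcases lt_or_eq_of_le (hN n hn h) with h' | h'
      · right; rw [h]; nlinarith
      · exact Or.inl (hseg n hn h h')

lemma exists_perp_ne_zero (A : E3) : ∃ d : E3, d ≠ 0 ∧ inner ℝ d A = 0 := by
  by_cases h : A 0 = 0 ∧ A 1 = 0
  · refine ⟨!₂[1, 0, 0], fun h' => ?_, ?_⟩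
    · have := congrArg (fun v : E3 => v 0) h'
      simp at this
    · rw [inner_eq3]; simp [h.1]
  · refine ⟨!₂[A 1, - A 0, 0], fun h' => h ?_, ?_⟩
    · have h0 := congrArg (fun v : E3 => v 0) h'
      have h1 := congrArg (fun v : E3 => v 1) h'
      simp at h0 h1
      exact ⟨h1, h0⟩
    · rw [inner_eq3]; simp; ring

lemma inner_cross3_cyclic (a b c : E3) : inner ℝ (cross3 a b) c = inner ℝ (cross3 c a) b := by
  simp only [inner_eq3, cross3_zero, cross3_one, cross3_two]; ring

/-- A facet of the convex hull of `S`, one of its edges, and the adjacent facet. The functional `z`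
vanishes on the edge, and is nonnegative on one facet, nonpositive on the other. -/
lemma exists_adjacent_facets {S : Finset E3} (hsymm : ∀ n ∈ S, -n ∈ S)
    (hspan : ∀ d : E3, d ≠ 0 → ∃ n ∈ S, inner ℝ d n ≠ (0 : ℝ)) :
    ∃ θ θ' z A B C C' : E3,
      (∀ n ∈ S, inner ℝ θ n ≤ (1 : ℝ)) ∧ (∀ n ∈ S, inner ℝ θ' n ≤ (1 : ℝ)) ∧
      (∀ n ∈ S, inner ℝ θ n = (1 : ℝ) → 0 ≤ inner ℝ z n) ∧
      (∀ n ∈ S, inner ℝ θ' n = (1 : ℝ) → inner ℝ z n ≤ (0 : ℝ)) ∧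
      (∀ n ∈ S, inner ℝ z n = (0 : ℝ) → (inner ℝ θ n = (1 : ℝ) ↔ inner ℝ θ' n = (1 : ℝ))) ∧
      A ∈ S ∧ B ∈ S ∧ A ≠ B ∧ inner ℝ θ A = (1 : ℝ) ∧ inner ℝ θ B = (1 : ℝ) ∧
      inner ℝ z A = (0 : ℝ) ∧ inner ℝ z B = (0 : ℝ) ∧
      C ∈ S ∧ inner ℝ θ C = (1 : ℝ) ∧ 0 < inner ℝ z C ∧
      C' ∈ S ∧ inner ℝ θ' C' = (1 : ℝ) ∧ inner ℝ z C' < (0 : ℝ) := by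
  classical
  have hpos : ∀ d : E3, d ≠ 0 → ∃ n ∈ S, 0 < inner ℝ d n := by
    intro d hd
    obtain ⟨n, hn, h⟩ := hspan d hd
    rcases lt_or_gt_of_ne h with h | h
    · exact ⟨-n, hsymm n hn, by rw [inner_neg_right]; linarith⟩
    · exact ⟨n, hn, h⟩
  have hSne : S.Nonempty := by
    obtain ⟨n, hn, _⟩ := hspan (!₂[1, 0, 0]) (fun h => by
      have := congrArg (fun v : E3 => v 0) h
      simp at this)
    exact ⟨n, hn⟩
  -- A longest frequency is a vertex, exposed by the functional `⟨A, ·⟩ / ‖A‖ ^ 2`. Rotating this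
  -- functional twice gives a facet at `A`.
  obtain ⟨A, hA, hAmax⟩ := S.exists_max_image (fun n => ‖n‖) hSne
  have hA0 : A ≠ 0 := by
    rintro rfl
    obtain ⟨n, hn, h⟩ := hspan (!₂[1, 0, 0]) (fun h => by
      have := congrArg (fun v : E3 => v 0) h
      simp at this)
    have h2 := hAmax n hn
    simp only [norm_zero, norm_le_zero_iff] at h2
    simp [h2] at h
  have hr : 0 < ‖A‖ ^ 2 := by have := norm_pos_iff.mpr hA0; positivity
  set r2 := ‖A‖ ^ 2 with hr2
  have hAn : ∀ n ∈ S, inner ℝ A n ≤ r2 := fun n hn =>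
    (real_inner_le_norm A n).trans (by
      rw [hr2, sq]; exact mul_le_mul_of_nonneg_left (hAmax n hn) (norm_nonneg _))
  have hAeq : ∀ n ∈ S, inner ℝ A n = r2 → n = A := by
    intro n hn h
    have h1 : ‖n - A‖ ^ 2 ≤ 0 := by
      rw [norm_sub_sq_real, real_inner_comm, h, ← hr2]
      have := hAmax n hn
      have : ‖n‖ ^ 2 ≤ r2 := by rw [hr2]; gcongr
      linarith
    have h2 : ‖n - A‖ = 0 := by
      have := norm_nonneg (n - A); nlinarith
    exact sub_eq_zero.mp (norm_eq_zero.mp h2)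
  have hAA : inner ℝ A A = r2 := real_inner_self_eq_norm_sq A
  -- first rotation
  obtain ⟨d1, hd1, hd1A⟩ := exists_perp_ne_zero A
  obtain ⟨t1, ht1, hθ2, B, hB, hd1B, hθ2B⟩ := exists_tangent S (fun n => 1 - inner ℝ A n / r2)
    (fun n => inner ℝ d1 n) (fun n hn => by
      have := (div_le_one hr).mpr (hAn n hn)
      linarith) (hpos d1 hd1)
  set θ2 := (1 / r2) • A + t1 • d1 with hθ2def
  have e2 : ∀ n, inner ℝ θ2 n = inner ℝ A n / r2 + t1 * inner ℝ d1 n := by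
    intro n
    rw [hθ2def, inner_add_left, real_inner_smul_left, real_inner_smul_left]; ring
  have h2le : ∀ n ∈ S, inner ℝ θ2 n ≤ (1 : ℝ) := fun n hn => by
    rw [e2]; have := hθ2 n hn; linarith
  have h2A : inner ℝ θ2 A = (1 : ℝ) := by rw [e2, hAA, hd1A, div_self hr.ne']; ring
  have h2B : inner ℝ θ2 B = (1 : ℝ) := by rw [e2]; linarith
  -- second rotation
  set d2 := cross3 A B with hd2def
  have hd2 : d2 ≠ 0 := by
    intro h
    obtain ⟨c, rfl⟩ := (cross3_eq_zero_iff hA0).mp h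
    rw [inner_smul_right, hd1A, mul_zero] at hd1B
    exact lt_irrefl _ hd1B
  have hd2A : inner ℝ d2 A = (0 : ℝ) := inner_cross3_left A B
  have hd2B : inner ℝ d2 B = (0 : ℝ) := inner_cross3_right A B
  obtain ⟨t2, ht2, hθ3, C, hC, hd2C, hθ3C⟩ := exists_tangent S (fun n => 1 - inner ℝ θ2 n)
    (fun n => inner ℝ d2 n) (fun n hn => by have := h2le n hn; linarith) (hpos d2 hd2)
  set θ := θ2 + t2 • d2 with hθdef
  have e3 : ∀ n, inner ℝ θ n = inner ℝ θ2 n + t2 * inner ℝ d2 n := by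
    intro n
    rw [hθdef, inner_add_left, real_inner_smul_left]
  have h3le : ∀ n ∈ S, inner ℝ θ n ≤ (1 : ℝ) := fun n hn => by
    rw [e3]; have := hθ3 n hn; linarith
  have h3A : inner ℝ θ A = (1 : ℝ) := by rw [e3, h2A, hd2A]; ring
  have h3B : inner ℝ θ B = (1 : ℝ) := by rw [e3, h2B, hd2B]; ring
  have h3C : inner ℝ θ C = (1 : ℝ) := by rw [e3]; linarith
  -- an edge of the facet at `A`
  set d3 := cross3 C A with hd3def
  have hd3A : inner ℝ d3 A = (0 : ℝ) := inner_cross3_right C A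
  have hd3C : inner ℝ d3 C = (0 : ℝ) := inner_cross3_left C A
  have hd3B : 0 < inner ℝ d3 B := by
    rw [hd3def, ← inner_cross3_cyclic]; exact hd2C
  set F := S.filter (fun n => inner ℝ θ n = (1 : ℝ)) with hF
  obtain ⟨t3, ht3, hz, B', hB'F, hd3B', hzB'⟩ := exists_tangent F
    (fun n => r2 * inner ℝ θ n - inner ℝ A n)
    (fun n => inner ℝ d3 n) (fun n hn => by
      obtain ⟨h1, h2⟩ := Finset.mem_filter.mp hn
      rw [h2]; have := hAn n h1; linarith) ⟨B, Finset.mem_filter.mpr ⟨hB, h3B⟩, hd3B⟩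
  obtain ⟨hB', h3B'⟩ := Finset.mem_filter.mp hB'F
  -- On the facet `θ = 1` this functional is the slack left after the rotation. It vanishes at `A`
  -- and `B'`, and it is positive at `C` because `d3` vanishes there and `A` alone maximizes `⟨A,
  -- ·⟩`.
  set z := r2 • θ - A - t3 • d3 with hzdef
  have ez : ∀ n, inner ℝ z n = r2 * inner ℝ θ n - inner ℝ A n - t3 * inner ℝ d3 n := by
    intro n
    rw [hzdef, inner_sub_left, inner_sub_left, real_inner_smul_left, real_inner_smul_left]
  have hzF : ∀ n ∈ S, inner ℝ θ n = (1 : ℝ) → 0 ≤ inner ℝ z n := by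
    intro n hn h
    rw [ez]; have := hz n (Finset.mem_filter.mpr ⟨hn, h⟩); linarith
  have hzA : inner ℝ z A = (0 : ℝ) := by rw [ez, h3A, hAA, hd3A]; ring
  have hzB : inner ℝ z B' = (0 : ℝ) := by rw [ez]; linarith
  have hCA : C ≠ A := by rintro rfl; rw [hd2A] at hd2C; exact lt_irrefl _ hd2C
  have hzC : 0 < inner ℝ z C := by
    rw [ez, h3C, hd3C]
    have := lt_of_le_of_ne (hAn C hC) fun h => hCA (hAeq C hC h)
    linarith
  -- the adjacent facet
  obtain ⟨t4, ht4, hθ', C', hC', hzC', hθ'C'⟩ := exists_tangent S (fun n => 1 - inner ℝ θ n)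
    (fun n => - inner ℝ z n) (fun n hn => by have := h3le n hn; linarith)
    ⟨-C, hsymm C hC, by rw [inner_neg_right]; linarith⟩
  set θ' := θ - t4 • z with hθ'def
  have e4 : ∀ n, inner ℝ θ' n = inner ℝ θ n - t4 * inner ℝ z n := by
    intro n
    rw [hθ'def, inner_sub_left, real_inner_smul_left]
  have ht4' : 0 < t4 := by
    refine lt_of_le_of_ne ht4 fun h => ?_
    rw [← h, zero_mul] at hθ'C'
    have := hzF C' hC' (by linarith)
    linarith
  refine ⟨θ, θ', z, A, B', C, C', h3le, ?_, hzF, ?_, ?_, hA, hB', ?_, h3A, h3B', hzA, hzB, hC, h3C,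
    hzC, hC', ?_, by linarith⟩
  · intro n hn
    rw [e4]; have := hθ' n hn; linarith
  · intro n hn h
    by_contra hlt
    push Not at hlt
    rw [e4] at h
    have := h3le n hn
    nlinarith
  · intro n _ h
    rw [e4, h, mul_zero, sub_zero]
  · rintro rfl
    rw [hd3A] at hd3B'
    exact lt_irrefl _ hd3B'
  · rw [e4]; linarith

/-- A facet lying in a quarter space, with an edge in one of the two bounding planes. -/
lemma exists_facet_quarter {S : Finset E3} (hsymm : ∀ n ∈ S, -n ∈ S)
    (hspan : ∀ d : E3, d ≠ 0 → ∃ n ∈ S, inner ℝ d n ≠ (0 : ℝ)) :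
    ∃ θ x z A B C : E3, ‖x‖ = 1 ∧ ‖z‖ = 1 ∧ inner ℝ z x = (0 : ℝ) ∧
      (∀ n ∈ S, inner ℝ θ n ≤ (1 : ℝ)) ∧
      (∀ n ∈ S, inner ℝ θ n = (1 : ℝ) →
        0 ≤ inner ℝ z n ∧ 0 ≤ inner ℝ x n ∧ (inner ℝ z n = (0 : ℝ) → 0 < inner ℝ x n)) ∧
      A ∈ S ∧ B ∈ S ∧ A ≠ B ∧ inner ℝ θ A = (1 : ℝ) ∧ inner ℝ θ B = (1 : ℝ) ∧
      inner ℝ z A = (0 : ℝ) ∧ inner ℝ z B = (0 : ℝ) ∧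
      C ∈ S ∧ inner ℝ θ C = (1 : ℝ) ∧ 0 < inner ℝ z C := by
  obtain ⟨θ, θ', z, A, B, C, C', hθ, hθ', hz, hz', hzz, hA, hB, hAB, hθA, hθB, hzA, hzB, hC, hθC,
    hzC, hC', hθC', hzC'⟩ := exists_adjacent_facets hsymm hspan
  -- Exchanging the two facets replaces `z` by `-z`, so one of the two choices has the required
  -- sign.
  wlog hle : inner ℝ z (θ + θ') ≤ (0 : ℝ) generalizing θ θ' z C C' with W
  · refine W θ' θ (-z) C' C hθ' hθ ?_ ?_ ?_ ?_ ?_ ?_ ?_ hC' hθC' ?_ hC hθC ?_ ?_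
    · intro n hn h; rw [inner_neg_left]; have := hz' n hn h; linarith
    · intro n hn h; rw [inner_neg_left]; have := hz n hn h; linarith
    · intro n hn h
      rw [inner_neg_left, neg_eq_zero] at h
      exact (hzz n hn h).symm
    · exact (hzz A hA hzA).mp hθA
    · exact (hzz B hB hzB).mp hθB
    · rw [inner_neg_left, hzA, neg_zero]
    · rw [inner_neg_left, hzB, neg_zero]
    · rw [inner_neg_left]; linarith
    · rw [inner_neg_left]; linarith
    · rw [inner_neg_left, add_comm]; linarith
  have hz0 : z ≠ 0 := by rintro rfl; simp at hzC
  have hzn : 0 < ‖z‖ := norm_pos_iff.mpr hz0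
  -- The component of `θ + θ'` orthogonal to `z`. On the facet `θ = 1` it is nonnegative: symmetry
  -- of `S` gives `θ' ≥ -1`, and the correction has the right sign by `hle`. On the common edge its
  -- value is 2.
  set x := (θ + θ') - (inner ℝ z (θ + θ') / ‖z‖ ^ 2) • z with hx
  have ex : ∀ n, inner ℝ x n =
      inner ℝ θ n + inner ℝ θ' n - inner ℝ z (θ + θ') / ‖z‖ ^ 2 * inner ℝ z n := by
    intro n
    rw [hx, inner_sub_left, inner_add_left, real_inner_smul_left]
  have hxz : inner ℝ z x = (0 : ℝ) := by
    rw [hx, inner_sub_right, real_inner_smul_right, real_inner_self_eq_norm_sq]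
    field_simp; ring
  have hge : ∀ n ∈ S, -1 ≤ inner ℝ θ' n := by
    intro n hn
    have := hθ' _ (hsymm n hn)
    rw [inner_neg_right] at this; linarith
  have hc : inner ℝ z (θ + θ') / ‖z‖ ^ 2 ≤ 0 := div_nonpos_of_nonpos_of_nonneg hle (by positivity)
  have hxF : ∀ n ∈ S, inner ℝ θ n = (1 : ℝ) → 0 ≤ inner ℝ x n := by
    intro n hn h
    rw [ex, h]
    have h1 := hge n hn
    have h2 := mul_nonneg_of_nonpos_of_nonpos hc (neg_nonpos.mpr (hz n hn h))
    linarith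
  have hxE : ∀ n ∈ S, inner ℝ θ n = (1 : ℝ) → inner ℝ z n = (0 : ℝ) → 0 < inner ℝ x n := by
    intro n hn h h0
    rw [ex, h, h0, (hzz n hn h0).mp h]; norm_num
  have hx0 : x ≠ 0 := by
    intro h
    have := hxE A hA hθA hzA
    rw [h, inner_zero_left] at this
    exact lt_irrefl _ this
  have hxn : 0 < ‖x‖ := norm_pos_iff.mpr hx0
  refine ⟨θ, ‖x‖⁻¹ • x, ‖z‖⁻¹ • z, A, B, C, ?_, ?_, ?_, hθ, fun n hn h => ⟨?_, ?_, fun h0 => ?_⟩,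
    hA, hB, hAB, hθA, hθB, ?_, ?_, hC, hθC, ?_⟩
  · rw [norm_smul, norm_inv, norm_norm, inv_mul_cancel₀ hxn.ne']
  · rw [norm_smul, norm_inv, norm_norm, inv_mul_cancel₀ hzn.ne']
  · rw [real_inner_smul_left, real_inner_smul_right, hxz]; simp
  · rw [real_inner_smul_left]; exact mul_nonneg (by positivity) (hz n hn h)
  · rw [real_inner_smul_left]; exact mul_nonneg (by positivity) (hxF n hn h)
  · rw [real_inner_smul_left] at h0 ⊢
    have h1 := (mul_eq_zero.mp h0).resolve_left (by positivity)
    exact mul_pos (by positivity) (hxE n hn h h1)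
  · rw [real_inner_smul_left, hzA, mul_zero]
  · rw [real_inner_smul_left, hzB, mul_zero]
  · rw [real_inner_smul_left]; exact mul_pos (by positivity) hzC

/-! ### Holonomy of a polygon in a quarter space -/

open ComplexConjugate in
lemma im_mul_mul_conj (w₁ w₂ w₃ : ℂ) : (w₁ * w₂ * conj w₃).im =
    ‖w₁‖ * ‖w₂‖ * ‖w₃‖ * Real.sin (w₁.arg + w₂.arg - w₃.arg) := by
  have h : w₁ * w₂ * conj w₃ = ((‖w₁‖ * ‖w₂‖ * ‖w₃‖ : ℝ) : ℂ) *
      Complex.exp (((w₁.arg + w₂.arg - w₃.arg : ℝ) : ℂ) * Complex.I) := by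
    conv_lhs => rw [← Complex.norm_mul_exp_arg_mul_I w₁, ← Complex.norm_mul_exp_arg_mul_I w₂,
      ← Complex.norm_mul_exp_arg_mul_I w₃]
    rw [map_mul, Complex.conj_ofReal, ← Complex.exp_conj, map_mul, Complex.conj_I,
      Complex.conj_ofReal]
    push_cast
    rw [show ((w₁.arg : ℂ) + w₂.arg - w₃.arg) * Complex.I = w₁.arg * Complex.I +
      w₂.arg * Complex.I + w₃.arg * -Complex.I by ring, Complex.exp_add, Complex.exp_add]
    ring
  rw [h, Complex.im_ofReal_mul, Complex.exp_ofReal_mul_I_im]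

section
open ComplexConjugate

lemma arg_nonneg_of {w : ℂ} (h : 0 ≤ w.im) : 0 ≤ w.arg := Complex.arg_nonneg_iff.mpr h

lemma arg_le_of {w : ℂ} (h : 0 ≤ w.re) : w.arg ≤ Real.pi / 2 :=
  (abs_le.mp (Complex.abs_arg_le_pi_div_two_iff.mpr h)).2

lemma arg_lt_of {w : ℂ} (h : 0 < w.re) : w.arg < Real.pi / 2 :=
  (abs_lt.mp (Complex.abs_arg_lt_pi_div_two_iff.mpr (Or.inl h))).2

/-- The sign conditions keep `w₁.arg + w₂.arg - w₃.arg` below π. If it were positive, its sine would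
be positive too, against the sign of the imaginary part. -/
lemma arg_add_le {w₁ w₂ w₃ : ℂ} (h1 : 0 < w₁.re) (h1' : 0 ≤ w₁.im) (h2 : 0 ≤ w₂.re)
    (h20 : w₂ ≠ 0) (h3' : 0 ≤ w₃.im) (h30 : w₃ ≠ 0)
    (h : (w₁ * w₂ * conj w₃).im ≤ 0) : w₁.arg + w₂.arg ≤ w₃.arg := by
  have h10 : w₁ ≠ 0 := by rintro rfl; simp at h1
  rw [im_mul_mul_conj] at h
  by_contra! hlt
  have := Real.sin_pos_of_pos_of_lt_pi (x := w₁.arg + w₂.arg - w₃.arg) (by linarith)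
    (by linarith [arg_lt_of h1, arg_le_of h2, arg_nonneg_of h3'])
  have := mul_pos (mul_pos (mul_pos (norm_pos_iff.mpr h10) (norm_pos_iff.mpr h20))
    (norm_pos_iff.mpr h30)) this
  linarith

lemma arg_add_lt {w₁ w₂ w₃ : ℂ} (h1 : 0 ≤ w₁.re) (h2 : 0 ≤ w₂.re) (h3' : 0 ≤ w₃.im)
    (h : (w₁ * w₂ * conj w₃).im < 0) : w₁.arg + w₂.arg < w₃.arg := by
  rw [im_mul_mul_conj] at h
  by_contra! hlt
  have := Real.sin_nonneg_of_nonneg_of_le_pi (x := w₁.arg + w₂.arg - w₃.arg) (by linarith)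
    (by linarith [arg_le_of h1, arg_le_of h2, arg_nonneg_of h3'])
  have := mul_nonneg (mul_nonneg (mul_nonneg (norm_nonneg w₁) (norm_nonneg w₂))
    (norm_nonneg w₃)) this
  linarith

lemma le_arg_add {w₁ w₂ w₃ : ℂ} (h1' : 0 ≤ w₁.im) (h10 : w₁ ≠ 0)
    (h2' : 0 ≤ w₂.im) (h20 : w₂ ≠ 0) (h3 : 0 ≤ w₃.re) (h30 : w₃ ≠ 0)
    (h : 0 ≤ (w₁ * w₂ * conj w₃).im) : w₃.arg ≤ w₁.arg + w₂.arg := by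
  rw [im_mul_mul_conj] at h
  by_contra! hlt
  have := Real.sin_neg_of_neg_of_neg_pi_lt (x := w₁.arg + w₂.arg - w₃.arg) (by linarith)
    (by linarith [arg_nonneg_of h1', arg_nonneg_of h2', arg_le_of h3, Real.pi_pos])
  have := mul_pos (mul_pos (mul_pos (norm_pos_iff.mpr h10) (norm_pos_iff.mpr h20))
    (norm_pos_iff.mpr h30)) (neg_pos.mpr this)
  linarith

/-- The holonomy factor between two stereographic parameters. -/
noncomputable def turn (c d : ℂ) : ℂ := 1 + conj c * d

lemma turn_re_pos {c d : ℂ} (hc : 0 ≤ c.re) (hc' : 0 ≤ c.im) (hd : 0 ≤ d.re) (hd' : 0 ≤ d.im) :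
    0 < (turn c d).re := by
  simp only [turn, Complex.add_re, Complex.one_re, Complex.mul_re, Complex.conj_re,
    Complex.conj_im]
  nlinarith [mul_nonneg hc hd, mul_nonneg hc' hd']

lemma turn_im (c d : ℂ) : (turn c d).im = (conj c * d).im := by
  simp [turn]

/-- For `w = turn c d` the argument is half the signed area of the spherical triangle with vertices
at the stereographic centre, `c` and `d`. The factor 4 thus makes the phase change twice the area.
-/
lemma eq_mul_exp_of_turn {w ρ ρ' : ℂ} (hw : w ≠ 0) (h : ρ' * w ^ 2 = ρ * conj w ^ 2) :
    ρ' = ρ * Complex.exp (-4 * (w.arg : ℂ) * Complex.I) := by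
  obtain ⟨t, ht⟩ : ∃ t, t = w.arg := ⟨_, rfl⟩
  have hw' : w = (‖w‖ : ℂ) * Complex.exp (t * Complex.I) := by
    rw [ht]; exact (Complex.norm_mul_exp_arg_mul_I w).symm
  rw [← ht]
  have hc : conj w = (‖w‖ : ℂ) * Complex.exp (-(t * Complex.I)) := by
    conv_lhs => rw [hw']
    rw [map_mul, Complex.conj_ofReal, ← Complex.exp_conj, map_mul, Complex.conj_I,
      Complex.conj_ofReal, mul_neg]
  have h2 : conj w ^ 2 = w ^ 2 * Complex.exp (-4 * (t : ℂ) * Complex.I) := by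
    rw [hc]
    conv_rhs => arg 1; rw [hw']
    rw [mul_pow, mul_pow, mul_assoc, ← Complex.exp_nat_mul, ← Complex.exp_nat_mul,
      ← Complex.exp_add]
    congr 2
    push_cast; ring
  rw [h2] at h
  have hw2 := pow_ne_zero 2 hw
  apply mul_right_cancel₀ hw2
  rw [h]; ring

lemma ne_zero_of_re_pos {w : ℂ} (h : 0 < w.re) : w ≠ 0 := by rintro rfl; simp at h

variable {ι : Type*}

/-- One chain of a polygon: the accumulated holonomy along the upper boundary. -/
lemma upper_chain (V : Finset ι) (f g : ι → ℝ) (c ρ : ι → ℂ) {A B : ι} (hA : A ∈ V) (hB : B ∈ V)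
    (hgA : g A = 0) (hgB : g B = 0) (hg0 : ∀ v ∈ V, 0 ≤ g v) (hBf : ∀ v ∈ V, g v = 0 → f v ≤ f B)
    (hre : ∀ v ∈ V, 0 ≤ (c v).re) (him : ∀ v ∈ V, 0 ≤ (c v).im)
    (him0 : ∀ v ∈ V, 0 < g v → 0 < (c v).im)
    (hcA : (c A).im = 0) (hcB : (c B).im = 0) (hBA : (c B).re < (c A).re)
    (hIm : ∀ p ∈ V, ∀ q ∈ V, g p < g q → 0 < (conj (c p) * c q).im)
    (hdet : ∀ p ∈ V, ∀ q ∈ V, (g p - g A) * f q + (g q - g p) * f A + (g A - g q) * f p ≤ 0 →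
      (turn (c A) (c p) * turn (c p) (c q) * conj (turn (c A) (c q))).im ≤ 0)
    (hedge : ∀ p ∈ V, ∀ q ∈ V, g p < g q →
      (∃ s : ℝ, (∀ v ∈ V, f v + s * g v ≤ f p + s * g p) ∧ f q + s * g q = f p + s * g p ∧
        ∀ v ∈ V, f v + s * g v = f p + s * g p → g p ≤ g v ∧ g v ≤ g q) →
      ρ q * turn (c p) (c q) ^ 2 = ρ p * conj (turn (c p) (c q)) ^ 2) :
    ∃ T ∈ V, (∀ v ∈ V, g v ≤ g T) ∧ (∀ v ∈ V, g v = g T → f v ≤ f T) ∧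
      ∃ U : ℝ, 0 ≤ U ∧ ρ T = ρ B * Complex.exp (-4 * (U : ℂ) * Complex.I) ∧
        ((T = B ∧ U = 0) ∨ U < (turn (c A) (c T)).arg) := by
  have hmain := upper_hull_induction V f g (fun T => ∃ U : ℝ, 0 ≤ U ∧
    ρ T = ρ B * Complex.exp (-4 * (U : ℂ) * Complex.I) ∧
        ((T = B ∧ U = 0) ∨ U < (turn (c A) (c T)).arg)) ?_ B hB ⟨0, le_rfl, by simp, by simp⟩
        (fun v hv => by rw [hgB]; exact hg0 v hv) (fun v hv h => hBf v hv (by rw [h, hgB]))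
  · obtain ⟨T, hT, h1, h2, h3⟩ := hmain
    exact ⟨T, hT, h2, h3, h1⟩
  rintro p hp q hq ⟨U, hU0, hU, hU'⟩ hpq hs
  have hT := turn_re_pos (hre p hp) (him p hp) (hre q hq) (him q hq)
  have hAp := turn_re_pos (hre A hA) (him A hA) (hre p hp) (him p hp)
  have hAq := turn_re_pos (hre A hA) (him A hA) (hre q hq) (him q hq)
  have hTi : 0 ≤ (turn (c p) (c q)).im := by rw [turn_im]; exact (hIm p hp q hq hpq).le
  have key : ∀ r ∈ V, 0 ≤ (turn (c A) (c r)).im := fun r hr => by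
    rw [turn_im, Complex.mul_im, Complex.conj_re, Complex.conj_im, hcA]
    nlinarith [mul_nonneg (hre A hA) (him r hr)]
  have hgq : 0 < g q := lt_of_le_of_lt (hg0 p hp) hpq
  refine ⟨U + (turn (c p) (c q)).arg, add_nonneg hU0 (arg_nonneg_of hTi), ?_, Or.inr ?_⟩
  · rw [eq_mul_exp_of_turn (ne_zero_of_re_pos hT) (hedge p hp q hq hpq hs), hU, mul_assoc,
      ← Complex.exp_add]
    congr 2
    push_cast; ring
  · rcases hU' with ⟨rfl, rfl⟩ | hU'
    -- On the first edge the direct turns from `B` and from `A` are compared; both parameters are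
    -- real and `c B` is the smaller one.
    · rw [zero_add]
      have := arg_add_lt (w₁ := turn (c p) (c q)) (w₂ := 1) (w₃ := turn (c A) (c q)) hT.le
        (by simp) (key q hq) ?_
      · simpa using this
      · have h1 := him0 q hq hgq
        simp only [turn, map_add, map_mul, map_one, Complex.conj_conj, Complex.mul_im,
          Complex.mul_re, Complex.add_re, Complex.add_im, Complex.conj_re, Complex.conj_im,
          Complex.one_re, Complex.one_im, hcA, hcB]
        nlinarith [mul_pos (sub_pos.mpr hBA) h1]
    -- `A` lies below the supporting line through `p` and `q`. This orients the triangle `A p q` so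
    -- that the turn from `A` to `p` followed by the turn from `p` to `q` is at most the direct turn
    -- from `A` to `q`.
    · obtain ⟨s, hs1, hs2, hs3⟩ := hs
      have := arg_add_le hAp (key p hp) hT.le (ne_zero_of_re_pos hT) (key q hq)
        (ne_zero_of_re_pos hAq) (hdet p hp q hq (by nlinarith [hs1 A hA]))
      linarith

/-- Two bounds are carried along the lower boundary from `A`. By convexity the accumulated turn is
at least the direct turn from `A`. It also stays below the argument of the end point, because `turn
c d` turns by less than the angle from `c` to `d`. -/
lemma lower_chain (V : Finset ι) (f g : ι → ℝ) (c ρ : ι → ℂ) {A : ι} (hA : A ∈ V)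
    (hgA : g A = 0) (hg0 : ∀ v ∈ V, 0 ≤ g v) (hAf : ∀ v ∈ V, g v = 0 → f A ≤ f v)
    (hre : ∀ v ∈ V, 0 ≤ (c v).re) (him : ∀ v ∈ V, 0 ≤ (c v).im)
    (hcA : (c A).im = 0)
    (hIm : ∀ p ∈ V, ∀ q ∈ V, g p < g q → 0 < (conj (c p) * c q).im)
    (hdet : ∀ p ∈ V, ∀ q ∈ V, 0 ≤ (g p - g A) * f q + (g q - g p) * f A + (g A - g q) * f p →
      0 ≤ (turn (c A) (c p) * turn (c p) (c q) * conj (turn (c A) (c q))).im)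
    (hedge : ∀ p ∈ V, ∀ q ∈ V, g p < g q →
      (∃ s : ℝ, (∀ v ∈ V, -f v + s * g v ≤ -f p + s * g p) ∧ -f q + s * g q = -f p + s * g p ∧
        ∀ v ∈ V, -f v + s * g v = -f p + s * g p → g p ≤ g v ∧ g v ≤ g q) →
      ρ q * turn (c p) (c q) ^ 2 = ρ p * conj (turn (c p) (c q)) ^ 2) :
    ∃ T ∈ V, (∀ v ∈ V, g v ≤ g T) ∧ (∀ v ∈ V, g v = g T → f T ≤ f v) ∧
      ∃ L : ℝ, (turn (c A) (c T)).arg ≤ L ∧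
        ρ T = ρ A * Complex.exp (-4 * (L : ℂ) * Complex.I) ∧
        ((T = A ∧ L = 0) ∨ L < (c T).arg) := by
  have harg0 : (turn (c A) (c A)).arg = 0 := by
    rw [Complex.arg_eq_zero_iff]
    refine ⟨(turn_re_pos (hre A hA) (him A hA) (hre A hA) (him A hA)).le, ?_⟩
    rw [turn_im, Complex.mul_im, Complex.conj_re, Complex.conj_im, hcA]; simp
  have hcA0 : (c A).arg = 0 := Complex.arg_eq_zero_iff.mpr ⟨hre A hA, hcA⟩
  have hmain := upper_hull_induction V (fun v => -f v) g (fun T => ∃ L : ℝ,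
    (turn (c A) (c T)).arg ≤ L ∧ ρ T = ρ A * Complex.exp (-4 * (L : ℂ) * Complex.I) ∧
        ((T = A ∧ L = 0) ∨ L < (c T).arg)) ?_ A hA ⟨0, harg0.le, by simp, by simp⟩
        (fun v hv => by rw [hgA]; exact hg0 v hv)
        (fun v hv h => neg_le_neg (hAf v hv (by rw [h, hgA])))
  · obtain ⟨T, hT, h1, h2, h3⟩ := hmain
    exact ⟨T, hT, h2, fun v hv h => neg_le_neg_iff.mp (h3 v hv h), h1⟩
  rintro p hp q hq ⟨L, hL0, hL, hL'⟩ hpq hs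
  have hT := turn_re_pos (hre p hp) (him p hp) (hre q hq) (him q hq)
  have hAp := turn_re_pos (hre A hA) (him A hA) (hre p hp) (him p hp)
  have hAq := turn_re_pos (hre A hA) (him A hA) (hre q hq) (him q hq)
  have hTi : 0 ≤ (turn (c p) (c q)).im := by rw [turn_im]; exact (hIm p hp q hq hpq).le
  have key : ∀ r ∈ V, 0 ≤ (turn (c A) (c r)).im := fun r hr => by
    rw [turn_im, Complex.mul_im, Complex.conj_re, Complex.conj_im, hcA]
    nlinarith [mul_nonneg (hre A hA) (him r hr)]
  refine ⟨L + (turn (c p) (c q)).arg, ?_, ?_, Or.inr ?_⟩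
  · obtain ⟨s, hs1, hs2, hs3⟩ := hs
    have := le_arg_add (key p hp) (ne_zero_of_re_pos hAp) hTi (ne_zero_of_re_pos hT) hAq.le
        (ne_zero_of_re_pos hAq) (hdet p hp q hq (by
          have e2 : f q = f p - s * g p + s * g q := by linarith
          rw [e2]; nlinarith [hs1 A hA]))
    linarith
  · rw [eq_mul_exp_of_turn (ne_zero_of_re_pos hT) (hedge p hp q hq hpq hs), hL, mul_assoc,
      ← Complex.exp_add]
    congr 2
    push_cast; ring
  -- The triple product is `c p * conj (c q)` plus a nonnegative real number, so its imaginary part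
  -- is the negative of that of `conj (c p) * c q`.
  · have := arg_add_lt (w₁ := turn (c p) (c q)) (w₂ := c p) (w₃ := c q) hT.le (hre p hp)
      (him q hq) (by
        have h1 := hIm p hp q hq hpq
        simp only [turn, Complex.mul_im, Complex.mul_re, Complex.add_re, Complex.add_im,
          Complex.conj_re, Complex.conj_im, Complex.one_re, Complex.one_im] at h1 ⊢
        nlinarith)
    rcases hL' with ⟨rfl, rfl⟩ | hL'
    · rw [hcA0] at this; linarith
    · linarith

/-- The holonomy around a polygon in a quarter space is nontrivial. -/
lemma holonomy_contradiction (V : Finset ι) (f g : ι → ℝ) (c ρ : ι → ℂ) {A B C : ι} (hA : A ∈ V)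
    (hB : B ∈ V) (hC : C ∈ V) (hgC : 0 < g C)
    (hgA : g A = 0) (hgB : g B = 0) (hg0 : ∀ v ∈ V, 0 ≤ g v) (hBf : ∀ v ∈ V, g v = 0 → f v ≤ f B)
    (hAf : ∀ v ∈ V, g v = 0 → f A ≤ f v) (hfAB : f A < f B)
    (hre : ∀ v ∈ V, 0 ≤ (c v).re) (him : ∀ v ∈ V, 0 ≤ (c v).im) (hρ : ∀ v ∈ V, ρ v ≠ 0)
    (him0 : ∀ v ∈ V, 0 < g v → 0 < (c v).im)
    (hcA : (c A).im = 0) (hcB : (c B).im = 0) (hBA : (c B).re < (c A).re)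
    (hIm : ∀ p ∈ V, ∀ q ∈ V, g p < g q → 0 < (conj (c p) * c q).im)
    (hIm0 : ∀ p ∈ V, ∀ q ∈ V, g p = g q → (conj (c p) * c q).im = 0)
    (hmono : ∀ p ∈ V, ∀ q ∈ V, g p = g q → f p ≤ f q → (c q).im ≤ (c p).im)
    (hdet : ∀ p ∈ V, ∀ q ∈ V, (g p - g A) * f q + (g q - g p) * f A + (g A - g q) * f p ≤ 0 →
      (turn (c A) (c p) * turn (c p) (c q) * conj (turn (c A) (c q))).im ≤ 0)
    (hdet' : ∀ p ∈ V, ∀ q ∈ V, 0 ≤ (g p - g A) * f q + (g q - g p) * f A + (g A - g q) * f p →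
      0 ≤ (turn (c A) (c p) * turn (c p) (c q) * conj (turn (c A) (c q))).im)
    (hinj : ∀ p ∈ V, ∀ q ∈ V, f p = f q → g p = g q → p = q)
    (hedge : ∀ p ∈ V, ∀ q ∈ V, p ≠ q → ∀ l m : ℝ,
      (∀ v ∈ V, l * f v + m * g v ≤ l * f p + m * g p) → l * f q + m * g q = l * f p + m * g p →
      (∀ v ∈ V, l * f v + m * g v = l * f p + m * g p → ∃ τ : ℝ, 0 ≤ τ ∧ τ ≤ 1 ∧
        f v = (1 - τ) * f p + τ * f q ∧ g v = (1 - τ) * g p + τ * g q) →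
      ρ q * turn (c p) (c q) ^ 2 = ρ p * conj (turn (c p) (c q)) ^ 2) : False := by
  -- An edge with constant `g` has a real turn, so it transports `ρ` without change. This closes the
  -- polygon along its top and bottom edges.
  have hflat : ∀ p ∈ V, ∀ q ∈ V, g p = g q → f p ≤ f q → (∀ v ∈ V, g v = g p →
      f p ≤ f v ∧ f v ≤ f q) → ∀ m : ℝ, (∀ v ∈ V, m * g v ≤ m * g p) → m ≠ 0 → ρ q = ρ p := by
    intro p hp q hq hg hf hv m hm hm0
    by_cases hpq : p = q
    · rw [hpq]
    have hflt : f p < f q := lt_of_le_of_ne hf fun h => hpq (hinj p hp q hq h hg)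
    have hT := turn_re_pos (hre p hp) (him p hp) (hre q hq) (him q hq)
    have h := hedge p hp q hq hpq 0 m (fun v hv => by simpa using hm v hv) (by rw [hg]; ring)
      (fun v hvV h => by
        have hgv : g v = g p := by
          simp only [zero_mul, zero_add] at h
          exact mul_left_cancel₀ hm0 h
        obtain ⟨h1, h2⟩ := hv v hvV hgv
        refine ⟨(f v - f p) / (f q - f p), div_nonneg (by linarith) (by linarith),
          (div_le_one (by linarith)).mpr (by linarith), ?_, ?_⟩
        · have : f q - f p ≠ 0 := by linarith
          field_simp; ring
        · rw [← hg, hgv]; ring)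
    have hreal : conj (turn (c p) (c q)) = turn (c p) (c q) := by
      rw [Complex.conj_eq_iff_im, turn_im]; exact hIm0 p hp q hq hg
    rw [hreal] at h
    exact mul_right_cancel₀ (pow_ne_zero 2 (ne_zero_of_re_pos hT)) h
  obtain ⟨T, hT, hTg, hTf, U, hU0, hU, hU'⟩ := upper_chain V f g c ρ hA hB hgA hgB hg0 hBf hre him
    him0 hcA hcB hBA hIm hdet (fun p hp q hq hpq ⟨s, h1, h2, h3⟩ =>
      hedge p hp q hq (by rintro rfl; exact lt_irrefl _ hpq) 1 s (by simpa using h1)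
        (by simpa using h2) (fun v hv h => by
          rw [one_mul, one_mul] at h
          obtain ⟨h4, h5⟩ := h3 v hv h
          have h6 : g q - g p ≠ 0 := by linarith
          refine ⟨(g v - g p) / (g q - g p), div_nonneg (by linarith) (by linarith),
            (div_le_one (by linarith)).mpr (by linarith), ?_, ?_⟩
          · have e1 : f v = f p + s * g p - s * g v := by linarith
            have e2 : f q = f p + s * g p - s * g q := by linarith
            rw [e1, e2]; field_simp; ring
          · field_simp; ring))
  obtain ⟨T', hT', hTg', hTf', L, hL0, hL, hL'⟩ := lower_chain V f g c ρ hA hgA hg0 hAf hre him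
    hcA hIm hdet' (fun p hp q hq hpq ⟨s, h1, h2, h3⟩ =>
      hedge p hp q hq (by rintro rfl; exact lt_irrefl _ hpq) (-1) s (by simpa using h1)
        (by simpa using h2) (fun v hv h => by
          rw [neg_one_mul, neg_one_mul] at h
          obtain ⟨h4, h5⟩ := h3 v hv h
          have h6 : g q - g p ≠ 0 := by linarith
          refine ⟨(g v - g p) / (g q - g p), div_nonneg (by linarith) (by linarith),
            (div_le_one (by linarith)).mpr (by linarith), ?_, ?_⟩
          · have e1 : f v = f p - s * g p + s * g v := by linarith
            have e2 : f q = f p - s * g p + s * g q := by linarith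
            rw [e1, e2]; field_simp; ring
          · field_simp; ring))
  have hgT : 0 < g T := hgC.trans_le (hTg C hC)
  have hgTT : g T' = g T := le_antisymm (hTg T' hT') (hTg' T hT)
  have hUlt : U < (turn (c A) (c T)).arg := by
    rcases hU' with ⟨rfl, -⟩ | h
    · linarith
    · exact h
  have hLlt : L < (c T').arg := by
    rcases hL' with ⟨rfl, -⟩ | h
    · linarith
    · exact h
  have hρT : ρ T = ρ T' := hflat T' hT' T hT hgTT (hTf' T hT hgTT.symm)
    (fun v hv h => ⟨hTf' v hv h, hTf v hv (by rw [h, hgTT])⟩) 1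
    (fun v hv => by simpa using hTg' v hv) one_ne_zero
  have hρA : ρ B = ρ A := hflat A hA B hB (by rw [hgA, hgB]) hfAB.le
    (fun v hv h => ⟨hAf v hv (by rw [h, hgA]), hBf v hv (by rw [h, hgA])⟩) (-1)
    (fun v hv => by rw [hgA]; linarith [hg0 v hv]) (by norm_num)
  have hAT := turn_re_pos (hre A hA) (him A hA) (hre T hT) (him T hT)
  have hAT' := turn_re_pos (hre A hA) (him A hA) (hre T' hT') (him T' hT')
  have key : ∀ r ∈ V, 0 ≤ (turn (c A) (c r)).im := fun r hr => by
    rw [turn_im, Complex.mul_im, Complex.conj_re, Complex.conj_im, hcA]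
    nlinarith [mul_nonneg (hre A hA) (him r hr)]
  have hle : (turn (c A) (c T)).arg ≤ (turn (c A) (c T')).arg := by
    have := arg_add_le (w₂ := 1) hAT (key T hT) (by simp) one_ne_zero (key T' hT')
      (ne_zero_of_re_pos hAT') (by
        have h1 := hmono T' hT' T hT hgTT (hTf' T hT hgTT.symm)
        have h2 := hIm0 T' hT' T hT hgTT
        simp only [turn, map_add, map_mul, map_one, Complex.conj_conj, Complex.mul_im,
          Complex.mul_re, Complex.add_re, Complex.add_im, Complex.conj_re, Complex.conj_im,
          Complex.one_re, Complex.one_im, hcA] at h2 ⊢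
        nlinarith [mul_nonneg (hre A hA) (sub_nonneg.mpr h1), congrArg (fun y => (c A).re ^ 2 * y) h2])
    simpa using this
  have hpi : (c T').arg ≤ Real.pi / 2 := arg_le_of (hre T' hT')
  rw [hU, hL, hρA] at hρT
  have hexp := mul_left_cancel₀ (hρ A hA) hρT
  -- The bounds chain up to `0 ≤ U < (turn (c A) (c T)).arg ≤ (turn (c A) (c T')).arg ≤ L < π / 2`.
  -- The phase `4 * (L - U)` is strictly between 0 and 2π, yet its exponential is 1.
  have h1 : Complex.exp (((4 * (L - U) : ℝ) : ℂ) * Complex.I) = 1 := by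
    rw [show ((4 * (L - U) : ℝ) : ℂ) * Complex.I = -4 * (U : ℂ) * Complex.I -
      (-4 * (L : ℂ) * Complex.I) by push_cast; ring, Complex.exp_sub, hexp,
      div_self (Complex.exp_ne_zero _)]
  have h2 := congrArg Complex.re h1
  rw [Complex.exp_ofReal_mul_I_re, Complex.one_re] at h2
  have h3 := (Real.cos_eq_one_iff_of_lt_of_lt (x := 4 * (L - U)) (by linarith [Real.pi_pos])
    (by linarith)).mp h2
  linarith

end

/-! ### Polarization in stereographic coordinates -/

/-- The bilinear square of a complex vector. -/
def bsq (w : C3) : ℂ := w 0 ^ 2 + w 1 ^ 2 + w 2 ^ 2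

lemma bsq_frame {a b : E3} (hab : inner ℝ a b = (0 : ℝ)) (w : C3) :
    ((‖a‖ ^ 2 : ℝ) : ℂ) * ((‖b‖ ^ 2 : ℝ) : ℂ) * bsq w =
      ((‖b‖ ^ 2 : ℝ) : ℂ) * cdot w a ^ 2 + ((‖a‖ ^ 2 : ℝ) : ℂ) * cdot w b ^ 2 +
        cdot w (cross3 a b) ^ 2 := by
  have h := cross3_basis_expansionC a b w
  rw [inner_cross3_cross3, hab, real_inner_self_eq_norm_sq, real_inner_self_eq_norm_sq,
    real_inner_comm, hab] at h
  have h0 := congrArg (fun v : C3 => v 0) h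
  have h1 := congrArg (fun v : C3 => v 1) h
  have h2 := congrArg (fun v : C3 => v 2) h
  simp only [PiLp.add_apply, PiLp.smul_apply, smul_eq_mul, toC_apply] at h0 h1 h2
  push_cast at h0 h1 h2 ⊢
  have ea := cdot_eq3 w a
  have eb := cdot_eq3 w b
  have ec := cdot_eq3 w (cross3 a b)
  unfold bsq
  linear_combination w 0 * h0 + w 1 * h1 + w 2 * h2 - ((‖b‖ : ℂ) ^ 2 * cdot w a) * ea -
    ((‖a‖ : ℂ) ^ 2 * cdot w b) * eb - cdot w (cross3 a b) * ec

/-- Both cases of the edge alternative satisfy this one equation. It is homogeneous in `e`, so `e`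
need not be normalized and may even vanish. -/
lemma edge_relation {S : Finset E3} {b : E3 → C3} (h0 : (0 : E3) ∉ S) (hb : ∀ n ∈ S, b n ≠ 0)
    (hdiv : ∀ n ∈ S, cdot (b n) n = 0) (hS : OuterBalanced S b) {p q e : E3} (hpq : IsEdge S p q)
    (hep : inner ℝ e p = (0 : ℝ)) (heq : inner ℝ e q = (0 : ℝ)) :
    (‖p‖ : ℂ) * cdot (b p) q * cdot (b q) e + (‖q‖ : ℂ) * cdot (b q) p * cdot (b p) e = 0 := by
  by_cases he0 : e = 0
  · simp [he0]
  have hne : ‖e‖ ≠ 0 := norm_ne_zero_iff.mpr he0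
  set e' : E3 := (‖e‖⁻¹ : ℝ) • e with he'
  have hee : e = ‖e‖ • e' := by rw [he', smul_smul, mul_inv_cancel₀ hne, one_smul]
  have hen : ‖e'‖ = 1 := by rw [he', norm_smul, norm_inv, norm_norm, inv_mul_cancel₀ hne]
  have hep' : inner ℝ e' p = (0 : ℝ) := by rw [he', real_inner_smul_left, hep, mul_zero]
  have heq' : inner ℝ e' q = (0 : ℝ) := by rw [he', real_inner_smul_left, heq, mul_zero]
  have hp0 : p ≠ 0 := fun h => h0 (h ▸ hpq.1)
  have hq0 : q ≠ 0 := fun h => h0 (h ▸ hpq.2.1)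
  have e1 := cdot_eq_alpha hen hep' hp0 (hdiv p hpq.1) q
  have e2 := cdot_eq_alpha hen heq' hq0 (hdiv q hpq.2.1) p
  rw [heq', Complex.ofReal_zero, mul_zero, add_zero] at e1
  rw [hep', Complex.ofReal_zero, mul_zero, add_zero, brk_swap] at e2
  clear_value e'
  rw [e1, e2, hee, cdot_smul_right, cdot_smul_right]
  rcases edge_alternative h0 hb hdiv hS hpq hen hep' heq' with ⟨h1, h2⟩ | ⟨_, _, h3, h4, _⟩
  · rw [h1, h2]; ring
  · rw [h3]; push_cast
    linear_combination ((‖q‖ : ℂ) * (brk e' p q) * (‖e‖ : ℂ)) * h4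

/-- The edge relation in stereographic coordinates. -/
lemma stereo_relation {c c' d d' h k up um uy vp vm vy : ℂ} (hh : h ≠ 0) (hk : k ≠ 0)
    (hc : 1 + c * c' ≠ 0) (hd : 1 + d * d' ≠ 0) (hcd : (d - c) * (d' - c') ≠ 0)
    (hu : (1 - c * c') * uy + c' * up + c * um = 0)
    (hv : (1 - d * d') * vy + d' * vp + d * vm = 0)
    (hR : h * (1 + c * c') / 2 * (k / 2 * ((1 - d * d') * uy + d' * up + d * um)) *
        (Complex.I * h * k / 2 * (c' * d - c * d') * vy +
          (-(Complex.I * h * k / 2 * ((1 - d * d') * c' - (1 - c * c') * d')) * vp +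
            Complex.I * h * k / 2 * ((1 - d * d') * c - (1 - c * c') * d) * vm) / 2) +
      k * (1 + d * d') / 2 * (h / 2 * ((1 - c * c') * vy + c' * vp + c * vm)) *
        (Complex.I * h * k / 2 * (c' * d - c * d') * uy +
          (-(Complex.I * h * k / 2 * ((1 - d * d') * c' - (1 - c * c') * d')) * up +
            Complex.I * h * k / 2 * ((1 - d * d') * c - (1 - c * c') * d) * um) / 2) = 0) :
    (um - c' ^ 2 * up - 2 * c' * uy) * (vp - d ^ 2 * vm - 2 * d * vy) * (1 + c * d') ^ 2 =
      (vm - d' ^ 2 * vp - 2 * d' * vy) * (up - c ^ 2 * um - 2 * c * uy) * (1 + c' * d) ^ 2 := by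
  set a := um - c' ^ 2 * up - 2 * c' * uy with ha
  set b := up - c ^ 2 * um - 2 * c * uy with hb
  set a₁ := vm - d' ^ 2 * vp - 2 * d' * vy with ha₁
  set b₁ := vp - d ^ 2 * vm - 2 * d * vy with hb₁
  set M := 1 + c * c' with hM
  set M₁ := 1 + d * d' with hM₁
  -- Under the divergence-free constraint the two null coordinates determine the vector; these
  -- identities invert the change of coordinates.
  have u1 : M ^ 2 * up = b - c ^ 2 * a := by
    rw [ha, hb, hM]; linear_combination (2 * c) * hu
  have u2 : M ^ 2 * um = a - c' ^ 2 * b := by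
    rw [ha, hb, hM]; linear_combination (2 * c') * hu
  have u3 : M ^ 2 * uy = -(c * a + c' * b) := by
    rw [ha, hb, hM]; linear_combination (1 - c * c') * hu
  have v1 : M₁ ^ 2 * vp = b₁ - d ^ 2 * a₁ := by
    rw [ha₁, hb₁, hM₁]; linear_combination (2 * d) * hv
  have v2 : M₁ ^ 2 * vm = a₁ - d' ^ 2 * b₁ := by
    rw [ha₁, hb₁, hM₁]; linear_combination (2 * d') * hv
  have v3 : M₁ ^ 2 * vy = -(d * a₁ + d' * b₁) := by
    rw [ha₁, hb₁, hM₁]; linear_combination (1 - d * d') * hv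
  clear_value a b a₁ b₁
  set z := (d - c) * (1 + c * d') with hz
  set z' := (d' - c') * (1 + c' * d) with hz'
  set w := (c - d) * (1 + d * c') with hw
  set w' := (c' - d') * (1 + d' * c) with hw'
  have p1 : M ^ 2 * ((1 - d * d') * uy + d' * up + d * um) = a * z + b * z' := by
    rw [hz, hz']
    linear_combination (1 - d * d') * u3 + d' * u1 + d * u2
  have p2 : M₁ ^ 2 * ((1 - c * c') * vy + c' * vp + c * vm) = a₁ * w + b₁ * w' := by
    rw [hw, hw']
    linear_combination (1 - c * c') * v3 + c' * v1 + c * v2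
  set P := (1 - d * d') * uy + d' * up + d * um
  set Q := (1 - c * c') * vy + c' * vp + c * vm
  have q1 : M ^ 2 * (Complex.I * h * k / 2 * (c' * d - c * d') * uy +
          (-(Complex.I * h * k / 2 * ((1 - d * d') * c' - (1 - c * c') * d')) * up +
            Complex.I * h * k / 2 * ((1 - d * d') * c - (1 - c * c') * d) * um) / 2) =
      -(Complex.I * h * k / 4) * M * (a * z - b * z') := by
    rw [hz, hz', hM]
    rw [hM] at u1 u2 u3
    linear_combination Complex.I * h * k / 2 * (c' * d - c * d') * u3 +
      (-(Complex.I * h * k / 2 * ((1 - d * d') * c' - (1 - c * c') * d'))) / 2 * u1 +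
      Complex.I * h * k / 2 * ((1 - d * d') * c - (1 - c * c') * d) / 2 * u2
  have q2 : M₁ ^ 2 * (Complex.I * h * k / 2 * (c' * d - c * d') * vy +
          (-(Complex.I * h * k / 2 * ((1 - d * d') * c' - (1 - c * c') * d')) * vp +
            Complex.I * h * k / 2 * ((1 - d * d') * c - (1 - c * c') * d) * vm) / 2) =
      (Complex.I * h * k / 4) * M₁ * (a₁ * w - b₁ * w') := by
    rw [hw, hw', hM₁]
    rw [hM₁] at v1 v2 v3
    linear_combination Complex.I * h * k / 2 * (c' * d - c * d') * v3 +
      (-(Complex.I * h * k / 2 * ((1 - d * d') * c' - (1 - c * c') * d'))) / 2 * v1 +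
      Complex.I * h * k / 2 * ((1 - d * d') * c - (1 - c * c') * d) / 2 * v2
  set Eu := Complex.I * h * k / 2 * (c' * d - c * d') * uy +
          (-(Complex.I * h * k / 2 * ((1 - d * d') * c' - (1 - c * c') * d')) * up +
            Complex.I * h * k / 2 * ((1 - d * d') * c - (1 - c * c') * d) * um) / 2
  set Ev := Complex.I * h * k / 2 * (c' * d - c * d') * vy +
          (-(Complex.I * h * k / 2 * ((1 - d * d') * c' - (1 - c * c') * d')) * vp +
            Complex.I * h * k / 2 * ((1 - d * d') * c - (1 - c * c') * d) * vm) / 2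
  -- In null coordinates the relation is a product of sums plus a product of differences. The terms
  -- `a * a₁` and `b * b₁` cancel and only the mixed products survive.
  have key : M * M₁ * (Complex.I * h ^ 2 * k ^ 2 / 8) * (b * z' * (a₁ * w) - a * z * (b₁ * w')) =
      0 := by
    have e1 : M ^ 2 * M₁ ^ 2 * (h * M / 2 * (k / 2 * P) * Ev + k * M₁ / 2 * (h / 2 * Q) * Eu) = 0 := by
      rw [hR, mul_zero]
    linear_combination e1 - h * M / 2 * (k / 2) * (M₁ ^ 2 * Ev * p1 + (a * z + b * z') * q2) -
      k * M₁ / 2 * (h / 2) * (M ^ 2 * Eu * p2 + (a₁ * w + b₁ * w') * q1)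
  have hne : M * M₁ * (Complex.I * h ^ 2 * k ^ 2 / 8) ≠ 0 := by
    refine mul_ne_zero (mul_ne_zero hc hd) (div_ne_zero (mul_ne_zero (mul_ne_zero
      Complex.I_ne_zero (pow_ne_zero 2 hh)) (pow_ne_zero 2 hk)) (by norm_num))
  have := (mul_eq_zero.mp key).resolve_left hne
  apply mul_left_cancel₀ hcd
  rw [hz, hz', hw, hw'] at this
  linear_combination this

/-- On the divergence-free plane the bilinear square equals the product of the null coordinates
divided by `(1 + c * c') ^ 2`. -/
lemma stereo_null {c c' up um uy : ℂ} (hc : 1 + c * c' ≠ 0)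
    (hu : (1 - c * c') * uy + c' * up + c * um = 0)
    (h : (um - c' ^ 2 * up - 2 * c' * uy) * (up - c ^ 2 * um - 2 * c * uy) = 0) :
    uy ^ 2 + up * um = 0 := by
  set a := um - c' ^ 2 * up - 2 * c' * uy with ha
  set b := up - c ^ 2 * um - 2 * c * uy with hb
  set M := 1 + c * c' with hM
  have u1 : M ^ 2 * up = b - c ^ 2 * a := by
    rw [ha, hb, hM]; linear_combination (2 * c) * hu
  have u2 : M ^ 2 * um = a - c' ^ 2 * b := by
    rw [ha, hb, hM]; linear_combination (2 * c') * hu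
  have u3 : M ^ 2 * uy = -(c * a + c' * b) := by
    rw [ha, hb, hM]; linear_combination (1 - c * c') * hu
  clear_value a b
  apply mul_left_cancel₀ (pow_ne_zero 4 hc)
  rw [mul_zero, show M ^ 4 * (uy ^ 2 + up * um) = (M ^ 2 * uy) ^ 2 + (M ^ 2 * up) * (M ^ 2 * um) by
    ring, u1, u2, u3]
  linear_combination (1 + c * c') ^ 2 * h

lemma frame_expansion {x z : E3} (hx : ‖x‖ = 1) (hz : ‖z‖ = 1) (hzx : inner ℝ z x = (0 : ℝ))
    (n : E3) : n = (inner ℝ x n : ℝ) • x + (inner ℝ (cross3 z x) n : ℝ) • cross3 z x +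
      (inner ℝ z n : ℝ) • z := by
  have h := cross3_basis_expansion z x n
  rw [norm_cross3_of_perp hz hzx, hx, real_inner_self_eq_norm_sq, real_inner_self_eq_norm_sq, hx,
    hz, hzx, real_inner_comm, real_inner_comm x n] at h
  simp only [one_pow, one_smul, mul_one, mul_zero, sub_zero] at h
  conv_lhs => rw [h]
  module

lemma frame_inner {x z : E3} (hx : ‖x‖ = 1) (hz : ‖z‖ = 1) (hzx : inner ℝ z x = (0 : ℝ))
    (m n : E3) : inner ℝ m n = (inner ℝ x m : ℝ) * inner ℝ x n +
      inner ℝ (cross3 z x) m * inner ℝ (cross3 z x) n + inner ℝ z m * inner ℝ z n := by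
  conv_lhs => rw [frame_expansion hx hz hzx m]
  simp only [inner_add_left, real_inner_smul_left]

lemma frame_cdot {x z : E3} (hx : ‖x‖ = 1) (hz : ‖z‖ = 1) (hzx : inner ℝ z x = (0 : ℝ))
    (w : C3) (n : E3) : cdot w n = ((inner ℝ x n : ℝ) : ℂ) * cdot w x +
      ((inner ℝ (cross3 z x) n : ℝ) : ℂ) * cdot w (cross3 z x) +
      ((inner ℝ z n : ℝ) : ℂ) * cdot w z := by
  conv_lhs => rw [frame_expansion hx hz hzx n]
  simp only [cdot_add_right, cdot_smul_right]

section Conj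

open ComplexConjugate

/-- `c` is the stereographic parameter of `n` in the frame `(x, z × x, z)`, with scale `h`. -/
structure IsStereo (x z n : E3) (c : ℂ) (h : ℝ) : Prop where
  pos : 0 < h
  x_eq : inner ℝ x n = h * c.re
  z_eq : inner ℝ z n = h * c.im
  y_eq : inner ℝ (cross3 z x) n = h / 2 * (1 - Complex.normSq c)
  norm_eq : ‖n‖ = h / 2 * (1 + Complex.normSq c)

/-- First null coordinate of `w` at stereographic parameter `c`. -/
noncomputable def nullA (x z : E3) (w : C3) (c : ℂ) : ℂ :=
  (cdot w x - Complex.I * cdot w z) - conj c ^ 2 * (cdot w x + Complex.I * cdot w z) -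
    2 * conj c * cdot w (cross3 z x)

/-- Second null coordinate of `w` at stereographic parameter `c`. -/
noncomputable def nullB (x z : E3) (w : C3) (c : ℂ) : ℂ :=
  (cdot w x + Complex.I * cdot w z) - c ^ 2 * (cdot w x - Complex.I * cdot w z) -
    2 * c * cdot w (cross3 z x)

lemma mul_conj_normSq (c : ℂ) : c * conj c = ((Complex.normSq c : ℝ) : ℂ) := Complex.mul_conj c

lemma one_add_mul_conj_ne_zero (c : ℂ) : 1 + c * conj c ≠ 0 := by
  rw [Complex.mul_conj]
  have := Complex.normSq_nonneg c
  have h : (1 + Complex.normSq c : ℝ) ≠ 0 := by linarith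
  exact_mod_cast h

lemma re_eq_conj (c : ℂ) : (c.re : ℂ) = (c + conj c) / 2 := by
  apply Complex.ext <;> simp

lemma im_eq_conj (c : ℂ) : (c.im : ℂ) = -Complex.I * (c - conj c) / 2 := by
  apply Complex.ext <;> simp

lemma IsStereo.cdot_eq {x z n : E3} {c : ℂ} {h : ℝ} (hx : ‖x‖ = 1) (hz : ‖z‖ = 1)
    (hzx : inner ℝ z x = (0 : ℝ)) (H : IsStereo x z n c h) (w : C3) :
    cdot w n = h / 2 * ((1 - c * conj c) * cdot w (cross3 z x) +
      conj c * (cdot w x + Complex.I * cdot w z) + c * (cdot w x - Complex.I * cdot w z)) := by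
  rw [frame_cdot hx hz hzx w n, H.x_eq, H.z_eq, H.y_eq, mul_conj_normSq]
  push_cast
  rw [← mul_conj_normSq, re_eq_conj, im_eq_conj]
  ring

lemma IsStereo.relation {S : Finset E3} {b : E3 → C3} (h0 : (0 : E3) ∉ S)
    (hb : ∀ n ∈ S, b n ≠ 0)
    (hdiv : ∀ n ∈ S, cdot (b n) n = 0) (hS : OuterBalanced S b) {p q x z : E3} {c d : ℂ} {h k : ℝ}
    (hx : ‖x‖ = 1) (hz : ‖z‖ = 1) (hzx : inner ℝ z x = (0 : ℝ)) (hpq : IsEdge S p q)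
    (Hp : IsStereo x z p c h) (Hq : IsStereo x z q d k) (hcd : c ≠ d) :
    nullA x z (b p) c * nullB x z (b q) d * (1 + c * conj d) ^ 2 =
      nullA x z (b q) d * nullB x z (b p) c * (1 + conj c * d) ^ 2 := by
  have hh : (h : ℂ) ≠ 0 := Complex.ofReal_ne_zero.mpr Hp.pos.ne'
  have hk : (k : ℂ) ≠ 0 := Complex.ofReal_ne_zero.mpr Hq.pos.ne'
  have hu := hdiv p hpq.1
  have hv := hdiv q hpq.2.1
  rw [Hp.cdot_eq hx hz hzx] at hu
  rw [Hq.cdot_eq hx hz hzx] at hv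
  replace hu := (mul_eq_zero.mp hu).resolve_left (by simpa using hh)
  replace hv := (mul_eq_zero.mp hv).resolve_left (by simpa using hk)
  set y := cross3 z x with hy
  set Xp := inner ℝ x p with hXp
  set Yp := inner ℝ y p with hYp
  set Zp := inner ℝ z p with hZp
  set Xq := inner ℝ x q with hXq
  set Yq := inner ℝ y q with hYq
  set Zq := inner ℝ z q with hZq
  -- The cross product of `p` and `q`, written in the orthonormal frame `(x, y, z)`.
  set e : E3 := (Yp * Zq - Zp * Yq) • x + (Zp * Xq - Xp * Zq) • y + (Xp * Yq - Yp * Xq) • z with he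
  have hep : inner ℝ e p = (0 : ℝ) := by
    rw [he, inner_add_left, inner_add_left, real_inner_smul_left, real_inner_smul_left,
      real_inner_smul_left, ← hXp, ← hYp, ← hZp]; ring
  have heq : inner ℝ e q = (0 : ℝ) := by
    rw [he, inner_add_left, inner_add_left, real_inner_smul_left, real_inner_smul_left,
      real_inner_smul_left, ← hXq, ← hYq, ← hZq]; ring
  have hR := edge_relation h0 hb hdiv hS hpq hep heq
  rw [Hp.cdot_eq hx hz hzx, Hq.cdot_eq hx hz hzx, Hp.norm_eq, Hq.norm_eq, he] at hR
  simp only [cdot_add_right, cdot_smul_right] at hR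
  rw [← hy, show Xp = h * c.re from Hp.x_eq, show Yp = _ from Hp.y_eq, show Zp = _ from Hp.z_eq,
    show Xq = _ from Hq.x_eq, show Yq = _ from Hq.y_eq, show Zq = _ from Hq.z_eq] at hR
  have hcd' : (d - c) * (conj d - conj c) ≠ 0 := by
    rw [← map_sub]
    exact mul_ne_zero (sub_ne_zero.mpr hcd.symm)
      ((map_ne_zero _).mpr (sub_ne_zero.mpr hcd.symm))
  refine stereo_relation hh hk (one_add_mul_conj_ne_zero c) (one_add_mul_conj_ne_zero d) hcd'
    hu hv ?_
  rw [← hR]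
  push_cast
  rw [← mul_conj_normSq, ← mul_conj_normSq]
  rw [re_eq_conj, re_eq_conj, im_eq_conj, im_eq_conj]
  have E : ∀ w : C3, (((h : ℂ) / 2 * (1 - c * conj c) * (k * (-Complex.I * (d - conj d) / 2)) -
        h * (-Complex.I * (c - conj c) / 2) * (k / 2 * (1 - d * conj d))) * cdot w x +
      (h * (-Complex.I * (c - conj c) / 2) * (k * ((d + conj d) / 2)) -
        h * ((c + conj c) / 2) * (k * (-Complex.I * (d - conj d) / 2))) * cdot w y +
      (h * ((c + conj c) / 2) * (k / 2 * (1 - d * conj d)) -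
        h / 2 * (1 - c * conj c) * (k * ((d + conj d) / 2))) * cdot w z) =
      (Complex.I * h * k / 2 * (conj c * d - c * conj d) * cdot w y +
          (-(Complex.I * h * k / 2 * ((1 - d * conj d) * conj c - (1 - c * conj c) * conj d)) *
            (cdot w x + Complex.I * cdot w z) +
            Complex.I * h * k / 2 * ((1 - d * conj d) * c - (1 - c * conj c) * d) *
            (cdot w x - Complex.I * cdot w z)) / 2) := by
    intro w
    linear_combination ((h : ℂ) * k / 4 * (((1 - d * conj d) * conj c - (1 - c * conj c) * conj d) +
      ((1 - d * conj d) * c - (1 - c * conj c) * d)) * cdot w z) * Complex.I_sq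
  rw [E, E]
  ring

lemma IsStereo.bsq_eq_zero {x z n : E3} {c : ℂ} {h : ℝ} (hx : ‖x‖ = 1) (hz : ‖z‖ = 1)
    (hzx : inner ℝ z x = (0 : ℝ)) (H : IsStereo x z n c h) {w : C3} (hw : cdot w n = 0)
    (h0 : nullA x z w c * nullB x z w c = 0) : bsq w = 0 := by
  have hh : (h : ℂ) ≠ 0 := Complex.ofReal_ne_zero.mpr H.pos.ne'
  rw [H.cdot_eq hx hz hzx] at hw
  replace hw := (mul_eq_zero.mp hw).resolve_left (by simpa using hh)
  have := stereo_null (one_add_mul_conj_ne_zero c) hw h0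
  have h2 := bsq_frame hzx w
  rw [hx, hz] at h2
  simp only [one_pow, Complex.ofReal_one, one_mul] at h2
  rw [h2]
  linear_combination this + cdot w z ^ 2 * Complex.I_sq

end Conj

section Conj

open ComplexConjugate

/-- Stereographic projection from the direction opposite to `z × x`. Positivity of the sum of the
`x` and `z` coordinates keeps `n` off that axis, so the denominator is positive. -/
lemma isStereo_of_pos {x z n : E3} (hx : ‖x‖ = 1) (hz : ‖z‖ = 1) (hzx : inner ℝ z x = (0 : ℝ))
    (hσ : 0 < inner ℝ x n + inner ℝ z n) :
    IsStereo x z n ⟨inner ℝ x n / (‖n‖ + inner ℝ (cross3 z x) n),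
      inner ℝ z n / (‖n‖ + inner ℝ (cross3 z x) n)⟩ (‖n‖ + inner ℝ (cross3 z x) n) := by
  have hN := frame_inner hx hz hzx n n
  rw [real_inner_self_eq_norm_sq] at hN
  have hn := norm_nonneg n
  set X := inner ℝ x n
  set Y := inner ℝ (cross3 z x) n
  set Z := inner ℝ z n
  have hXZ : 0 < X * X + Z * Z := by
    rcases eq_or_ne X 0 with h | h
    · have : 0 < Z := by rw [h, zero_add] at hσ; exact hσ
      nlinarith [mul_pos this this, mul_self_nonneg X]
    · nlinarith [mul_self_pos.mpr h, mul_self_nonneg Z]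
  have hpos : 0 < ‖n‖ + Y := by nlinarith
  have hns : Complex.normSq ⟨X / (‖n‖ + Y), Z / (‖n‖ + Y)⟩ = (‖n‖ - Y) / (‖n‖ + Y) := by
    rw [Complex.normSq_mk]
    field_simp
    linarith
  refine ⟨hpos, ?_, ?_, ?_, ?_⟩
  · exact (mul_div_cancel₀ _ hpos.ne').symm
  · exact (mul_div_cancel₀ _ hpos.ne').symm
  · rw [hns]; field_simp; ring
  · rw [hns]; field_simp; ring

/-- The right side is, up to a positive factor, the determinant of the three directions. The
orientation of a spherical triangle can therefore be read off from planar coordinates. -/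
lemma turn_triple_im (a p q : ℂ) : (turn a p * turn p q * conj (turn a q)).im =
    (conj a * p).im * (1 - Complex.normSq q) + (conj p * q).im * (1 - Complex.normSq a) +
      (conj q * a).im * (1 - Complex.normSq p) := by
  simp only [turn, map_add, map_mul, map_one, Complex.conj_conj, Complex.mul_im,
    Complex.mul_re, Complex.add_re, Complex.add_im, Complex.conj_re, Complex.conj_im,
    Complex.one_re, Complex.one_im, Complex.normSq_apply]
  ring

/-- `H` is the root `f + √(f ^ 2 + K)`, which increases with `f`. -/
lemma le_of_quadratic {H H' f f' K : ℝ} (hH : 0 < H) (hH' : 0 < H') (hK : 0 ≤ K)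
    (h : H ^ 2 - 2 * f * H = K) (h' : H' ^ 2 - 2 * f' * H' = K) (hf : f ≤ f') : H ≤ H' := by
  by_contra! hlt
  have h1 : 2 * f ≤ H := by
    by_contra! h2
    nlinarith
  nlinarith [mul_le_mul_of_nonneg_right hf hH'.le, mul_pos (sub_pos.mpr hlt) hH',
    mul_nonneg (sub_nonneg.mpr h1) (sub_pos.mpr hlt).le]

lemma lt_of_quadratic {H H' f f' K : ℝ} (hH : 0 < H) (hH' : 0 < H') (hK : 0 ≤ K)
    (h : H ^ 2 - 2 * f * H = K) (h' : H' ^ 2 - 2 * f' * H' = K) (hf : f < f') : H < H' := by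
  refine lt_of_le_of_ne (le_of_quadratic hH hH' hK h h' hf.le) ?_
  rintro rfl
  have := mul_pos (sub_pos.mpr hf) hH
  nlinarith

/-- Were no end point of an edge null, the ratio of null coordinates would be finite and nonzero at
every vertex of the chosen facet. The edge relation would transport it consistently around the
polygon, which the holonomy forbids. -/
lemma exists_null_edge {S : Finset E3} {b : E3 → C3} (h0 : (0 : E3) ∉ S)
    (hsymm : ∀ n ∈ S, -n ∈ S) (hspan : ∀ d : E3, d ≠ 0 → ∃ n ∈ S, inner ℝ d n ≠ (0 : ℝ))
    (hb : ∀ n ∈ S, b n ≠ 0) (hdiv : ∀ n ∈ S, cdot (b n) n = 0) (hS : OuterBalanced S b) :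
    ∃ p q, IsEdge S p q ∧ bsq (b p) = 0 := by
  classical
  obtain ⟨θ, x, z, A₀, B₀, C, hx, hz, hzx, hθ, hquart, hA₀, hB₀, hAB₀, hθA₀, hθB₀, hzA₀, hzB₀, hC,
    hθC, hzC⟩ := exists_facet_quarter hsymm hspan
  by_contra! hnn
  set V := S.filter (fun n => inner ℝ θ n = (1 : ℝ)) with hV
  have memV : ∀ {n}, n ∈ V ↔ n ∈ S ∧ inner ℝ θ n = (1 : ℝ) := by
    intro n; rw [hV, Finset.mem_filter]
  have VS : ∀ {n}, n ∈ V → n ∈ S := fun h => (memV.mp h).1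
  have Vθ : ∀ {n}, n ∈ V → inner ℝ θ n = (1 : ℝ) := fun h => (memV.mp h).2
  set y := cross3 z x with hy
  -- Central projection to the plane where the `x` and `z` coordinates sum to 1: `n / σ n` has frame
  -- coordinates `(1 - g n, f n, g n)`. The facet becomes a planar point set without change of
  -- directions.
  set σ : E3 → ℝ := fun n => inner ℝ x n + inner ℝ z n with hσdef
  set h : E3 → ℝ := fun n => ‖n‖ + inner ℝ y n with hhdef
  set c : E3 → ℂ := fun n => ⟨inner ℝ x n / h n, inner ℝ z n / h n⟩ with hcdef
  set f : E3 → ℝ := fun n => inner ℝ y n / σ n with hfdef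
  set g : E3 → ℝ := fun n => inner ℝ z n / σ n with hgdef
  have hσ : ∀ n ∈ V, 0 < σ n := by
    intro n hn
    obtain ⟨h1, h2, h3⟩ := hquart n (VS hn) (Vθ hn)
    rcases eq_or_lt_of_le h1 with h4 | h4
    · have := h3 h4.symm
      simp only [hσdef]; linarith
    · simp only [hσdef]; linarith
  have hst : ∀ n ∈ V, IsStereo x z n (c n) (h n) := fun n hn => isStereo_of_pos hx hz hzx (hσ n hn)
  have hh : ∀ n ∈ V, 0 < h n := fun n hn => (hst n hn).pos
  have eZ : ∀ n ∈ V, inner ℝ z n = σ n * g n := fun n hn => by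
    simp only [hgdef]; rw [mul_div_cancel₀ _ (hσ n hn).ne']
  have eY : ∀ n ∈ V, inner ℝ y n = σ n * f n := fun n hn => by
    simp only [hfdef]; rw [mul_div_cancel₀ _ (hσ n hn).ne']
  have eX : ∀ n ∈ V, inner ℝ x n = σ n * (1 - g n) := fun n hn => by
    rw [mul_one_sub, ← eZ n hn]; simp [hσdef]
  have eF : ∀ n ∈ V, n = σ n • ((1 - g n) • x + f n • y + g n • z) := fun n hn => by
    conv_lhs => rw [frame_expansion hx hz hzx n, ← hy, eX n hn, eY n hn, eZ n hn]
    module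
  have ecre : ∀ n, (c n).re = inner ℝ x n / h n := fun n => rfl
  have ecim : ∀ n, (c n).im = inner ℝ z n / h n := fun n => rfl
  have ens : ∀ n ∈ V, 1 - Complex.normSq (c n) = 2 * σ n * f n / h n := fun n hn => by
    have h1 := (hst n hn).y_eq
    rw [← hy, eY n hn] at h1
    have := (hh n hn).ne'
    field_simp
    linarith
  have eIm : ∀ p ∈ V, ∀ q ∈ V, (conj (c p) * c q).im =
      σ p * σ q / (h p * h q) * (g q - g p) := fun p hp q hq => by
    rw [Complex.mul_im, Complex.conj_re, Complex.conj_im, ecre, ecre, ecim, ecim, eX p hp, eX q hq,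
      eZ p hp, eZ q hq]
    have := (hh p hp).ne'
    have := (hh q hq).ne'
    field_simp
    ring
  have edet : ∀ a ∈ V, ∀ p ∈ V, ∀ q ∈ V,
      (turn (c a) (c p) * turn (c p) (c q) * conj (turn (c a) (c q))).im =
      2 * σ a * σ p * σ q / (h a * h p * h q) *
        ((g p - g a) * f q + (g q - g p) * f a + (g a - g q) * f p) := by
    intro a ha p hp q hq
    rw [turn_triple_im, eIm a ha p hp, eIm p hp q hq, eIm q hq a ha, ens a ha, ens p hp, ens q hq]
    have := (hh p hp).ne'
    have := (hh q hq).ne'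
    have := (hh a ha).ne'
    field_simp
  have hH : ∀ n ∈ V, 0 < h n / σ n := fun n hn => div_pos (hh n hn) (hσ n hn)
  -- Here `h n / σ n = ‖n‖ / σ n + f n`, and the identity is the square of the norm in the frame. It
  -- makes `h n / σ n` increase with `f` when `g` is fixed.
  have hquad : ∀ n ∈ V, (h n / σ n) ^ 2 - 2 * f n * (h n / σ n) = (1 - g n) ^ 2 + g n ^ 2 := by
    intro n hn
    have hN := frame_inner hx hz hzx n n
    rw [real_inner_self_eq_norm_sq, ← hy, eX n hn, eY n hn, eZ n hn] at hN
    have hhn : h n = ‖n‖ + σ n * f n := by rw [← eY n hn]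
    have hs := (hσ n hn).ne'
    rw [hhn]
    field_simp
    nlinarith
  have him_eq : ∀ n ∈ V, (c n).im = g n / (h n / σ n) := fun n hn => by
    rw [ecim, eZ n hn, mul_comm, div_div_eq_mul_div]
  have hre_eq : ∀ n ∈ V, (c n).re = (1 - g n) / (h n / σ n) := fun n hn => by
    rw [ecre, eX n hn, mul_comm, div_div_eq_mul_div]
  have hg0 : ∀ v ∈ V, 0 ≤ g v := fun v hv => div_nonneg (hquart v (VS hv) (Vθ hv)).1 (hσ v hv).le
  have hinj : ∀ p ∈ V, ∀ q ∈ V, f p = f q → g p = g q → p = q := by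
    intro p hp q hq hf hg
    have h1 := eF p hp
    have h2 := eF q hq
    rw [hf, hg] at h1
    have h3 := Vθ hp
    have h4 := Vθ hq
    rw [h1, inner_smul_right] at h3
    rw [h2, inner_smul_right] at h4
    have h5 : inner ℝ θ ((1 - g q) • x + f q • y + g q • z) ≠ (0 : ℝ) := fun h => by
      rw [h, mul_zero] at h3; exact zero_ne_one h3
    have h6 : σ p = σ q := mul_right_cancel₀ h5 (h3.trans h4.symm)
    rw [h6] at h1
    exact h1.trans h2.symm
  set W := V.filter (fun n => inner ℝ z n = (0 : ℝ)) with hW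
  have gW : ∀ n ∈ V, (n ∈ W ↔ g n = 0) := fun n hn => by
    rw [hW, Finset.mem_filter, eZ n hn, mul_eq_zero]
    have := (hσ n hn).ne'
    tauto
  have hA₀W : A₀ ∈ W := Finset.mem_filter.mpr ⟨memV.mpr ⟨hA₀, hθA₀⟩, hzA₀⟩
  have hB₀W : B₀ ∈ W := Finset.mem_filter.mpr ⟨memV.mpr ⟨hB₀, hθB₀⟩, hzB₀⟩
  have WV : ∀ {n}, n ∈ W → n ∈ V := fun h => (Finset.mem_filter.mp h).1
  obtain ⟨A, hAW, hAmin⟩ := W.exists_min_image f ⟨A₀, hA₀W⟩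
  obtain ⟨B, hBW, hBmax⟩ := W.exists_max_image f ⟨A₀, hA₀W⟩
  have hA := WV hAW
  have hB := WV hBW
  have hgA := (gW A hA).mp hAW
  have hgB := (gW B hB).mp hBW
  have hfAB : f A < f B := by
    by_contra! hle
    apply hAB₀
    apply hinj _ (WV hA₀W) _ (WV hB₀W)
    · linarith [hAmin A₀ hA₀W, hAmin B₀ hB₀W, hBmax A₀ hA₀W, hBmax B₀ hB₀W]
    · rw [(gW _ (WV hA₀W)).mp hA₀W, (gW _ (WV hB₀W)).mp hB₀W]
  have hCV : C ∈ V := memV.mpr ⟨hC, hθC⟩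
  have hedge : ∀ p ∈ V, ∀ q ∈ V, p ≠ q → ∀ l m : ℝ,
      (∀ v ∈ V, l * f v + m * g v ≤ l * f p + m * g p) → l * f q + m * g q = l * f p + m * g p →
      (∀ v ∈ V, l * f v + m * g v = l * f p + m * g p → ∃ τ : ℝ, 0 ≤ τ ∧ τ ≤ 1 ∧
        f v = (1 - τ) * f p + τ * f q ∧ g v = (1 - τ) * g p + τ * g q) → IsEdge S p q := by
    intro p hp q hq hpq l m h1 h2 h3
    -- `N` below is the affine function `l f + m g - κ` made homogeneous by the factor `σ`.
    set κ := l * f p + m * g p with hκ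
    set N : E3 := l • y + m • z - κ • (x + z) with hN
    have eN : ∀ n ∈ V, inner ℝ N n = σ n * (l * f n + m * g n - κ) := by
      intro n hn
      rw [hN, inner_sub_left, inner_add_left, real_inner_smul_left, real_inner_smul_left,
        real_inner_smul_left, inner_add_left, eX n hn, eY n hn, eZ n hn]; ring
    refine isEdge_of_face (θ := θ) (N := N) (VS hp) (VS hq) hpq hθ (Vθ hp) (Vθ hq) ?_ ?_ ?_ ?_
    · intro n hn hn'
      have hnV := memV.mpr ⟨hn, hn'⟩
      rw [eN n hnV]
      exact mul_nonpos_of_nonneg_of_nonpos (hσ n hnV).le (by linarith [h1 n hnV])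
    · rw [eN p hp, hκ, sub_self, mul_zero]
    · rw [eN q hq, h2, sub_self, mul_zero]
    · intro n hn hn' hNn
      have hnV := memV.mpr ⟨hn, hn'⟩
      rw [eN n hnV] at hNn
      obtain ⟨τ, ht0, ht1, hf, hg⟩ := h3 n hnV
        (by linarith [(mul_eq_zero.mp hNn).resolve_left (hσ n hnV).ne'])
      have hsp := hσ p hp
      have hsq := hσ q hq
      have hsn := hσ n hnV
      have hcomb : n = (σ n * (1 - τ) / σ p) • p + (σ n * τ / σ q) • q := by
        have e0 : ∀ r : ℝ, ∀ v ∈ V,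
            (r / σ v) • v = r • ((1 - g v) • x + f v • y + g v • z) := fun r v hv =>
          (congrArg (fun t => (r / σ v) • t) (eF v hv)).trans
            (by simp only [smul_smul]; rw [div_mul_cancel₀ _ (hσ v hv).ne'])
        rw [e0 _ p hp, e0 _ q hq]
        conv_lhs => rw [eF n hnV, hf, hg]
        module
      refine ⟨_, _, ?_, ?_, ?_, hcomb.symm⟩
      · exact div_nonneg (mul_nonneg hsn.le (by linarith)) hsp.le
      · exact div_nonneg (mul_nonneg hsn.le ht0) hsq.le
      · have := hn'
        rw [hcomb, inner_add_right, inner_smul_right, inner_smul_right, Vθ hp, Vθ hq] at this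
        linarith
  have hcne : ∀ p ∈ V, ∀ q ∈ V, p ≠ q → c p ≠ c q := by
    intro p hp q hq hpq hc
    have h1 := ens p hp
    rw [hc, ens q hq] at h1
    have h2 := congrArg Complex.im hc
    have h3 := congrArg Complex.re hc
    rw [ecim, ecim, eZ p hp, eZ q hq] at h2
    rw [ecre, ecre, eX p hp, eX q hq] at h3
    have hp' := (hh p hp).ne'
    have hq' := (hh q hq).ne'
    have sp := (hσ p hp).ne'
    have hr : σ p / h p = σ q / h q := by
      have e1 : σ p * g p / h p + σ p * (1 - g p) / h p = σ p / h p := by ring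
      have e2 : σ q * g q / h q + σ q * (1 - g q) / h q = σ q / h q := by ring
      rw [← e1, ← e2, h2, h3]
    have hr0 : σ q / h q ≠ 0 := by
      rw [← hr]; exact div_ne_zero sp hp'
    have hg : g p = g q := by
      apply mul_left_cancel₀ hr0
      calc σ q / h q * g p = σ p * g p / h p := by rw [← hr]; ring
        _ = σ q / h q * g q := by rw [h2]; ring
    have hf : f p = f q := by
      apply mul_left_cancel₀ hr0
      calc σ q / h q * f p = (2 * σ p * f p / h p) / 2 := by rw [← hr]; ring
        _ = σ q / h q * f q := by rw [← h1]; ring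
    exact hpq (hinj p hp q hq hf hg)
  have hquad0 : ∀ n, 0 ≤ (1 - g n) ^ 2 + g n ^ 2 := fun n => by positivity
  -- Facet points that are not ends of an edge may be null. The value 1 there keeps `ρ` nonzero
  -- everywhere; at ends of edges `ρ` is the true ratio.
  set ρ : E3 → ℂ := fun n =>
    if nullA x z (b n) (c n) = 0 ∨ nullB x z (b n) (c n) = 0 then 1
    else nullA x z (b n) (c n) / nullB x z (b n) (c n) with hρ
  have hρ0 : ∀ v ∈ V, ρ v ≠ 0 := by
    intro v hv
    simp only [hρ]
    split_ifs with h
    · exact one_ne_zero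
    · exact div_ne_zero (fun h1 => h (Or.inl h1)) (fun h1 => h (Or.inr h1))
  have hρe : ∀ p q, IsEdge S p q → p ∈ V → nullA x z (b p) (c p) ≠ 0 ∧ nullB x z (b p) (c p) ≠ 0 ∧
      ρ p = nullA x z (b p) (c p) / nullB x z (b p) (c p) := by
    intro p q hpq hp
    have h1 : ¬ (nullA x z (b p) (c p) = 0 ∨ nullB x z (b p) (c p) = 0) := fun h =>
      hnn p q hpq ((hst p hp).bsq_eq_zero hx hz hzx (hdiv p (VS hp)) (mul_eq_zero.mpr h))
    refine ⟨fun h => h1 (Or.inl h), fun h => h1 (Or.inr h), ?_⟩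
    simp only [hρ]
    rw [if_neg h1]
  have hrel : ∀ p ∈ V, ∀ q ∈ V, IsEdge S p q →
      ρ q * turn (c p) (c q) ^ 2 = ρ p * conj (turn (c p) (c q)) ^ 2 := by
    intro p hp q hq hpq
    obtain ⟨h1, h2, h3⟩ := hρe p q hpq hp
    obtain ⟨h4, h5, h6⟩ := hρe q p hpq.symm hq
    have := IsStereo.relation h0 hb hdiv hS hx hz hzx hpq (hst p hp) (hst q hq)
      (hcne p hp q hq hpq.2.2.1)
    rw [h3, h6]
    simp only [turn, map_add, map_mul, map_one, Complex.conj_conj]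
    field_simp
    linear_combination -this
  refine holonomy_contradiction V f g c ρ hA hB hCV (div_pos hzC (hσ C hCV)) hgA hgB hg0
    (fun v hv h => hBmax v ((gW v hv).mpr h)) (fun v hv h => hAmin v ((gW v hv).mpr h)) hfAB
    (fun v hv => div_nonneg (hquart v (VS hv) (Vθ hv)).2.1 (hh v hv).le)
    (fun v hv => div_nonneg (hquart v (VS hv) (Vθ hv)).1 (hh v hv).le) hρ0
    (fun v hv h => by rw [him_eq v hv]; exact div_pos h (hH v hv))
    (by rw [him_eq A hA, hgA, zero_div]) (by rw [him_eq B hB, hgB, zero_div]) ?_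
    (fun p hp q hq h => ?_) (fun p hp q hq h => by rw [eIm p hp q hq, h, sub_self, mul_zero]) ?_
    (fun p hp q hq h => ?_) (fun p hp q hq h => ?_) hinj
    (fun p hp q hq hpq l m h1 h2 h3 => hrel p hp q hq (hedge p hp q hq hpq l m h1 h2 h3))
  · rw [hre_eq A hA, hre_eq B hB, hgA, hgB]
    have := lt_of_quadratic (hH A hA) (hH B hB) (hquad0 A) (hquad A hA)
      (by rw [hquad B hB, hgA, hgB]) hfAB
    exact div_lt_div_of_pos_left (by norm_num) (hH A hA) this
  · rw [eIm p hp q hq]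
    exact mul_pos (div_pos (mul_pos (hσ p hp) (hσ q hq)) (mul_pos (hh p hp) (hh q hq)))
      (sub_pos.mpr h)
  · intro p hp q hq hg hf
    rw [him_eq p hp, him_eq q hq, hg]
    have := le_of_quadratic (hH p hp) (hH q hq) (hquad0 p) (hquad p hp)
      (by rw [hquad q hq, hg]) hf
    exact div_le_div_of_nonneg_left (hg0 q hq) (hH p hp) this
  · rw [edet A hA p hp q hq]
    refine mul_nonpos_of_nonneg_of_nonpos ?_ h
    have := hσ A hA; have := hσ p hp; have := hσ q hq
    have := hh A hA; have := hh p hp; have := hh q hq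
    positivity
  · rw [edet A hA p hp q hq]
    refine mul_nonneg ?_ h
    have := hσ A hA; have := hσ p hp; have := hσ q hq
    have := hh A hA; have := hh p hp; have := hh q hq
    positivity

end Conj

/-! ### Helical modes and the nonplanar case -/

/-- The bilinear cross product on `ℂ³`. -/
noncomputable def crossC (u v : C3) : C3 :=
  !₂[u 1 * v 2 - u 2 * v 1, u 2 * v 0 - u 0 * v 2, u 0 * v 1 - u 1 * v 0]

@[simp] lemma crossC_zero (m n : C3) : crossC m n 0 = m 1 * n 2 - m 2 * n 1 := rfl
@[simp] lemma crossC_one (m n : C3) : crossC m n 1 = m 2 * n 0 - m 0 * n 2 := rfl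
@[simp] lemma crossC_two (m n : C3) : crossC m n 2 = m 0 * n 1 - m 1 * n 0 := rfl

lemma cdot_crossC_toC (n : E3) (u : C3) (y : E3) :
    cdot (crossC (toC n) u) y = cdot u (cross3 y n) := by
  simp only [cdot_eq3, crossC_zero, crossC_one, crossC_two, toC_apply, cross3_zero, cross3_one,
    cross3_two]
  push_cast; ring

lemma exists_smul_of_forall_perp {N : E3} (hN : N ≠ 0) {w : C3}
    (h : ∀ y : E3, inner ℝ N y = (0 : ℝ) → cdot w y = 0) : ∃ c : ℂ, w = c • toC N := by
  have hN2 : ‖N‖ ^ 2 ≠ 0 := pow_ne_zero 2 (norm_ne_zero_iff.mpr hN)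
  have key : ∀ y : E3, cdot w y = (inner ℝ N y / ‖N‖ ^ 2 : ℝ) * cdot w N := by
    intro y
    have h1 := h (y - (inner ℝ N y / ‖N‖ ^ 2) • N) (by
      rw [inner_sub_right, inner_smul_right, real_inner_self_eq_norm_sq, div_mul_cancel₀ _ hN2,
        sub_self])
    rw [cdot_sub_right, cdot_smul_right, sub_eq_zero] at h1
    exact h1
  refine ⟨cdot w N / ((‖N‖ ^ 2 : ℝ) : ℂ), ?_⟩
  ext i
  have h1 := key (EuclideanSpace.single i 1)
  have h2 : cdot w (EuclideanSpace.single i 1) = w i := by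
    fin_cases i <;> simp [cdot_eq3]
  have h3 : inner ℝ N (EuclideanSpace.single i 1) = N i := by
    fin_cases i <;> simp [inner_eq3]
  rw [h2, h3] at h1
  rw [h1, PiLp.smul_apply, smul_eq_mul, toC_apply]
  push_cast; ring

lemma crossC_toC_eq_smul {e n : E3} {u : C3} {κ : ℂ} (he : ‖e‖ = 1) (hen : inner ℝ e n = (0 : ℝ))
    (hn : n ≠ 0) (hu : cdot u n = 0) (h1 : cdot u (cross3 e n) = κ * cdot u e)
    (h2 : κ * cdot u (cross3 e n) = - ((‖n‖ ^ 2 : ℝ) : ℂ) * cdot u e) :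
    crossC (toC n) u = κ • u := by
  rw [← sub_eq_zero]
  apply eq_zero_of_cdot_eq_zero (cross3_ne_zero_of_perp he hen hn)
  · rw [cdot_sub_left, cdot_smul_left, cdot_crossC_toC, h1, sub_self]
  · rw [cdot_sub_left, cdot_smul_left, cdot_crossC_toC, hu]
    have : cross3 n n = 0 := by
      apply ext3 <;> simp <;> ring
    simp [this]
  · rw [cdot_sub_left, cdot_smul_left, cdot_crossC_toC, h2]
    have : cross3 (cross3 e n) n = (inner ℝ e n : ℝ) • n - (‖n‖ ^ 2 : ℝ) • e := by
      rw [← real_inner_self_eq_norm_sq, inner_eq3, inner_eq3]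
      apply ext3 <;> simp <;> ring
    rw [this, hen, zero_smul, zero_sub, cdot_neg_right, cdot_smul_right]
    ring

lemma eq_zero_of_helical {a m : E3} {u : C3} {κ : ℂ} (ham : cross3 a m ≠ 0)
    (hu : crossC (toC a) u = κ • u) (hua : cdot u a = 0) (hum : cdot u m = 0) : u = 0 := by
  apply eq_zero_of_cdot_eq_zero ham hua hum
  have h := cdot_crossC_toC a u m
  rw [hu, cdot_smul_left, hum, mul_zero] at h
  have h2 : cross3 a m = - cross3 m a := by apply ext3 <;> simp <;> ring
  rw [h2, cdot_neg_right, ← h, neg_zero]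

/-- The interaction of two divergence-free modes in terms of their curls. -/
lemma cdot_mul_cdot_eq (u v : C3) (n y : E3) : cdot u n * cdot v y =
    ((inner ℝ n y : ℝ) : ℂ) * (u 0 * v 0 + u 1 * v 1 + u 2 * v 2) -
      cdot (crossC u (crossC (toC n) v)) y := by
  simp only [cdot_eq3, inner_eq3, crossC_zero, crossC_one, crossC_two, toC_apply]
  push_cast; ring

/-- The Lamb form of the convection term. Tested against `y` orthogonal to `N`, the gradient part is
antisymmetric in the two frequencies, and so is `κ b × b`; only the defect `w` from being helical
remains. -/
lemma cdot_interactionSum_curl {S : Finset E3} {b w : E3 → C3} {κ : ℂ}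
    (hw : ∀ n ∈ S, crossC (toC n) (b n) = w n + κ • b n) {N y : E3} (hy : inner ℝ N y = (0 : ℝ)) :
    cdot (interactionSum S b N) y =
      -2 * pairSum S S (fun m n => cdot (crossC (b m) (w n)) y) N := by
  rw [cdot_interactionSum']
  have h1 : pairSum S S (fun m n => cdot (b m) n * cdot (b n) y) N =
      pairSum S S (fun m n => (((inner ℝ n y - inner ℝ m y : ℝ) : ℂ) / 2 *
        (b m 0 * b n 0 + b m 1 * b n 1 + b m 2 * b n 2) - κ * cdot (crossC (b m) (b n)) y) +
        (-1) * cdot (crossC (b m) (w n)) y) N := by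
    refine pairSum_congr fun m hm n hn hmn => ?_
    rw [cdot_mul_cdot_eq, hw n hn]
    have h2 : (inner ℝ m y : ℝ) = - inner ℝ n y := by
      rw [← hmn, inner_add_left] at hy; linarith
    rw [h2]
    simp only [cdot_eq3, crossC_zero, crossC_one, crossC_two, PiLp.add_apply, PiLp.smul_apply,
      smul_eq_mul]
    push_cast; ring
  rw [h1, pairSum_add, pairSum_mul_left, pairSum_antisymm, zero_add]
  · ring
  · intro m _ n _
    simp only [cdot_eq3, crossC_zero, crossC_one, crossC_two]
    push_cast; ring

lemma exists_helical_of_spanning {S : Finset E3} {b : E3 → C3} (h0 : (0 : E3) ∉ S)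
    (hsymm : ∀ n ∈ S, -n ∈ S) (hspan : ∀ d : E3, d ≠ 0 → ∃ n ∈ S, inner ℝ d n ≠ (0 : ℝ))
    (hb : ∀ n ∈ S, b n ≠ 0) (hdiv : ∀ n ∈ S, cdot (b n) n = 0)
    (hconj : ∀ n ∈ S, ∀ i, b (-n) i = starRingEnd ℂ (b n i)) (hS : OuterBalanced S b) :
    ∃ (κ : ℂ) (r : ℝ), 0 < r ∧ ∀ n ∈ S, crossC (toC n) (b n) = κ • b n ∧ ‖n‖ = r := by
  classical
  obtain ⟨p, q, hpq, hnull⟩ := exists_null_edge h0 hsymm hspan hb hdiv hS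
  have hedge := hpq
  obtain ⟨hp, hq, hne, Θ₀, hΘp, hΘq, -⟩ := hpq
  have hp0 : p ≠ 0 := fun h => h0 (h ▸ hp)
  have hq0 : q ≠ 0 := fun h => h0 (h ▸ hq)
  have hcr : cross3 p q ≠ 0 := by
    intro h
    obtain ⟨c, rfl⟩ := (cross3_eq_zero_iff hp0).mp h
    rw [inner_smul_right, hΘp, mul_one] at hΘq
    rw [hΘq, one_smul] at hne
    exact hne rfl
  have hcn : ‖cross3 p q‖ ≠ 0 := norm_ne_zero_iff.mpr hcr
  obtain ⟨e, he, hep, heq⟩ : ∃ e : E3, ‖e‖ = 1 ∧ inner ℝ e p = (0 : ℝ) ∧ inner ℝ e q = (0 : ℝ) :=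
    ⟨(‖cross3 p q‖⁻¹ : ℝ) • cross3 p q,
      by rw [norm_smul, norm_inv, norm_norm, inv_mul_cancel₀ hcn],
      by rw [real_inner_smul_left, inner_cross3_left, mul_zero],
      by rw [real_inner_smul_left, inner_cross3_right, mul_zero]⟩
  have hpC : ((‖p‖ ^ 2 : ℝ) : ℂ) ≠ 0 :=
    Complex.ofReal_ne_zero.mpr (pow_ne_zero 2 (norm_ne_zero_iff.mpr hp0))
  have hαp : cdot (b p) (cross3 e p) = ((‖p‖ ^ 2 : ℝ) : ℂ) * alpha e b p := by
    rw [alpha, mul_div_cancel₀ _ hpC]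
  have hαβ : cdot (b p) e ^ 2 = - ((‖p‖ ^ 2 : ℝ) : ℂ) * alpha e b p ^ 2 := by
    have h := bsq_frame hep (b p)
    rw [hnull, hdiv p hp, hαp, he] at h
    apply mul_left_cancel₀ hpC
    simp only [one_pow, Complex.ofReal_one] at h
    linear_combination -h
  rcases edge_alternative h0 hb hdiv hS hedge he hep heq with ⟨h1, -⟩ | ⟨h1, h2, h3, h4, Θ, h5, h6, h7⟩
  · exfalso
    apply hb p hp
    rw [h1] at hαβ hαp
    apply eq_zero_of_cdot_eq_zero (cross3_ne_zero_of_perp he hep hp0)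
    · exact pow_eq_zero_iff (two_ne_zero) |>.mp (by rw [hαβ]; ring)
    · exact hdiv p hp
    · rw [hαp, mul_zero]
  have hαq : cdot (b q) (cross3 e q) = ((‖p‖ ^ 2 : ℝ) : ℂ) * alpha e b q := by
    rw [alpha, ← h3, mul_div_cancel₀ _ hpC]
  -- The ratio of normal to in-plane part determines the curl eigenvalue. Nullity of `b p` gives `κ
  -- ^ 2 = -‖p‖ ^ 2`, and the edge alternative gives the same ratio and the same norm at `q`.
  obtain ⟨κ, hκ⟩ : ∃ κ : ℂ, κ = - cdot (b p) e / alpha e b p := ⟨_, rfl⟩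
  have hβp : cdot (b p) e = -κ * alpha e b p := by rw [hκ]; field_simp
  have hβq : cdot (b q) e = -κ * alpha e b q := by
    apply mul_left_cancel₀ h1
    rw [h4, hβp]; ring
  have hκ2 : κ ^ 2 = - ((‖p‖ ^ 2 : ℝ) : ℂ) := by
    rw [hβp] at hαβ
    apply mul_right_cancel₀ (pow_ne_zero 2 h1)
    linear_combination hαβ
  have hcp : crossC (toC p) (b p) = κ • b p := by
    apply crossC_toC_eq_smul he hep hp0 (hdiv p hp)
    · rw [hαp, hβp]; linear_combination alpha e b p * hκ2
    · rw [hαp, hβp]; ring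
  have hcq : crossC (toC q) (b q) = κ • b q := by
    apply crossC_toC_eq_smul he heq hq0 (hdiv q hq)
    · rw [hαq, hβq]; linear_combination alpha e b q * hκ2
    · rw [hαq, hβq, h3]; ring
  -- `κ` is purely imaginary, so complex conjugation relates the defects at `n` and `-n`, and the
  -- set `R` of defective frequencies is symmetric.
  have hκc : starRingEnd ℂ κ = -κ := by
    have hre := congrArg Complex.re hκ2
    have him := congrArg Complex.im hκ2
    rw [pow_two, Complex.mul_im, Complex.neg_im, Complex.ofReal_im] at him
    rw [pow_two, Complex.mul_re, Complex.neg_re, Complex.ofReal_re] at hre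
    have hpp : 0 < ‖p‖ ^ 2 := pow_pos (norm_pos_iff.mpr hp0) 2
    have hre0 : κ.re = 0 := by
      by_contra hne0
      have : κ.im = 0 := by
        have h8 : κ.re * κ.im = 0 := by linarith
        exact (mul_eq_zero.mp h8).resolve_left hne0
      rw [this] at hre
      nlinarith [mul_self_nonneg κ.re]
    apply Complex.ext <;> simp [hre0]
  set w : E3 → C3 := fun n => crossC (toC n) (b n) - κ • b n with hw
  have hw' : ∀ n ∈ S, crossC (toC n) (b n) = w n + κ • b n := fun n _ => by simp [hw]
  set R := S.filter (fun n => w n ≠ 0) with hR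
  have memR : ∀ {n}, n ∈ R ↔ n ∈ S ∧ w n ≠ 0 := by intro n; rw [hR, Finset.mem_filter]
  have hwp : w p = 0 := by simp only [hw]; rw [hcp, sub_self]
  have hwq : w q = 0 := by simp only [hw]; rw [hcq, sub_self]
  have hwneg : ∀ n ∈ S, ∀ i, w (-n) i = - starRingEnd ℂ (w n i) := by
    intro n hn i
    have h8 := hconj n hn
    fin_cases i <;>
      simp [hw, h8, map_sub, hκc] <;> ring
  have hRe : R = ∅ := by
    by_contra hRne
    obtain ⟨m, hm, a, ha, hpar, hnS, hN0, huniq⟩ := exists_unique_sum (V := S) (R := R)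
      (Finset.filter_subset _ _) (by
        intro n hn
        obtain ⟨h8, h9⟩ := memR.mp hn
        refine memR.mpr ⟨hsymm n h8, fun h => h9 ?_⟩
        ext i
        have := hwneg n h8 i
        rw [h] at this
        simpa using this.symm) (fun h => h0 (memR.mp h).1)
      (Finset.nonempty_iff_ne_empty.mpr hRne) (fun h => (memR.mp h).2 hwp) hne h5 h6 h7
    obtain ⟨hmS, hwm⟩ := memR.mp hm
    have haS : a ∈ S := by rcases ha with rfl | rfl <;> assumption
    have hca : crossC (toC a) (b a) = κ • b a := by rcases ha with rfl | rfl <;> assumption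
    have ha0 : a ≠ 0 := fun h => h0 (h ▸ haS)
    have ham : cross3 a m ≠ 0 := fun h => by
      obtain ⟨c, hc⟩ := (cross3_eq_zero_iff ha0).mp h
      exact hpar c hc
    have hD : ∀ y : E3, inner ℝ (a + m) y = (0 : ℝ) → cdot (crossC (b a) (w m)) y = 0 := by
      intro y hy
      have h8 := cdot_helmholtzProj hN0 (interactionSum S b (a + m)) hy
      rw [hS _ hN0 hnS, cdot_zero_left, cdot_interactionSum_curl hw' hy,
        pairSum_eq_single haS hmS] at h8
      · simpa using h8.symm
      · intro k hk l hl hkl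
        by_cases hlR : l ∈ R
        · exact Or.inl (huniq k hk l hlR hkl)
        · right
          have : w l = 0 := by
            by_contra h9
            exact hlR (memR.mpr ⟨hl, h9⟩)
          rw [this]
          simp [cdot_eq3]
    obtain ⟨c, hc⟩ := exists_smul_of_forall_perp hN0 hD
    have hwm_div : cdot (w m) m = 0 := by
      simp only [hw]
      rw [cdot_sub_left, cdot_smul_left, cdot_crossC_toC, hdiv m hmS]
      have : cross3 m m = 0 := by apply ext3 <;> simp <;> ring
      simp [this]
    have hbam : cdot (b a) m ≠ 0 := fun h =>
      hb a haS (eq_zero_of_helical ham hca (hdiv a haS) h)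
    have c0 := congrArg (fun v : C3 => v 0) hc
    have c1 := congrArg (fun v : C3 => v 1) hc
    have c2 := congrArg (fun v : C3 => v 2) hc
    simp only [crossC_zero, crossC_one, crossC_two, PiLp.smul_apply, smul_eq_mul, toC_apply] at c0 c1 c2
    -- Pairing `b a × w m = c (a + m)` with `b a` annihilates the left side, while `b a · (a + m) =
    -- b a · m` is nonzero.
    have hc0 : c = 0 := by
      have h9 : c * cdot (b a) (a + m) = 0 := by
        rw [cdot_eq3]
        linear_combination -(b a 0) * c0 - (b a 1) * c1 - (b a 2) * c2
      rw [cdot_add_right, hdiv a haS, zero_add] at h9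
      exact (mul_eq_zero.mp h9).resolve_right hbam
    rw [hc0] at c0 c1 c2
    apply hwm
    rw [cdot_eq3] at hbam hwm_div
    -- Now `b a × w m = 0`. Its cross product with `m` is `b a (m · w m) - w m (m · b a)`, whose
    -- first term vanishes because `w m` is divergence-free.
    apply extC3
    · apply mul_left_cancel₀ hbam
      simp only [PiLp.zero_apply]
      linear_combination (b a 0) * hwm_div - (m 1 : ℂ) * c2 + (m 2 : ℂ) * c1
    · apply mul_left_cancel₀ hbam
      simp only [PiLp.zero_apply]
      linear_combination (b a 1) * hwm_div + (m 0 : ℂ) * c2 - (m 2 : ℂ) * c0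
    · apply mul_left_cancel₀ hbam
      simp only [PiLp.zero_apply]
      linear_combination (b a 2) * hwm_div - (m 0 : ℂ) * c1 + (m 1 : ℂ) * c0
  have hall : ∀ n ∈ S, crossC (toC n) (b n) = κ • b n := by
    intro n hn
    have : w n = 0 := by
      by_contra h9
      have : n ∈ R := memR.mpr ⟨hn, h9⟩
      rw [hRe] at this
      simp at this
    rw [hw' n hn, this, zero_add]
  refine ⟨κ, ‖p‖, norm_pos_iff.mpr hp0, fun n hn => ⟨hall n hn, ?_⟩⟩
  have h8 := hall n hn
  have c0 := congrArg (fun v : C3 => v 0) h8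
  have c1 := congrArg (fun v : C3 => v 1) h8
  have c2 := congrArg (fun v : C3 => v 2) h8
  have hd := hdiv n hn
  rw [cdot_eq3] at hd
  simp only [crossC_zero, crossC_one, crossC_two, PiLp.smul_apply, smul_eq_mul, toC_apply] at c0 c1 c2
  -- Applying `n ×` twice to a divergence-free vector multiplies it by `-‖n‖ ^ 2`, so a helical
  -- amplitude satisfies `κ ^ 2 = -‖n‖ ^ 2`.
  have hsq : ∀ i, (((‖n‖ ^ 2 : ℝ) : ℂ) - ((‖p‖ ^ 2 : ℝ) : ℂ)) * b n i = 0 := by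
    have h9 : (((‖n‖ ^ 2 : ℝ) : ℂ)) = (n 0 : ℂ) ^ 2 + (n 1 : ℂ) ^ 2 + (n 2 : ℂ) ^ 2 := by
      rw [← real_inner_self_eq_norm_sq, inner_eq3]; push_cast; ring
    have h10 : (((‖p‖ ^ 2 : ℝ) : ℂ)) = - κ ^ 2 := by rw [hκ2, neg_neg]
    rw [h9, h10]
    intro i
    fin_cases i
    · show _ * b n 0 = 0
      linear_combination (n 0 : ℂ) * hd - κ * c0 - (n 1 : ℂ) * c2 + (n 2 : ℂ) * c1
    · show _ * b n 1 = 0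
      linear_combination (n 1 : ℂ) * hd - κ * c1 + (n 0 : ℂ) * c2 - (n 2 : ℂ) * c0
    · show _ * b n 2 = 0
      linear_combination (n 2 : ℂ) * hd - κ * c2 - (n 0 : ℂ) * c1 + (n 1 : ℂ) * c0
  have h11 : ((‖n‖ ^ 2 : ℝ) : ℂ) - ((‖p‖ ^ 2 : ℝ) : ℂ) = 0 := by
    by_contra h12
    apply hb n hn
    ext i
    exact (mul_eq_zero.mp (hsq i)).resolve_left h12
  have h13 : ‖n‖ ^ 2 = ‖p‖ ^ 2 := by
    have := sub_eq_zero.mp h11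
    exact_mod_cast this
  exact (pow_left_inj₀ (norm_nonneg _) (norm_nonneg _) two_ne_zero).mp h13

/-! ### The in-plane part of a planar field -/

lemma eq_smul_of_brk_eq_zero {e a m : E3} (he : ‖e‖ = 1) (ha : inner ℝ e a = (0 : ℝ))
    (hm : inner ℝ e m = (0 : ℝ)) (ha0 : a ≠ 0) (h : brk e a m = 0) :
    m = (inner ℝ a m / ‖a‖ ^ 2 : ℝ) • a := by
  have hx := cross3_basis_expansion e a m
  unfold brk at h
  have hee : inner ℝ e e = (1 : ℝ) := by rw [real_inner_self_eq_norm_sq, he]; norm_num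
  rw [norm_cross3_of_perp he ha, h, real_inner_comm, hm, ha, hee, real_inner_comm] at hx
  have hn : ‖a‖ ^ 2 ≠ 0 := pow_ne_zero 2 (norm_ne_zero_iff.mpr ha0)
  simp only [zero_mul, mul_zero, sub_zero, zero_smul, mul_one, zero_add, add_zero] at hx
  rw [div_eq_inv_mul, mul_smul, real_inner_comm, ← hx, smul_smul, inv_mul_cancel₀ hn, one_smul]

lemma eq_zero_of_planar {e a x : E3} (he : ‖e‖ = 1) (ha : inner ℝ e a = (0 : ℝ)) (ha0 : a ≠ 0)
    (h1 : inner ℝ e x = (0 : ℝ)) (h2 : inner ℝ a x = (0 : ℝ)) (h3 : brk e a x = 0) : x = 0 := by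
  have := eq_smul_of_brk_eq_zero he ha h1 ha0 h3
  rw [this, h2, zero_div, zero_smul]

/-- A planar symmetric set which is not contained in a line has an edge. -/
lemma exists_planar_edge {e : E3} {T : Finset E3} (he : ‖e‖ = 1)
    (hT : ∀ n ∈ T, inner ℝ e n = (0 : ℝ)) (h0 : (0 : E3) ∉ T) (hsymm : ∀ n ∈ T, -n ∈ T)
    (hne : T.Nonempty) (hline : ∀ a ∈ T, ∃ n ∈ T, brk e a n ≠ 0) :
    ∃ A ∈ T, ∃ B ∈ T, A ≠ B ∧ ∃ Θ : E3, inner ℝ Θ A = (1 : ℝ) ∧ inner ℝ Θ B = (1 : ℝ) ∧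
      ∀ n ∈ T, inner ℝ Θ n ≤ 1 ∧ (inner ℝ Θ n = (1 : ℝ) → n ∈ segment ℝ A B) := by
  classical
  obtain ⟨A, hA, hmax⟩ := T.exists_max_image (fun n => ‖n‖) hne
  have hA0 : A ≠ 0 := fun h => h0 (h ▸ hA)
  have hA2 : 0 < ‖A‖ ^ 2 := pow_pos (norm_pos_iff.mpr hA0) 2
  have hlt : ∀ n ∈ T, n ≠ A → inner ℝ A n < ‖A‖ ^ 2 := by
    intro n hn hnA
    have h1 : 0 < ‖n - A‖ ^ 2 := pow_pos (norm_pos_iff.mpr (sub_ne_zero.mpr hnA)) 2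
    rw [norm_sub_sq_real, real_inner_comm] at h1
    have h2 : ‖n‖ ^ 2 ≤ ‖A‖ ^ 2 := pow_le_pow_left₀ (norm_nonneg n) (hmax n hn) 2
    linarith
  obtain ⟨v, hv, hvA⟩ := hline A hA
  obtain ⟨t, ht0, ht, w, hw, hdw, hwt⟩ := exists_tangent T
    (fun n => 1 - inner ℝ A n / ‖A‖ ^ 2) (fun n => brk e A n)
    (fun n hn => by
      by_cases h : n = A
      · rw [h, real_inner_self_eq_norm_sq, div_self hA2.ne', sub_self]
      · have := (div_lt_one hA2).mpr (hlt n hn h)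
        linarith)
    (by
      rcases lt_or_gt_of_ne hvA with h | h
      · exact ⟨-v, hsymm v hv, by rw [brk_neg_right]; linarith⟩
      · exact ⟨v, hv, h⟩)
  set Θ : E3 := (‖A‖ ^ 2)⁻¹ • A + t • cross3 e A with hΘ
  have eΘ : ∀ n, inner ℝ Θ n = inner ℝ A n / ‖A‖ ^ 2 + t * brk e A n := fun n => by
    rw [hΘ, inner_add_left, real_inner_smul_left, real_inner_smul_left, brk]; ring
  have hΘA : inner ℝ Θ A = (1 : ℝ) := by
    rw [eΘ, real_inner_self_eq_norm_sq, div_self hA2.ne', brk_self, mul_zero, add_zero]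
  have hΘle : ∀ n ∈ T, inner ℝ Θ n ≤ (1 : ℝ) := fun n hn => by rw [eΘ]; linarith [ht n hn]
  set E := T.filter (fun n => inner ℝ Θ n = (1 : ℝ)) with hE
  have hwE : w ∈ E := Finset.mem_filter.mpr ⟨hw, by rw [eΘ]; linarith⟩
  obtain ⟨B, hBE, hBmax⟩ := E.exists_max_image (fun n => brk e A n) ⟨w, hwE⟩
  obtain ⟨hB, hΘB⟩ := Finset.mem_filter.mp hBE
  have hdB : 0 < brk e A B := lt_of_lt_of_le hdw (hBmax w hwE)
  refine ⟨A, hA, B, hB, ?_, Θ, hΘA, hΘB, fun n hn => ⟨hΘle n hn, fun hn1 => ?_⟩⟩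
  · rintro rfl
    simp at hdB
  have hdn : 0 ≤ brk e A n := by
    by_cases hnA : n = A
    · rw [hnA, brk_self]
    · have h1 := (div_lt_one hA2).mpr (hlt n hn hnA)
      rw [eΘ] at hn1
      by_contra! h2
      nlinarith [mul_nonneg ht0 (neg_nonneg.mpr h2.le)]
  have hdnB : brk e A n ≤ brk e A B := hBmax n (Finset.mem_filter.mpr ⟨hn, hn1⟩)
  have hseg : n - A - (brk e A n / brk e A B) • (B - A) = 0 := by
    have h3 : brk e A (n - A - (brk e A n / brk e A B) • (B - A)) = 0 := by
      rw [brk_sub_right, brk_sub_right, brk_smul_right, brk_sub_right, brk_self]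
      field_simp; ring
    refine eq_zero_of_planar he (hT A hA) hA0 ?_ ?_ h3
    · rw [inner_sub_right, inner_sub_right, inner_smul_right, inner_sub_right, hT n hn, hT A hA,
        hT B hB]; ring
    · have h4 : inner ℝ Θ (n - A - (brk e A n / brk e A B) • (B - A)) = (0 : ℝ) := by
        rw [inner_sub_right, inner_sub_right, inner_smul_right, inner_sub_right, hn1, hΘA, hΘB]
        ring
      rw [eΘ, h3, mul_zero, add_zero] at h4
      exact (div_eq_zero_iff.mp h4).resolve_right hA2.ne'
  rw [segment_eq_image']
  refine ⟨brk e A n / brk e A B, ⟨div_nonneg hdn hdB.le, (div_le_one hdB).mpr hdnB⟩, ?_⟩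
  rw [sub_eq_zero, sub_eq_iff_eq_add] at hseg
  show A + (brk e A n / brk e A B) • (B - A) = n
  conv_rhs => rw [hseg]
  exact add_comm _ _

/-- The frequencies carrying a nonzero in-plane part. -/
noncomputable def planarSupport (S : Finset E3) (a : E3 → ℂ) : Finset E3 := by
  classical exact S.filter (fun n => a n ≠ 0)

lemma mem_planarSupport {S : Finset E3} {a : E3 → ℂ} {n : E3} :
    n ∈ planarSupport S a ↔ n ∈ S ∧ a n ≠ 0 := by
  classical
  unfold planarSupport
  rw [Finset.mem_filter]

/-- If the in-plane frequencies were collinear, let `A` be the farthest one along their line and `m`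
the frequency of `S` farthest across the line, then farthest along it. The sum `A + m` leaves `S`,
is hit once, and carries `a A` times the nonzero normal part of `m`. -/
lemma planarSupport_noncollinear {e : E3} {S : Finset E3} {a β : E3 → ℂ} (he : ‖e‖ = 1)
    (hS : ∀ n ∈ S, inner ℝ e n = (0 : ℝ)) (h0 : (0 : E3) ∉ S) (hsymm : ∀ n ∈ S, -n ∈ S)
    (hspan : ∀ m ∈ S, ∃ n ∈ S, brk e m n ≠ 0) (hab : ∀ n ∈ S, a n ≠ 0 ∨ β n ≠ 0)
    (hβ : ∀ N, N ≠ 0 → N ∉ S → Lop e S a β N = 0) {d : E3} (hd : d ∈ planarSupport S a) :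
    ∃ n ∈ planarSupport S a, brk e d n ≠ 0 := by
  classical
  by_contra! hcol
  obtain ⟨hdS, -⟩ := mem_planarSupport.mp hd
  have hd0 : d ≠ 0 := fun h => h0 (h ▸ hdS)
  obtain ⟨A, hA, hAmax⟩ := (planarSupport S a).exists_max_image (fun n => (inner ℝ d n : ℝ)) ⟨d, hd⟩
  obtain ⟨hAS, haA⟩ := mem_planarSupport.mp hA
  have hdA : 0 < (inner ℝ d A : ℝ) := by
    have := hAmax d hd
    rw [real_inner_self_eq_norm_sq] at this
    exact lt_of_lt_of_le (pow_pos (norm_pos_iff.mpr hd0) 2) this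
  obtain ⟨v, hv, hvd⟩ := hspan d hdS
  obtain ⟨m₀, hm₀, hm₀max⟩ := S.exists_max_image (fun n => brk e d n) ⟨d, hdS⟩
  have hpos : 0 < brk e d m₀ := by
    rcases lt_or_gt_of_ne hvd with h | h
    · have := hm₀max _ (hsymm v hv)
      rw [brk_neg_right] at this; linarith
    · exact lt_of_lt_of_le h (hm₀max v hv)
  obtain ⟨m, hm, hmmax⟩ := (S.filter (fun n => brk e d n = brk e d m₀)).exists_max_image
    (fun n => (inner ℝ d n : ℝ)) ⟨m₀, Finset.mem_filter.mpr ⟨hm₀, rfl⟩⟩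
  obtain ⟨hmS, hml⟩ := Finset.mem_filter.mp hm
  have hNl : brk e d (A + m) = brk e d m₀ := by rw [brk_add_right, hcol A hA, hml, zero_add]
  have hN0 : A + m ≠ 0 := fun h => by rw [h, brk_zero_right] at hNl; linarith
  have hNS : A + m ∉ S := fun h => by
    have := hmmax _ (Finset.mem_filter.mpr ⟨h, hNl⟩)
    rw [inner_add_right] at this; linarith
  have h1 := hβ _ hN0 hNS
  unfold Lop at h1
  rw [pairSum_eq_single hAS hmS] at h1
  · have ham : a m = 0 := by
      by_contra h2
      have := hcol m (mem_planarSupport.mpr ⟨hmS, h2⟩)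
      linarith
    have hβm : β m ≠ 0 := (hab m hmS).resolve_left (not_not.mpr ham)
    have hbrk : (brk e A m : ℂ) ≠ 0 := by
      rw [Complex.ofReal_ne_zero]
      intro h
      have hA0 : A ≠ 0 := fun h => h0 (h ▸ hAS)
      have h3 := eq_smul_of_brk_eq_zero he (hS A hAS) (hS m hmS) hA0 h
      rw [h3, brk_smul_right, hcol A hA, mul_zero] at hml
      linarith
    exact mul_ne_zero (mul_ne_zero haA hbrk) hβm h1
  · intro k hk l hl hkl
    by_cases hak : a k = 0
    · right; rw [hak]; ring
    have hkT := mem_planarSupport.mpr ⟨hk, hak⟩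
    have hl1 : brk e d l = brk e d m₀ := by
      rw [← hNl, ← hkl, brk_add_right, hcol k hkT, zero_add]
    have h2 := hmmax l (Finset.mem_filter.mpr ⟨hl, hl1⟩)
    have h3 := hAmax k hkT
    have h4 : (inner ℝ d k : ℝ) + inner ℝ d l = inner ℝ d A + inner ℝ d m := by
      rw [← inner_add_right, hkl, inner_add_right]
    left
    have hlm : l = m := by
      have h5 : l - m = 0 := by
        refine eq_zero_of_planar he (hS d hdS) hd0 ?_ ?_ ?_
        · rw [inner_sub_right, hS l hl, hS m hmS, sub_self]
        · rw [inner_sub_right]; linarith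
        · rw [brk_sub_right, hl1, hml, sub_self]
      exact sub_eq_zero.mp h5
    rw [hlm] at hkl
    exact ⟨add_right_cancel hkl, hlm⟩

/-- The in-plane part of a balanced planar field is either zero or supported on a circle. -/
lemma planarSupport_circle {e : E3} {S : Finset E3} {a β : E3 → ℂ} (he : ‖e‖ = 1)
    (hS : ∀ n ∈ S, inner ℝ e n = (0 : ℝ)) (h0 : (0 : E3) ∉ S) (hsymm : ∀ n ∈ S, -n ∈ S)
    (hspan : ∀ m ∈ S, ∃ n ∈ S, brk e m n ≠ 0) (hab : ∀ n ∈ S, a n ≠ 0 ∨ β n ≠ 0)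
    (hasymm : ∀ n ∈ S, a n ≠ 0 → a (-n) ≠ 0)
    (hβ : ∀ N, N ≠ 0 → N ∉ S → Lop e S a β N = 0)
    (hJ : ∀ N, N ≠ 0 → N ∉ planarSupport S a →
      Lop e S a (fun n => ((‖n‖ ^ 2 : ℝ) : ℂ) * a n) N = 0)
    (hne : (planarSupport S a).Nonempty) :
    ∃ r : ℝ, 0 < r ∧ (∀ n ∈ planarSupport S a, ‖n‖ = r) ∧
      ∃ A ∈ planarSupport S a, ∃ B ∈ planarSupport S a, A ≠ B ∧ ∃ Θ : E3,
        inner ℝ Θ A = (1 : ℝ) ∧ inner ℝ Θ B = (1 : ℝ) ∧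
        ∀ n ∈ planarSupport S a, n ≠ A → n ≠ B → inner ℝ Θ n < (1 : ℝ) := by
  classical
  set T := planarSupport S a with hT
  have memT : ∀ {n}, n ∈ T ↔ n ∈ S ∧ a n ≠ 0 := mem_planarSupport
  have TS : ∀ {n}, n ∈ T → n ∈ S := fun h => (memT.mp h).1
  have Tsymm : ∀ n ∈ T, -n ∈ T := fun n hn =>
    memT.mpr ⟨hsymm n (TS hn), hasymm n (TS hn) (memT.mp hn).2⟩
  have T0 : (0 : E3) ∉ T := fun h => h0 (TS h)
  obtain ⟨A, hA, B, hB, hAB, Θ, hΘA, hΘB, hΘ⟩ := exists_planar_edge he (fun n hn => hS n (TS hn)) T0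
    Tsymm hne (fun d hd => planarSupport_noncollinear he hS h0 hsymm hspan hab hβ hd)
  set E := T.filter (fun n => inner ℝ Θ n = (1 : ℝ)) with hE
  have memE : ∀ {n}, n ∈ E ↔ n ∈ T ∧ inner ℝ Θ n = (1 : ℝ) := by
    intro n; rw [hE, Finset.mem_filter]
  have hLop : ∀ m ∈ E, ∀ n ∈ E, Lop e E a (fun n => ((‖n‖ ^ 2 : ℝ) : ℂ) * a n) (m + n) = 0 := by
    intro m hm n hn
    have hsum : inner ℝ Θ (m + n) = (2 : ℝ) := by
      rw [inner_add_right, (memE.mp hm).2, (memE.mp hn).2]; norm_num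
    rw [← hJ (m + n) (fun h => by rw [h, inner_zero_right] at hsum; norm_num at hsum)
      (fun h => by linarith [(hΘ _ h).1])]
    symm
    refine pairSum_subset (fun k hk => TS (memE.mp hk).1) (fun k hk => TS (memE.mp hk).1) ?_
    intro k hk l hl hkl
    by_cases hak : a k = 0
    · right; rw [hak]; ring
    by_cases hal : a l = 0
    · right; simp [hal]
    left
    have hkT := memT.mpr ⟨hk, hak⟩
    have hlT := memT.mpr ⟨hl, hal⟩
    have h1 := (hΘ k hkT).1
    have h2 := (hΘ l hlT).1
    rw [← hkl, inner_add_right] at hsum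
    exact ⟨memE.mpr ⟨hkT, by linarith⟩, memE.mpr ⟨hlT, by linarith⟩⟩
  have hAE : A ∈ E := memE.mpr ⟨hA, hΘA⟩
  have hBE : B ∈ E := memE.mpr ⟨hB, hΘB⟩
  obtain ⟨hnorm, honly⟩ := edge_alpha_support he hAB
    (fun n hn => (hΘ n (memE.mp hn).1).2 (memE.mp hn).2) (fun n hn => hS n (TS (memE.mp hn).1))
    (fun n hn => (memE.mp hn).2) hLop hAE hBE (memT.mp hA).2 (memT.mp hB).2 hAB
  have hΘlt : ∀ n ∈ T, n ≠ A → n ≠ B → inner ℝ Θ n < (1 : ℝ) := by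
    intro n hn h1 h2
    refine lt_of_le_of_ne (hΘ n hn).1 fun h3 => ?_
    rcases honly n (memE.mpr ⟨hn, h3⟩) (memT.mp hn).2 with h | h
    · exact h1 h
    · exact h2 h
  have hA0 : A ≠ 0 := fun h => T0 (h ▸ hA)
  refine ⟨‖A‖, norm_pos_iff.mpr hA0, ?_, A, hA, B, hB, hAB, Θ, hΘA, hΘB, hΘlt⟩
  by_contra! hcon
  obtain ⟨n₀, hn₀, hn₀'⟩ := hcon
  set R := T.filter (fun n => ‖n‖ ≠ ‖A‖) with hR
  have memR : ∀ {n}, n ∈ R ↔ n ∈ T ∧ ‖n‖ ≠ ‖A‖ := by intro n; rw [hR, Finset.mem_filter]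
  obtain ⟨m, hm, c, hc, hpar, hNT, hN0, huniq⟩ := exists_unique_sum (V := T) (R := R)
    (Finset.filter_subset _ _)
    (fun n hn => memR.mpr ⟨Tsymm n (memR.mp hn).1, by rw [norm_neg]; exact (memR.mp hn).2⟩)
    (fun h => T0 (memR.mp h).1) ⟨n₀, memR.mpr ⟨hn₀, hn₀'⟩⟩ (fun h => (memR.mp h).2 rfl) hAB hΘA hΘB
    hΘlt
  have hcT : c ∈ T := by rcases hc with rfl | rfl <;> assumption
  obtain ⟨hmT, hmn⟩ := memR.mp hm
  have h1 := hJ _ hN0 hNT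
  -- Since `Lop_self` vanishes, `‖A‖ ^ 2` may be subtracted from the squared norm. The second factor
  -- is then supported on `R`, as needed for the uniquely represented sum.
  have h2 : Lop e S a (fun n => ((‖n‖ ^ 2 - ‖A‖ ^ 2 : ℝ) : ℂ) * a n) (c + m) = 0 := by
    have h3 := Lop_self e S a (c + m)
    unfold Lop at h1 h3 ⊢
    have h4 : pairSum S S (fun m n => a m * (brk e m n : ℂ) *
        (((‖n‖ ^ 2 - ‖A‖ ^ 2 : ℝ) : ℂ) * a n)) (c + m) =
        pairSum S S (fun m n => a m * (brk e m n : ℂ) * (((‖n‖ ^ 2 : ℝ) : ℂ) * a n) +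
          (-((‖A‖ ^ 2 : ℝ) : ℂ)) * (a m * (brk e m n : ℂ) * a n)) (c + m) :=
      pairSum_congr fun k _ l _ _ => by push_cast; ring
    rw [h4, pairSum_add, h1, pairSum_mul_left, h3]; ring
  unfold Lop at h2
  rw [pairSum_eq_single (TS hcT) (TS hmT)] at h2
  · have hbrk : (brk e c m : ℂ) ≠ 0 := by
      rw [Complex.ofReal_ne_zero]
      exact fun h => hpar _ (eq_smul_of_brk_eq_zero he (hS c (TS hcT)) (hS m (TS hmT))
        (fun h => T0 (h ▸ hcT)) h)
    have hsq : ((‖m‖ ^ 2 - ‖A‖ ^ 2 : ℝ) : ℂ) ≠ 0 := by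
      rw [Complex.ofReal_ne_zero, sub_ne_zero]
      exact fun h => hmn ((pow_left_inj₀ (norm_nonneg _) (norm_nonneg _) two_ne_zero).mp h)
    exact mul_ne_zero (mul_ne_zero (memT.mp hcT).2 hbrk) (mul_ne_zero hsq (memT.mp hmT).2) h2
  · intro k hk l hl hkl
    by_cases hak : a k = 0
    · right; rw [hak]; ring
    by_cases hal : a l = 0
    · right; simp [hal]
    by_cases hln : ‖l‖ = ‖A‖
    · right; simp [hln]
    exact Or.inl (huniq k (memT.mpr ⟨hk, hak⟩) l (memR.mpr ⟨memT.mpr ⟨hl, hal⟩, hln⟩) hkl)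

/-! ### Transport and polynomials in the stream function -/

/-- The recursion generates the binomial coefficients of `h` weighted by powers of `b / a`. A finite
support can begin only where the left factor `q` vanishes and end only where `h + 1 - q` vanishes,
hence at a natural `h`. -/
lemma rec_support {φ : ℝ → ℂ} {h : ℝ} {a b : ℂ} (ha : a ≠ 0) (hb : b ≠ 0)
    (hfin : {q | φ q ≠ 0}.Finite)
    (hrec : ∀ q : ℝ, a * q * φ q = b * ((h + 1 - q : ℝ) : ℂ) * φ (q - 1))
    (hne : ∃ q, φ q ≠ 0) : φ 0 ≠ 0 ∧ (∃ n : ℕ, h = n) ∧ ∀ q, φ q ≠ 0 → 0 ≤ q := by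
  obtain ⟨q₀, hq₀, hmin⟩ := hfin.exists_minimalFor id _ hne
  have hmin' : ∀ q, φ q ≠ 0 → q₀ ≤ q := fun q hq => by
    rcases le_total q₀ q with h | h
    · exact h
    · exact hmin hq h
  have h1 : φ (q₀ - 1) = 0 := by
    by_contra hc
    linarith [hmin' _ hc]
  have h2 := hrec q₀
  rw [h1, mul_zero] at h2
  have hq0 : q₀ = 0 := by
    have h3 := (mul_eq_zero.mp h2).resolve_right hq₀
    exact_mod_cast (mul_eq_zero.mp h3).resolve_left ha
  rw [hq0] at hq₀ hmin'
  refine ⟨hq₀, ?_, hmin'⟩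
  by_contra! hcon
  have h3 : ∀ n : ℕ, φ n ≠ 0 := by
    intro n
    induction n with
    | zero => simpa using hq₀
    | succ n ih =>
      intro h4
      have h5 := hrec (n + 1)
      push_cast at h4
      rw [h4, mul_zero, add_sub_cancel_right] at h5
      have h6 := (mul_eq_zero.mp h5.symm).resolve_right ih
      have h7 := (mul_eq_zero.mp h6).resolve_left hb
      have h8 : h + 1 - (n + 1 : ℝ) = 0 := by exact_mod_cast h7
      exact hcon n (by linarith)
  have h4 : (Set.range fun n : ℕ => (n : ℝ)) ⊆ {q | φ q ≠ 0} := by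
    rintro _ ⟨n, rfl⟩
    exact h3 n
  exact Set.infinite_range_of_injective Nat.cast_injective (hfin.subset h4)

/-- At a lowest negative support point the right side is zero while the left factor is not. -/
lemma rec_support_neg {φ : ℝ → ℂ} {h : ℝ} {a b : ℂ} (ha : a ≠ 0)
    (hfin : {q | φ q ≠ 0}.Finite)
    (hrec : ∀ q : ℝ, q < 0 → a * q * φ q = b * ((h + 1 - q : ℝ) : ℂ) * φ (q - 1)) :
    ∀ q < 0, φ q = 0 := by
  by_contra! hcon
  obtain ⟨q', hq', hφ'⟩ := hcon
  obtain ⟨q₀, ⟨hq₀, hq₀'⟩, hmin⟩ :=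
    (hfin.subset (Set.inter_subset_left (t := {q : ℝ | q < 0}))).exists_minimalFor id _
      ⟨q', hφ', hq'⟩
  have h1 : φ (q₀ - 1) = 0 := by
    by_contra hc
    have := hmin (j := q₀ - 1) ⟨hc, by simp only [Set.mem_ofPred_eq] at hq₀' ⊢; linarith⟩ (by simp)
    simp only [id] at this
    linarith
  have h2 := hrec q₀ hq₀'
  rw [h1, mul_zero] at h2
  have h3 := (mul_eq_zero.mp h2).resolve_right hq₀
  have h4 : q₀ = 0 := by exact_mod_cast (mul_eq_zero.mp h3).resolve_left ha
  exact absurd hq₀' (by simp [h4])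

/-- Transport by the stream function with coefficients `a` on `T`. -/
noncomputable def transport (e : E3) (T : Finset E3) (a f : E3 → ℂ) (n : E3) : ℂ :=
  ∑ m ∈ T, a m * (brk e m n : ℂ) * f (n - m)

/-- Convolution powers of the coefficient function `a` on `T`. -/
noncomputable def convPow (T : Finset E3) (a : E3 → ℂ) : ℕ → E3 → ℂ
  | 0 => fun n => by classical exact if n = 0 then 1 else 0
  | k + 1 => fun n => ∑ m ∈ T, a m * convPow T a k (n - m)

lemma convPow_zero (T : Finset E3) (a : E3 → ℂ) (n : E3) [Decidable (n = 0)] :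
    convPow T a 0 n = if n = 0 then 1 else 0 := by
  simp only [convPow]
  congr

lemma convPow_succ (T : Finset E3) (a : E3 → ℂ) (k : ℕ) (n : E3) :
    convPow T a (k + 1) n = ∑ m ∈ T, a m * convPow T a k (n - m) := rfl

/-- Transport is a derivation for convolution and annihilates the stream function by antisymmetry,
so it annihilates all powers. -/
lemma transport_convPow (e : E3) (T : Finset E3) (a : E3 → ℂ) (k : ℕ) :
    ∀ n, transport e T a (convPow T a k) n = 0 := by
  classical
  induction k with
  | zero =>
    intro n
    refine Finset.sum_eq_zero fun m _ => ?_
    rw [convPow_zero]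
    split_ifs with h
    · rw [sub_eq_zero.mp h]; simp
    · simp
  | succ k ih =>
    intro n
    unfold transport
    have h1 : ∀ m ∈ T, a m * (brk e m n : ℂ) * convPow T a (k + 1) (n - m) =
        ∑ l ∈ T, (a l * (a m * (brk e m (n - l) : ℂ) * convPow T a k (n - l - m)) +
          a m * a l * (brk e m l : ℂ) * convPow T a k (n - m - l)) := by
      intro m _
      rw [convPow_succ, Finset.mul_sum]
      refine Finset.sum_congr rfl fun l _ => ?_
      rw [brk_sub_right, sub_right_comm n l m]
      push_cast; ring
    rw [Finset.sum_congr rfl h1]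
    simp only [Finset.sum_add_distrib]
    have h2 : ∑ m ∈ T, ∑ l ∈ T, a l * (a m * (brk e m (n - l) : ℂ) * convPow T a k (n - l - m)) =
        0 := by
      rw [Finset.sum_comm]
      refine Finset.sum_eq_zero fun l _ => ?_
      rw [← Finset.mul_sum]
      have := ih (n - l)
      unfold transport at this
      rw [this, mul_zero]
    have h3 : ∑ m ∈ T, ∑ l ∈ T, a m * a l * (brk e m l : ℂ) * convPow T a k (n - m - l) =
        - ∑ m ∈ T, ∑ l ∈ T, a m * a l * (brk e m l : ℂ) * convPow T a k (n - m - l) := by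
      conv_lhs => rw [Finset.sum_comm]
      rw [← Finset.sum_neg_distrib]
      refine Finset.sum_congr rfl fun m _ => ?_
      rw [← Finset.sum_neg_distrib]
      refine Finset.sum_congr rfl fun l _ => ?_
      rw [brk_swap, sub_right_comm n m l]
      push_cast; ring
    rw [h2, zero_add]
    linear_combination h3 / 2

lemma convPow_finite (T : Finset E3) (a : E3 → ℂ) {e : E3} (hT : ∀ n ∈ T, inner ℝ e n = (0 : ℝ))
    (k : ℕ) : ∃ F : Finset E3, (∀ n ∈ F, inner ℝ e n = (0 : ℝ)) ∧ ∀ n ∉ F, convPow T a k n = 0 := by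
  classical
  induction k with
  | zero =>
    refine ⟨{0}, by simp, fun n hn => ?_⟩
    rw [convPow_zero, if_neg (by simpa using hn)]
  | succ k ih =>
    obtain ⟨F, hF, hF'⟩ := ih
    refine ⟨(T ×ˢ F).image (fun x => x.1 + x.2), ?_, ?_⟩
    · intro n hn
      obtain ⟨⟨m, l⟩, hml, rfl⟩ := Finset.mem_image.mp hn
      obtain ⟨hm, hl⟩ := Finset.mem_product.mp hml
      rw [inner_add_right, hT m hm, hF l hl, add_zero]
    · intro n hn
      rw [convPow_succ]
      refine Finset.sum_eq_zero fun m hm => ?_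
      rw [hF', mul_zero]
      intro hl
      exact hn (Finset.mem_image.mpr ⟨(m, n - m), Finset.mem_product.mpr ⟨hm, hl⟩,
        add_sub_cancel _ _⟩)

/-- The point of level `h` and position `q` in the coordinates given by `A`, `B`. -/
noncomputable def levelPt (A B : E3) (h q : ℝ) : E3 := (h - q) • A + q • B

section Level

variable {e A B Θ : E3} {T : Finset E3} {a : E3 → ℂ}

/-- Only `A` and `B` reach level 1 of `Θ`, so one level above the top of `f` the convolution sees
only the shifts by `A` and `B`. For transport this yields the binomial recursion of `rec_support`.
-/
lemma sum_top {f : E3 → ℂ} {h : ℝ} (hA : A ∈ T) (hB : B ∈ T) (hAB : A ≠ B)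
    (hΘA : inner ℝ Θ A = (1 : ℝ)) (hΘB : inner ℝ Θ B = (1 : ℝ))
    (hΘ : ∀ n ∈ T, n ≠ A → n ≠ B → inner ℝ Θ n < (1 : ℝ))
    (hf : ∀ n, h < inner ℝ Θ n → f n = 0) (w : E3 → ℂ) (q : ℝ) :
    ∑ m ∈ T, w m * f (levelPt A B (h + 1) q - m) =
      w A * f (levelPt A B h q) + w B * f (levelPt A B h (q - 1)) := by
  classical
  have hlev : inner ℝ Θ (levelPt A B (h + 1) q) = h + 1 := by
    rw [levelPt, inner_add_right, inner_smul_right, inner_smul_right, hΘA, hΘB]; ring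
  rw [← Finset.sum_subset (s₁ := {A, B}), Finset.sum_pair hAB]
  · congr 3
    · simp only [levelPt]; module
    · simp only [levelPt]; module
  · intro n hn
    rcases Finset.mem_insert.mp hn with rfl | hn
    · exact hA
    · rw [Finset.mem_singleton.mp hn]; exact hB
  · intro m hm hm'
    have h1 : m ≠ A := fun h => hm' (by simp [h])
    have h2 : m ≠ B := fun h => hm' (by simp [h])
    rw [hf, mul_zero]
    rw [inner_sub_right, hlev]
    linarith [hΘ m hm h1 h2]

lemma transport_top {f : E3 → ℂ} {h : ℝ} (hA : A ∈ T) (hB : B ∈ T) (hAB : A ≠ B)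
    (hΘA : inner ℝ Θ A = (1 : ℝ)) (hΘB : inner ℝ Θ B = (1 : ℝ))
    (hΘ : ∀ n ∈ T, n ≠ A → n ≠ B → inner ℝ Θ n < (1 : ℝ))
    (hf : ∀ n, h < inner ℝ Θ n → f n = 0) (q : ℝ) :
    transport e T a f (levelPt A B (h + 1) q) = (brk e A B : ℂ) *
      (a A * q * f (levelPt A B h q) -
        a B * ((h + 1 - q : ℝ) : ℂ) * f (levelPt A B h (q - 1))) := by
  unfold transport
  rw [sum_top hA hB hAB hΘA hΘB hΘ hf (fun m => a m * (brk e m (levelPt A B (h + 1) q) : ℂ))]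
  simp only [levelPt, brk_add_right, brk_smul_right, brk_self, brk_swap e A B]
  push_cast; ring

lemma levelPt_surj {n : E3} (he : ‖e‖ = 1) (heA : inner ℝ e A = (0 : ℝ))
    (heB : inner ℝ e B = (0 : ℝ)) (hΘA : inner ℝ Θ A = (1 : ℝ)) (hΘB : inner ℝ Θ B = (1 : ℝ))
    (hAB : A ≠ B) (hn : inner ℝ e n = (0 : ℝ)) : ∃ q, n = levelPt A B (inner ℝ Θ n) q := by
  have hbrk := brk_ne_zero he heA heB hΘA hΘB hAB
  have hA0 : A ≠ 0 := by rintro rfl; simp at hΘA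
  refine ⟨brk e A n / brk e A B, ?_⟩
  obtain ⟨q, hq⟩ : ∃ q, q = brk e A n / brk e A B := ⟨_, rfl⟩
  rw [← hq]
  have h1 : brk e A (n - levelPt A B (inner ℝ Θ n) q) = 0 := by
    rw [brk_sub_right, levelPt, brk_add_right, brk_smul_right, brk_smul_right, brk_self, hq]
    field_simp; ring
  have h2 := eq_smul_of_brk_eq_zero he heA (m := n - levelPt A B (inner ℝ Θ n) q)
    (by rw [inner_sub_right, levelPt, inner_add_right, inner_smul_right, inner_smul_right, heA, heB,
      hn]; ring) hA0 h1
  have h3 := congrArg (fun v => inner ℝ Θ v) h2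
  simp only [inner_smul_right, hΘA, mul_one] at h3
  rw [← h3] at h2
  have h4 : inner ℝ Θ (n - levelPt A B (inner ℝ Θ n) q) = (0 : ℝ) := by
    rw [inner_sub_right, levelPt, inner_add_right, inner_smul_right, inner_smul_right, hΘA, hΘB]
    ring
  rw [h4, zero_smul, sub_eq_zero] at h2
  exact h2

lemma levelPt_finite {f : E3 → ℂ} {F : Finset E3} (hF : ∀ n ∉ F, f n = 0) (hAB : A ≠ B) (h : ℝ) :
    {q | f (levelPt A B h q) ≠ 0}.Finite := by
  have hinj : Function.Injective (levelPt A B h) := by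
    intro q q' hq
    have h1 : (q - q') • (B - A) = 0 := by
      simp only [levelPt] at hq
      have : (h - q) • A + q • B - ((h - q') • A + q' • B) = 0 := sub_eq_zero.mpr hq
      rw [← this]; module
    rcases smul_eq_zero.mp h1 with h2 | h2
    · exact sub_eq_zero.mp h2
    · exact absurd (sub_eq_zero.mp h2).symm hAB
  refine (F.finite_toSet.preimage hinj.injOn).subset fun q hq => ?_
  by_contra h1
  exact hq (hF _ h1)

/-- A finitely supported function in the kernel of the top-level transport. -/
lemma top_level {f : E3 → ℂ} {h : ℝ} {F : Finset E3} (he : ‖e‖ = 1)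
    (heF : ∀ n ∈ F, inner ℝ e n = (0 : ℝ))
    (hF : ∀ n ∉ F, f n = 0) (heA : inner ℝ e A = (0 : ℝ)) (heB : inner ℝ e B = (0 : ℝ))
    (hA : A ∈ T) (hB : B ∈ T) (haA : a A ≠ 0) (haB : a B ≠ 0) (hAB : A ≠ B)
    (hΘA : inner ℝ Θ A = (1 : ℝ)) (hΘB : inner ℝ Θ B = (1 : ℝ))
    (hΘ : ∀ n ∈ T, n ≠ A → n ≠ B → inner ℝ Θ n < (1 : ℝ))
    (hf : ∀ n, h < inner ℝ Θ n → f n = 0)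
    (hLf : ∀ n, inner ℝ Θ n = h + 1 → transport e T a f n = 0)
    (hne : ∃ n, inner ℝ Θ n = h ∧ f n ≠ 0) :
    f (levelPt A B h 0) ≠ 0 ∧ (∃ k : ℕ, h = k) ∧ ∀ q, f (levelPt A B h q) ≠ 0 → 0 ≤ q := by
  have hbrk : (brk e A B : ℂ) ≠ 0 :=
    Complex.ofReal_ne_zero.mpr (brk_ne_zero he heA heB hΘA hΘB hAB)
  refine rec_support haA haB (levelPt_finite hF hAB h) (fun q => ?_) ?_
  · have h1 := transport_top (e := e) (a := a) hA hB hAB hΘA hΘB hΘ hf q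
    rw [hLf _ (by rw [levelPt, inner_add_right, inner_smul_right, inner_smul_right, hΘA, hΘB]; ring)]
      at h1
    exact sub_eq_zero.mp ((mul_eq_zero.mp h1.symm).resolve_left hbrk)
  · obtain ⟨n, hn, hfn⟩ := hne
    have hnF : n ∈ F := by
      by_contra h1
      exact hfn (hF n h1)
    obtain ⟨q, hq⟩ := levelPt_surj he heA heB hΘA hΘB hAB (heF n hnF)
    rw [hn] at hq
    exact ⟨q, by rw [← hq]; exact hfn⟩

lemma convPow_top (hA : A ∈ T) (hB : B ∈ T) (hAB : A ≠ B)
    (hΘA : inner ℝ Θ A = (1 : ℝ)) (hΘB : inner ℝ Θ B = (1 : ℝ))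
    (hΘ : ∀ n ∈ T, n ≠ A → n ≠ B → inner ℝ Θ n < (1 : ℝ)) (k : ℕ) :
    (∀ n, (k : ℝ) < inner ℝ Θ n → convPow T a k n = 0) ∧
      convPow T a k (levelPt A B k 0) = a A ^ k ∧
      ∀ q < 0, convPow T a k (levelPt A B k q) = 0 := by
  classical
  induction k with
  | zero =>
    refine ⟨fun n hn => ?_, ?_, fun q hq => ?_⟩
    · rw [convPow_zero, if_neg]
      rintro rfl
      simp at hn
    · rw [convPow_zero, if_pos (by simp [levelPt]), pow_zero]
    · rw [convPow_zero, if_neg]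
      intro h
      have h1 : q • (B - A) = 0 := by
        rw [← h]; simp only [levelPt, Nat.cast_zero]; module
      rcases smul_eq_zero.mp h1 with h2 | h2
      · linarith
      · exact hAB (sub_eq_zero.mp h2).symm
  | succ k ih =>
    obtain ⟨h1, h2, h3⟩ := ih
    have hle : ∀ n ∈ T, inner ℝ Θ n ≤ (1 : ℝ) := fun n hn => by
      by_cases hA' : n = A
      · rw [hA', hΘA]
      by_cases hB' : n = B
      · rw [hB', hΘB]
      exact (hΘ n hn hA' hB').le
    refine ⟨fun n hn => ?_, ?_, fun q hq => ?_⟩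
    · rw [convPow_succ]
      refine Finset.sum_eq_zero fun m hm => ?_
      rw [h1, mul_zero]
      rw [inner_sub_right]
      push_cast at hn
      linarith [hle m hm]
    · rw [convPow_succ]
      push_cast
      rw [sum_top hA hB hAB hΘA hΘB hΘ h1 a, h2, h3 _ (by norm_num)]
      ring
    · rw [convPow_succ]
      push_cast
      rw [sum_top hA hB hAB hΘA hΘB hΘ h1 a, h3 _ hq, h3 _ (by linarith)]
      ring

/-- Functions whose iterated transports stay in a fixed finite set are polynomials in `a` for the
convolution. -/
lemma exists_convPoly_aux (he : ‖e‖ = 1) (heT : ∀ n ∈ T, inner ℝ e n = (0 : ℝ))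
    (hA : A ∈ T) (hB : B ∈ T) (haA : a A ≠ 0) (haB : a B ≠ 0) (hAB : A ≠ B)
    (hΘA : inner ℝ Θ A = (1 : ℝ)) (hΘB : inner ℝ Θ B = (1 : ℝ))
    (hΘ : ∀ n ∈ T, n ≠ A → n ≠ B → inner ℝ Θ n < (1 : ℝ)) (N : ℕ) :
    ∀ (f : E3 → ℂ) (F : Finset E3), (∀ n ∈ F, inner ℝ e n = (0 : ℝ)) →
      (∀ k, ∀ n ∉ F, (transport e T a)^[k] f n = 0) →
      (∀ k n, (N : ℝ) ≤ inner ℝ Θ n → (transport e T a)^[k] f n = 0) →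
      ∃ c : ℕ → ℂ, ∀ n, f n = ∑ k ∈ Finset.range N, c k * convPow T a k n := by
  classical
  have heA := heT A hA
  have heB := heT B hB
  have htop := fun (f : E3 → ℂ) (h : ℝ) (F : Finset E3) h1 h2 h3 h4 h5 =>
    top_level (a := a) (f := f) (h := h) (F := F) he h1 h2 heA heB hA hB haA haB hAB hΘA hΘB hΘ
      h3 h4 h5
  -- The highest level occurring among all iterates is a natural number: one level above it the next
  -- iterate vanishes, so `top_level` applies to the iterate attaining it. Levels can thus be
  -- lowered by whole steps.
  have hnat : ∀ (f : E3 → ℂ) (F : Finset E3), (∀ n ∈ F, inner ℝ e n = (0 : ℝ)) →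
      (∀ k, ∀ n ∉ F, (transport e T a)^[k] f n = 0) → ∀ s M : ℝ, (∀ j : ℕ, (j : ℝ) < M → (j : ℝ) ≤ s) →
      (∀ k n, M ≤ inner ℝ Θ n → (transport e T a)^[k] f n = 0) →
      (∀ k n, s < inner ℝ Θ n → (transport e T a)^[k] f n = 0) := by
    intro f F h1 h2 s M hs h3
    by_contra! hcon
    obtain ⟨k₀, n₀, hn₀, hf₀⟩ := hcon
    set F' := F.filter (fun n => ∃ k, (transport e T a)^[k] f n ≠ 0) with hF'
    have memF' : ∀ k n, (transport e T a)^[k] f n ≠ 0 → n ∈ F' := fun k n h => by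
      refine Finset.mem_filter.mpr ⟨?_, k, h⟩
      by_contra h4
      exact h (h2 k n h4)
    obtain ⟨n₁, hn₁, hmax⟩ := F'.exists_max_image (fun n => (inner ℝ Θ n : ℝ)) ⟨n₀, memF' _ _ hf₀⟩
    obtain ⟨-, k₁, hk₁⟩ := Finset.mem_filter.mp hn₁
    have hmax' : ∀ k n, inner ℝ Θ n₁ < (inner ℝ Θ n : ℝ) → (transport e T a)^[k] f n = 0 := by
      intro k n hn
      by_contra h4
      linarith [hmax n (memF' k n h4)]
    obtain ⟨-, ⟨j, hj⟩, -⟩ := htop ((transport e T a)^[k₁] f) (inner ℝ Θ n₁) F h1 (h2 k₁)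
      (hmax' k₁) (fun n hn => by
        rw [← Function.iterate_succ_apply' (transport e T a)]
        exact hmax' _ _ (by linarith)) ⟨n₁, rfl, hk₁⟩
    have h5 : inner ℝ Θ n₁ < M := by
      by_contra! h6
      exact hk₁ (h3 k₁ n₁ h6)
    have h6 := hs j (by linarith)
    linarith [hmax n₀ (memF' _ _ hf₀)]
  induction N with
  | zero =>
    intro f F h1 h2 h3
    refine ⟨0, fun n => ?_⟩
    simp only [Finset.range_zero, Finset.sum_empty]
    by_contra hfn
    refine hfn (hnat f F h1 h2 (inner ℝ Θ n - 1) 0 (fun j hj => ?_) (by simpa using h3) 0 n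
      (by linarith))
    exact absurd hj (not_lt.mpr (Nat.cast_nonneg j))
  | succ N ih =>
    intro f F h1 h2 h3
    have hle := hnat f F h1 h2 N (N + 1) (fun j hj => by
      have : j < N + 1 := by exact_mod_cast hj
      exact_mod_cast Nat.lt_succ_iff.mp this) (by push_cast at h3; exact h3)
    obtain ⟨hc1, hc2, -⟩ := convPow_top (a := a) hA hB hAB hΘA hΘB hΘ N
    obtain ⟨G, hG1, hG2⟩ := convPow_finite T a heT N
    -- Subtracting this multiple of the `N`th power cancels the value at position 0. An element of
    -- the top-level kernel is nonzero there unless its whole top level vanishes, so level `N` of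
    -- `g` disappears. Transport of `g` and of `f` agree.
    set C := f (levelPt A B N 0) / a A ^ N with hC
    set g : E3 → ℂ := fun n => f n - C * convPow T a N n with hg
    have hLg : transport e T a g = transport e T a f := by
      funext n
      have h4 : transport e T a g n = transport e T a f n -
          C * transport e T a (convPow T a N) n := by
        unfold transport
        rw [Finset.mul_sum, ← Finset.sum_sub_distrib]
        exact Finset.sum_congr rfl fun m _ => by simp only [hg]; ring
      rw [h4, transport_convPow, mul_zero, sub_zero]
    have hLgk : ∀ k, (transport e T a)^[k + 1] g = (transport e T a)^[k + 1] f := fun k => by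
      rw [Function.iterate_succ_apply, Function.iterate_succ_apply, hLg]
    have hgF : ∀ k, ∀ n ∉ F ∪ G, (transport e T a)^[k] g n = 0 := by
      intro k n hn
      rw [Finset.mem_union, not_or] at hn
      cases k with
      | zero =>
        show f n - C * convPow T a N n = 0
        rw [show f n = 0 from h2 0 n hn.1, hG2 n hn.2]; ring
      | succ k => rw [hLgk]; exact h2 _ n hn.1
    have hFG : ∀ n ∈ F ∪ G, inner ℝ e n = (0 : ℝ) := fun n hn => by
      rcases Finset.mem_union.mp hn with h | h
      · exact h1 n h
      · exact hG1 n h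
    have hgle : ∀ k n, (N : ℝ) < inner ℝ Θ n → (transport e T a)^[k] g n = 0 := by
      intro k n hn
      cases k with
      | zero =>
        show f n - C * convPow T a N n = 0
        rw [show f n = 0 from hle 0 n hn, hc1 n hn]; ring
      | succ k => rw [hLgk]; exact hle _ n hn
    have hg0 : g (levelPt A B N 0) = 0 := by
      simp only [hg]
      rw [hc2, hC, div_mul_cancel₀ _ (pow_ne_zero N haA), sub_self]
    have hstep : ∀ k n, (N : ℝ) ≤ inner ℝ Θ n → (transport e T a)^[k] g n = 0 := by
      intro k
      induction k with
      | zero =>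
        intro n hn
        rcases eq_or_lt_of_le hn with h4 | h4
        · by_contra h5
          exact (htop g N (F ∪ G) hFG (hgF 0) (hgle 0) (fun n hn => hgle 1 n (by linarith))
            ⟨n, h4.symm, h5⟩).1 hg0
        · exact hgle 0 n h4
      | succ k ihk =>
        intro n hn
        set z := (transport e T a)^[k] g with hz
        have hz1 : (transport e T a)^[k + 1] g = transport e T a z :=
          Function.iterate_succ_apply' _ _ _
        have hz2 : (transport e T a)^[k + 2] g = transport e T a (transport e T a z) := by
          rw [Function.iterate_succ_apply' (transport e T a) (k + 1), hz1]
        rcases eq_or_lt_of_le hn with h4 | h4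
        swap
        · exact hgle _ n h4
        -- A top level strictly between `N - 1` and `N` would be a natural number by `top_level`,
        -- since the transport of `z` vanishes above level `N`.
        have hzle : ∀ n, (N : ℝ) - 1 < inner ℝ Θ n → z n = 0 := by
          by_contra! hcon
          obtain ⟨n₀, hn₀, hzn₀⟩ := hcon
          set F' := (F ∪ G).filter (fun n => z n ≠ 0) with hF'
          have memF' : ∀ n, z n ≠ 0 → n ∈ F' := fun n h => by
            refine Finset.mem_filter.mpr ⟨?_, h⟩
            by_contra h4
            exact h (hgF k n h4)
          obtain ⟨n₁, hn₁, hmax⟩ := F'.exists_max_image (fun n => (inner ℝ Θ n : ℝ))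
            ⟨n₀, memF' _ hzn₀⟩
          obtain ⟨-, hk₁⟩ := Finset.mem_filter.mp hn₁
          have h5 := hmax n₀ (memF' _ hzn₀)
          obtain ⟨-, ⟨j, hj⟩, -⟩ := htop z (inner ℝ Θ n₁) (F ∪ G) hFG (hgF k)
            (fun n hn => by
              by_contra h4
              linarith [hmax n (memF' n h4)]) (fun n hn => by
                rw [← hz1]
                exact hgle _ _ (by linarith)) ⟨n₁, rfl, hk₁⟩
          have h6 : inner ℝ Θ n₁ < (N : ℝ) := by
            by_contra! h6
            exact hk₁ (ihk n₁ h6)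
          have h7 : (j : ℝ) < N := by linarith
          have h8 : (N : ℝ) < j + 1 := by linarith
          have h9 : j < N := by exact_mod_cast h7
          have h10 : N < j + 1 := by exact_mod_cast h8
          omega
        by_contra hnz
        -- No Jordan chain exists at the top level. An element of the kernel vanishes at negative
        -- positions and is nonzero at position 0. An element of the image that vanishes at negative
        -- positions comes from a `z` vanishing there too, so it also vanishes at position 0.
        rw [hz1] at hnz
        obtain ⟨hne0, -, hpos⟩ := htop (transport e T a z) N (F ∪ G) hFG
          (fun n hn => by rw [← hz1]; exact hgF _ n hn)
          (fun n hn => by rw [← hz1]; exact hgle _ n hn)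
          (fun n hn => by rw [← hz2]; exact hgle _ n (by linarith)) ⟨n, h4.symm, hnz⟩
        have hbrk : (brk e A B : ℂ) ≠ 0 :=
          Complex.ofReal_ne_zero.mpr (brk_ne_zero he heA heB hΘA hΘB hAB)
        have htr := transport_top (e := e) (a := a) hA hB hAB hΘA hΘB hΘ hzle
        rw [sub_add_cancel] at htr
        have hneg := rec_support_neg (φ := fun q => z (levelPt A B (N - 1) q)) (h := N - 1)
          (b := a B) haA (levelPt_finite (hgF k) hAB _) (fun q hq => by
            have h5 : transport e T a z (levelPt A B N q) = 0 := by
              by_contra h6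
              linarith [hpos q h6]
            rw [htr] at h5
            have := sub_eq_zero.mp ((mul_eq_zero.mp h5).resolve_left hbrk)
            rw [sub_add_cancel]
            exact this)
        apply hne0
        rw [htr, hneg (0 - 1) (by norm_num)]
        simp
    obtain ⟨c, hc⟩ := ih g (F ∪ G) hFG hgF hstep
    refine ⟨fun k => if k = N then C else c k, fun n => ?_⟩
    rw [Finset.sum_range_succ]
    simp only [if_true]
    have h4 : ∑ k ∈ Finset.range N, (if k = N then C else c k) * convPow T a k n = g n := by
      rw [hc n]
      refine Finset.sum_congr rfl fun k hk => ?_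
      rw [if_neg (Finset.mem_range.mp hk).ne]
    rw [h4]
    simp only [hg]; ring

lemma exists_convPoly (he : ‖e‖ = 1) (heT : ∀ n ∈ T, inner ℝ e n = (0 : ℝ))
    (hA : A ∈ T) (hB : B ∈ T) (haA : a A ≠ 0) (haB : a B ≠ 0) (hAB : A ≠ B)
    (hΘA : inner ℝ Θ A = (1 : ℝ)) (hΘB : inner ℝ Θ B = (1 : ℝ))
    (hΘ : ∀ n ∈ T, n ≠ A → n ≠ B → inner ℝ Θ n < (1 : ℝ)) {f : E3 → ℂ} {F : Finset E3}
    (hF : ∀ n ∈ F, inner ℝ e n = (0 : ℝ)) (hf : ∀ k, ∀ n ∉ F, (transport e T a)^[k] f n = 0) :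
    ∃ (N : ℕ) (c : ℕ → ℂ), ∀ n, f n = ∑ k ∈ Finset.range N, c k * convPow T a k n := by
  obtain ⟨M, hM⟩ : ∃ M : ℝ, ∀ n ∈ F, inner ℝ Θ n ≤ M := by
    obtain ⟨M, hM⟩ := (F.image fun n => (inner ℝ Θ n : ℝ)).bddAbove
    exact ⟨M, fun n hn => hM (Finset.mem_coe.mpr (Finset.mem_image_of_mem _ hn))⟩
  obtain ⟨N, hN⟩ := exists_nat_gt M
  refine ⟨N, exists_convPoly_aux he heT hA hB haA haB hAB hΘA hΘB hΘ N f F hF hf fun k n hn => ?_⟩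
  apply hf
  intro h
  linarith [hM n h]

end Level

/-! ### Fields whose interaction is a gradient everywhere -/

lemma interactionSum_eq_zero {S : Finset E3} {b : E3 → C3} {N : E3}
    (h : ∀ m ∈ S, ∀ n ∈ S, m + n = N → cdot (b m) n = 0 ∧ cdot (b n) m = 0) :
    interactionSum S b N = 0 := by
  classical
  unfold interactionSum
  refine Finset.sum_eq_zero fun m hm => Finset.sum_eq_zero fun n hn => ?_
  split_ifs with hmn
  · rw [(h m hm n hn hmn).1, (h m hm n hn hmn).2, zero_smul, zero_smul, add_zero]
  · rfl

lemma helmholtzProj_zero (n : E3) : helmholtzProj n 0 = 0 := by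
  simp [helmholtzProj]

lemma interactionSum_of_not_perp {e : E3} {S : Finset E3} {b : E3 → C3} {N : E3}
    (hS : ∀ n ∈ S, inner ℝ e n = (0 : ℝ)) (hN : inner ℝ e N ≠ (0 : ℝ)) :
    interactionSum S b N = 0 :=
  interactionSum_eq_zero fun m hm n hn hmn => absurd (by
    rw [← hmn, inner_add_right, hS m hm, hS n hn, add_zero]) hN

lemma Lop_of_not_perp {e : E3} {S : Finset E3} {a f : E3 → ℂ} {N : E3}
    (hS : ∀ n ∈ S, inner ℝ e n = (0 : ℝ)) (hN : inner ℝ e N ≠ (0 : ℝ)) : Lop e S a f N = 0 :=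
  pairSum_eq_zero fun m hm n hn hmn => absurd (by
    rw [← hmn, inner_add_right, hS m hm, hS n hn, add_zero]) hN

lemma Lop_eq_transport {e : E3} {S : Finset E3} {a f : E3 → ℂ} (hf : ∀ n ∉ S, f n = 0) (N : E3) :
    Lop e S a f N = transport e (planarSupport S a) a f N := by
  classical
  have hsub : planarSupport S a ⊆ S := fun n hn => (mem_planarSupport.mp hn).1
  unfold Lop pairSum transport
  rw [← Finset.sum_subset hsub]
  · refine Finset.sum_congr rfl fun m _ => ?_
    by_cases h : N - m ∈ S
    · rw [Finset.sum_eq_single_of_mem _ h]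
      · rw [if_pos (add_sub_cancel m N)]
        simp only [brk_sub_right, brk_self, sub_zero]
      · intro n _ hn
        rw [if_neg]
        rintro rfl
        exact hn (by rw [add_sub_cancel_left])
    · rw [hf _ h, mul_zero]
      refine Finset.sum_eq_zero fun n hn => ?_
      rw [if_neg]
      rintro rfl
      exact h (by rw [add_sub_cancel_left]; exact hn)
  · intro m hm hm'
    have : a m = 0 := by
      by_contra h
      exact hm' (mem_planarSupport.mpr ⟨hm, h⟩)
    refine Finset.sum_eq_zero fun n _ => ?_
    simp [this]

/-- The quadratic interaction is a gradient at every frequency. -/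
def FullyBalanced (S : Finset E3) (b : E3 → C3) : Prop :=
  ∀ N, N ≠ 0 → helmholtzProj N (interactionSum S b N) = 0

lemma fullyBalanced_of_cdot {S : Finset E3} {b : E3 → C3}
    (h : ∀ m ∈ S, ∀ n ∈ S, cdot (b m) n = 0) : FullyBalanced S b := fun N _ => by
  rw [interactionSum_eq_zero fun m hm n hn _ => ⟨h m hm n hn, h n hn m hm⟩, helmholtzProj_zero]

lemma fullyBalanced_of_helical {S : Finset E3} {b : E3 → C3} {κ : ℂ}
    (h : ∀ n ∈ S, crossC (toC n) (b n) = κ • b n) : FullyBalanced S b := by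
  intro N hN
  obtain ⟨c, hc⟩ := exists_smul_of_forall_perp hN (w := interactionSum S b N) (fun y hy => by
    rw [cdot_interactionSum_curl (w := fun _ => 0) (fun n hn => by rw [h n hn, zero_add]) hy,
      pairSum_eq_zero, mul_zero]
    intro m _ n _ _
    simp [cdot_eq3])
  rw [hc, helmholtzProj_smul_toC hN]

lemma fullyBalanced_of_Lop {e : E3} {S : Finset E3} {b : E3 → C3} (he : ‖e‖ = 1)
    (hS : ∀ n ∈ S, inner ℝ e n = (0 : ℝ)) (h0 : (0 : E3) ∉ S) (hb : ∀ n ∈ S, cdot (b n) n = 0)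
    (h1 : ∀ N, Lop e S (alpha e b) (fun n => cdot (b n) e) N = 0)
    (h2 : ∀ N, Lop e S (alpha e b) (fun n => ((‖n‖ ^ 2 : ℝ) : ℂ) * alpha e b n) N = 0) :
    FullyBalanced S b := by
  intro N hN
  by_cases heN : inner ℝ e N = (0 : ℝ)
  · obtain ⟨h3, h4⟩ := interactionSum_planar he hS h0 hb N
    exact helmholtzProj_eq_zero_of_planar he heN hN (by rw [h3, h1, mul_zero])
      (by rw [h4, h2, mul_zero])
  · rw [interactionSum_of_not_perp hS heN, helmholtzProj_zero]

/-- On a circle the vorticity is a multiple of the stream function, so this reduces to `Lop_self`.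
-/
lemma Lop_norm_sq_of_circle {e : E3} {S : Finset E3} {a : E3 → ℂ} {r : ℝ}
    (h : ∀ n ∈ planarSupport S a, ‖n‖ = r) (N : E3) :
    Lop e S a (fun n => ((‖n‖ ^ 2 : ℝ) : ℂ) * a n) N = 0 := by
  have h1 : Lop e S a (fun n => ((‖n‖ ^ 2 : ℝ) : ℂ) * a n) N =
      ((r ^ 2 : ℝ) : ℂ) * Lop e S a a N := by
    unfold Lop
    rw [← pairSum_mul_left]
    refine pairSum_congr fun m _ n hn _ => ?_
    by_cases han : a n = 0
    · simp [han]
    · simp only [h n (mem_planarSupport.mpr ⟨hn, han⟩)]; ring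
  rw [h1, Lop_self, mul_zero]

lemma transport_of_convPoly {e : E3} {T : Finset E3} {a f : E3 → ℂ} {K : ℕ} {c : ℕ → ℂ}
    (h : ∀ n, f n = ∑ k ∈ Finset.range K, c k * convPow T a k n) (N : E3) :
    transport e T a f N = 0 := by
  have : transport e T a f N = ∑ k ∈ Finset.range K, c k * transport e T a (convPow T a k) N := by
    unfold transport
    simp only [Finset.mul_sum]
    rw [Finset.sum_comm]
    refine Finset.sum_congr rfl fun m _ => ?_
    rw [h, Finset.mul_sum]
    exact Finset.sum_congr rfl fun k _ => by ring
  rw [this]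
  exact Finset.sum_eq_zero fun k _ => by rw [transport_convPow, mul_zero]

/-! ### Flows with a constant vanishing pattern -/

/-- The bilinear pairing with a fixed real vector as a continuous linear map. -/
noncomputable def cdotL (y : E3) : C3 →L[ℝ] ℂ :=
  (∑ i, (y i : ℂ) • (EuclideanSpace.proj i : C3 →L[ℂ] ℂ)).restrictScalars ℝ

lemma cdotL_apply (y : E3) (w : C3) : cdotL y w = cdot w y := by
  simp [cdotL, cdot, mul_comm]

lemma HasDerivAt.cdot {f : ℝ → C3} {f' : C3} {t : ℝ} (h : HasDerivAt f f' t) (y : E3) :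
    HasDerivAt (fun s => _root_.cdot (f s) y) (_root_.cdot f' y) t := by
  have := (cdotL y).hasFDerivAt.comp_hasDerivAt t h
  simpa only [cdotL_apply, Function.comp_def] using this

/-- A solution of the projected Euler system on `J` with constant vanishing pattern. -/
structure IsPatternFlow (J : Set ℝ) (S : Finset E3) (a : ℝ → E3 → C3) : Prop where
  isOpen : IsOpen J
  preconn : IsPreconnected J
  zero_notMem : (0 : E3) ∉ S
  symm : ∀ n ∈ S, -n ∈ S
  ne_zero : ∀ t ∈ J, ∀ n ∈ S, a t n ≠ 0
  eq_zero : ∀ t ∈ J, ∀ n ∉ S, a t n = 0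
  conj : ∀ t ∈ J, ∀ n ∈ S, ∀ i, a t (-n) i = starRingEnd ℂ (a t n i)
  div_free : ∀ t ∈ J, ∀ n ∈ S, cdot (a t n) n = 0
  pattern : ∀ n ∈ S, ∀ m ∈ S, (∀ t ∈ J, cdot (a t n) m = 0) ∨ ∀ t ∈ J, cdot (a t n) m ≠ 0
  deriv : ∀ t ∈ J, ∀ n, n ≠ 0 → HasDerivAt (fun s => a s n)
    (-((Complex.I / 2) • helmholtzProj n (interactionSum S (a t) n))) t

/-- A function vanishing on an open set has zero derivative there. -/
lemma hasDerivAt_eq_zero_of_eqOn {E : Type*} [NormedAddCommGroup E] [NormedSpace ℝ E]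
    {J : Set ℝ} (hJ : IsOpen J) {f : ℝ → E} {f' : E} {t : ℝ} (ht : t ∈ J)
    (h : ∀ s ∈ J, f s = 0) (hf : HasDerivAt f f' t) : f' = 0 := by
  have h1 : f =ᶠ[nhds t] fun _ => 0 := by
    filter_upwards [hJ.mem_nhds ht] with s hs using h s hs
  exact hf.unique ((hasDerivAt_const t (0 : E)).congr_of_eventuallyEq h1)

/-- A function with zero derivative on a preconnected open set is constant. -/
lemma eq_of_hasDerivAt_zero {E : Type*} [NormedAddCommGroup E] [NormedSpace ℝ E]
    {J : Set ℝ} (hJ : IsOpen J) (hJ' : IsPreconnected J) {f : ℝ → E}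
    (hf : ∀ t ∈ J, HasDerivAt f 0 t) {s t : ℝ} (hs : s ∈ J) (ht : t ∈ J) : f s = f t :=
  hJ.is_const_of_deriv_eq_zero hJ' (fun x hx => (hf x hx).differentiableAt.differentiableWithinAt)
    (fun x hx => (hf x hx).deriv) hs ht

namespace IsPatternFlow

variable {J : Set ℝ} {S : Finset E3} {a : ℝ → E3 → C3}

lemma outerBalanced (H : IsPatternFlow J S a) {t : ℝ} (ht : t ∈ J) : OuterBalanced S (a t) := by
  intro N hN hNS
  have h := hasDerivAt_eq_zero_of_eqOn H.isOpen ht (fun s hs => H.eq_zero s hs N hNS)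
    (H.deriv t ht N hN)
  rw [neg_eq_zero, smul_eq_zero] at h
  exact h.resolve_left (by simp)

variable {e : E3}

/-- This expresses the vanishing of the in-plane part through the pairings with frequencies of `S`,
whose vanishing pattern does not depend on time. -/
lemma alpha_eq_zero_iff (H : IsPatternFlow J S a) (he : ‖e‖ = 1)
    (hS : ∀ n ∈ S, inner ℝ e n = (0 : ℝ)) (hspan : ∀ m ∈ S, ∃ n ∈ S, brk e m n ≠ 0)
    {t : ℝ} (ht : t ∈ J) {n : E3} (hn : n ∈ S) :
    alpha e (a t) n = 0 ↔ ∀ m ∈ S, cdot (a t n) m = 0 := by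
  have hn0 : n ≠ 0 := fun h => H.zero_notMem (h ▸ hn)
  have key := fun m => cdot_eq_alpha (b := a t) he (hS n hn) hn0 (H.div_free t ht n hn) m
  constructor
  · intro h m hm
    rw [key, h, hS m hm]; simp
  · intro h
    obtain ⟨m, hm, hnm⟩ := hspan n hn
    have h1 := key m
    rw [h m hm, hS m hm, Complex.ofReal_zero, mul_zero, add_zero] at h1
    exact (mul_eq_zero.mp h1.symm).resolve_right (Complex.ofReal_ne_zero.mpr hnm)

lemma planarSupport_eq (H : IsPatternFlow J S a) (he : ‖e‖ = 1)
    (hS : ∀ n ∈ S, inner ℝ e n = (0 : ℝ)) (hspan : ∀ m ∈ S, ∃ n ∈ S, brk e m n ≠ 0)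
    {s t : ℝ} (hs : s ∈ J) (ht : t ∈ J) :
    planarSupport S (alpha e (a s)) = planarSupport S (alpha e (a t)) := by
  have key : ∀ s ∈ J, ∀ t ∈ J, ∀ n ∈ S, alpha e (a s) n = 0 → alpha e (a t) n = 0 := by
    intro s hs t ht n hn h
    rw [H.alpha_eq_zero_iff he hS hspan hs hn] at h
    rw [H.alpha_eq_zero_iff he hS hspan ht hn]
    intro m hm
    rcases H.pattern n hn m hm with h1 | h1
    · exact h1 t ht
    · exact absurd (h m hm) (h1 s hs)
  ext n
  rw [mem_planarSupport, mem_planarSupport]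
  exact ⟨fun h => ⟨h.1, fun h1 => h.2 (key t ht s hs n h.1 h1)⟩,
    fun h => ⟨h.1, fun h1 => h.2 (key s hs t ht n h.1 h1)⟩⟩

lemma Lop_outer (H : IsPatternFlow J S a) (he : ‖e‖ = 1)
    (hS : ∀ n ∈ S, inner ℝ e n = (0 : ℝ)) {t : ℝ} (ht : t ∈ J) {N : E3} (hN : N ≠ 0)
    (hNS : N ∉ S) : Lop e S (alpha e (a t)) (fun n => cdot (a t n) e) N = 0 ∧
      Lop e S (alpha e (a t)) (fun n => ((‖n‖ ^ 2 : ℝ) : ℂ) * alpha e (a t) n) N = 0 := by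
  by_cases heN : inner ℝ e N = (0 : ℝ)
  · obtain ⟨h1, h2⟩ := interactionSum_planar he hS H.zero_notMem (H.div_free t ht) N
    have h3 := H.outerBalanced ht N hN hNS
    have h4 := cdot_helmholtzProj hN (interactionSum S (a t) N) (y := e)
      (by rw [real_inner_comm]; exact heN)
    have h5 := cdot_helmholtzProj hN (interactionSum S (a t) N) (y := cross3 e N)
      (by rw [real_inner_comm]; exact inner_cross3_right e N)
    rw [h3, cdot_zero_left] at h4 h5
    rw [h1] at h4
    rw [h2] at h5
    exact ⟨(mul_eq_zero.mp h4.symm).resolve_left two_ne_zero,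
      (mul_eq_zero.mp h5.symm).resolve_left two_ne_zero⟩
  · exact ⟨Lop_of_not_perp hS heN, Lop_of_not_perp hS heN⟩

/-- For `N` in `S` without in-plane part, the pairings of `a t N` with `S` vanish throughout `J`,
and hence so do their derivatives. One frequency of `S` not parallel to `N` then detects the
in-plane component of the interaction. -/
lemma Lop_in_plane (H : IsPatternFlow J S a) (he : ‖e‖ = 1)
    (hS : ∀ n ∈ S, inner ℝ e n = (0 : ℝ)) (hspan : ∀ m ∈ S, ∃ n ∈ S, brk e m n ≠ 0)
    {t : ℝ} (ht : t ∈ J) {N : E3} (hN : N ≠ 0) (hNS : N ∉ planarSupport S (alpha e (a t))) :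
    Lop e S (alpha e (a t)) (fun n => ((‖n‖ ^ 2 : ℝ) : ℂ) * alpha e (a t) n) N = 0 := by
  by_cases hN' : N ∈ S
  swap
  · exact (H.Lop_outer he hS ht hN hN').2
  have hα : alpha e (a t) N = 0 := by
    by_contra h
    exact hNS (mem_planarSupport.mpr ⟨hN', h⟩)
  have h1 := (H.alpha_eq_zero_iff he hS hspan ht hN').mp hα
  obtain ⟨m, hm, hNm⟩ := hspan N hN'
  have h2 : cdot (helmholtzProj N (interactionSum S (a t) N)) m = 0 := by
    have h3 := hasDerivAt_eq_zero_of_eqOn H.isOpen ht (fun s hs => ?_)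
      ((H.deriv t ht N hN).cdot m)
    · rw [cdot_neg_left, cdot_smul_left, neg_eq_zero] at h3
      exact (mul_eq_zero.mp h3).resolve_left (by simp)
    · rcases H.pattern N hN' m hm with h4 | h4
      · exact h4 s hs
      · exact absurd (h1 m hm) (h4 t ht)
  have h3 := cdot_planar he (hS N hN') hN (cdot_helmholtzProj_self hN (interactionSum S (a t) N)) m
  rw [h2, hS m hm, Complex.ofReal_zero, mul_zero, add_zero] at h3
  have h4 := (div_eq_zero_iff.mp ((mul_eq_zero.mp h3.symm).resolve_right
    (Complex.ofReal_ne_zero.mpr hNm))).resolve_right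
    (Complex.ofReal_ne_zero.mpr (pow_ne_zero 2 (norm_ne_zero_iff.mpr hN)))
  rw [cdot_helmholtzProj hN _ (by rw [real_inner_comm]; exact inner_cross3_right e N),
    (interactionSum_planar he hS H.zero_notMem (H.div_free t ht) N).2] at h4
  exact (mul_eq_zero.mp h4).resolve_left two_ne_zero

lemma alpha_neg_ne_zero (H : IsPatternFlow J S a) (he : ‖e‖ = 1)
    (hS : ∀ n ∈ S, inner ℝ e n = (0 : ℝ)) (hspan : ∀ m ∈ S, ∃ n ∈ S, brk e m n ≠ 0)
    {t : ℝ} (ht : t ∈ J) {n : E3} (hn : n ∈ S) (h : alpha e (a t) n ≠ 0) :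
    alpha e (a t) (-n) ≠ 0 := by
  refine fun h' => h ?_
  rw [H.alpha_eq_zero_iff he hS hspan ht hn]
  intro m hm
  have h1 := (H.alpha_eq_zero_iff he hS hspan ht (H.symm n hn)).mp h' m hm
  have h2 := H.conj t ht n hn
  rw [cdot_eq3, h2, h2, h2] at h1
  rw [cdot_eq3]
  simpa using congrArg (starRingEnd ℂ) h1

lemma circle (H : IsPatternFlow J S a) (he : ‖e‖ = 1)
    (hS : ∀ n ∈ S, inner ℝ e n = (0 : ℝ)) (hspan : ∀ m ∈ S, ∃ n ∈ S, brk e m n ≠ 0)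
    {t : ℝ} (ht : t ∈ J) (hne : (planarSupport S (alpha e (a t))).Nonempty) :
    ∃ r : ℝ, 0 < r ∧ (∀ n ∈ planarSupport S (alpha e (a t)), ‖n‖ = r) ∧
      ∃ A ∈ planarSupport S (alpha e (a t)), ∃ B ∈ planarSupport S (alpha e (a t)), A ≠ B ∧
        ∃ Θ : E3, inner ℝ Θ A = (1 : ℝ) ∧ inner ℝ Θ B = (1 : ℝ) ∧
        ∀ n ∈ planarSupport S (alpha e (a t)), n ≠ A → n ≠ B → inner ℝ Θ n < (1 : ℝ) := by
  refine planarSupport_circle (β := fun n => cdot (a t n) e) he hS H.zero_notMem H.symm hspan ?_ ?_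
    (fun N hN hNS => (H.Lop_outer he hS ht hN hNS).1)
    (fun N hN hNS => H.Lop_in_plane he hS hspan ht hN hNS) hne
  · intro n hn
    by_contra! h
    have hn0 : n ≠ 0 := fun h => H.zero_notMem (h ▸ hn)
    apply H.ne_zero t ht n hn
    apply eq_zero_of_cdot_eq_zero (cross3_ne_zero_of_perp he (hS n hn) hn0) h.2
      (H.div_free t ht n hn)
    exact (div_eq_zero_iff.mp h.1).resolve_right
      (Complex.ofReal_ne_zero.mpr (pow_ne_zero 2 (norm_ne_zero_iff.mpr hn0)))
  · exact fun n hn h => H.alpha_neg_ne_zero he hS hspan ht hn h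

lemma hasDerivAt_beta (H : IsPatternFlow J S a) (he : ‖e‖ = 1)
    (hS : ∀ n ∈ S, inner ℝ e n = (0 : ℝ)) {t : ℝ} (ht : t ∈ J) {N : E3} (hN : N ≠ 0) :
    HasDerivAt (fun s => cdot (a s N) e)
      (-Complex.I * Lop e S (alpha e (a t)) (fun n => cdot (a t n) e) N) t := by
  have h := (H.deriv t ht N hN).cdot e
  convert h using 1
  by_cases heN : inner ℝ e N = (0 : ℝ)
  · rw [cdot_neg_left, cdot_smul_left, cdot_helmholtzProj hN _ (by rw [real_inner_comm]; exact heN),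
      (interactionSum_planar he hS H.zero_notMem (H.div_free t ht) N).1]
    ring
  · rw [Lop_of_not_perp hS heN, interactionSum_of_not_perp hS heN, helmholtzProj_zero]
    simp

/-- The in-plane frequencies lie on a circle at each time, so the planar flow does not transport its
own vorticity. -/
lemma alpha_const (H : IsPatternFlow J S a) (he : ‖e‖ = 1)
    (hS : ∀ n ∈ S, inner ℝ e n = (0 : ℝ)) (hspan : ∀ m ∈ S, ∃ n ∈ S, brk e m n ≠ 0)
    {s t : ℝ} (hs : s ∈ J) (ht : t ∈ J) (hne : (planarSupport S (alpha e (a t))).Nonempty) :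
    alpha e (a s) = alpha e (a t) := by
  funext n
  by_cases hn : n ∈ S
  swap
  · simp [alpha, H.eq_zero s hs n hn, H.eq_zero t ht n hn]
  have hn0 : n ≠ 0 := fun h => H.zero_notMem (h ▸ hn)
  unfold alpha
  congr 1
  refine eq_of_hasDerivAt_zero H.isOpen H.preconn (f := fun s => cdot (a s n) (cross3 e n))
    (fun x hx => ?_) hs ht
  have h := (H.deriv x hx n hn0).cdot (cross3 e n)
  rw [cdot_neg_left, cdot_smul_left, cdot_helmholtzProj hn0 _
      (by rw [real_inner_comm]; exact inner_cross3_right e n),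
    (interactionSum_planar he hS H.zero_notMem (H.div_free x hx) n).2] at h
  obtain ⟨r, -, hr, -⟩ := H.circle he hS hspan hx
    (by rw [H.planarSupport_eq he hS hspan hx ht]; exact hne)
  rw [Lop_norm_sq_of_circle hr, mul_zero, mul_zero, neg_zero] at h
  exact h

/-- With the in-plane part constant, the normal part solves a linear equation `β' = -i L β` with a
fixed operator `L`. It vanishes outside `S` at all times, so all its time derivatives and thus all
iterates of `L` on it vanish there, which is the hypothesis of `exists_convPoly`. -/
lemma convPoly (H : IsPatternFlow J S a) (he : ‖e‖ = 1)
    (hS : ∀ n ∈ S, inner ℝ e n = (0 : ℝ)) (hspan : ∀ m ∈ S, ∃ n ∈ S, brk e m n ≠ 0)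
    {t : ℝ} (ht : t ∈ J) (hne : (planarSupport S (alpha e (a t))).Nonempty) :
    ∃ (K : ℕ) (c : ℕ → ℂ), ∀ n, cdot (a t n) e = ∑ k ∈ Finset.range K,
      c k * convPow (planarSupport S (alpha e (a t))) (alpha e (a t)) k n := by
  obtain ⟨r, -, hr, A, hA, B, hB, hAB, Θ, hΘA, hΘB, hΘ⟩ := H.circle he hS hspan ht hne
  set α := alpha e (a t) with hα
  set T := planarSupport S α with hT
  have hβ0 : ∀ s ∈ J, ∀ n ∉ S, cdot (a s n) e = 0 := fun s hs n hn => by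
    rw [H.eq_zero s hs n hn, cdot_zero_left]
  have hd : ∀ s ∈ J, ∀ n, HasDerivAt (fun s => cdot (a s n) e)
      (-Complex.I * transport e T α (fun n => cdot (a s n) e) n) s := by
    intro s hs n
    by_cases hn : n = 0
    · have h1 : transport e T α (fun n => cdot (a s n) e) n = 0 := by
        refine Finset.sum_eq_zero fun m _ => ?_
        rw [hn, brk_zero_right]; simp
      rw [h1, mul_zero]
      refine (hasDerivAt_const s (0 : ℂ)).congr_of_eventuallyEq ?_
      filter_upwards [H.isOpen.mem_nhds hs] with x hx
      exact hβ0 x hx n (hn ▸ H.zero_notMem)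
    · have h1 := H.hasDerivAt_beta he hS hs hn
      rw [H.alpha_const he hS hspan hs ht hne, ← hα, Lop_eq_transport (hβ0 s hs)] at h1
      exact h1
  have hdk : ∀ k, ∀ s ∈ J, ∀ n, HasDerivAt
      (fun s => (transport e T α)^[k] (fun n => cdot (a s n) e) n)
      (-Complex.I * (transport e T α)^[k + 1] (fun n => cdot (a s n) e) n) s := by
    intro k
    induction k with
    | zero => exact hd
    | succ k ih =>
      intro s hs n
      have h1 : HasDerivAt (fun s => ∑ m ∈ T, α m * (brk e m n : ℂ) *
          (transport e T α)^[k] (fun n => cdot (a s n) e) (n - m))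
          (∑ m ∈ T, α m * (brk e m n : ℂ) *
            (-Complex.I * (transport e T α)^[k + 1] (fun n => cdot (a s n) e) (n - m))) s :=
        HasDerivAt.fun_sum fun m _ => (ih s hs (n - m)).const_mul _
      convert h1 using 1
      · funext s
        rw [Function.iterate_succ_apply']
        rfl
      · rw [Function.iterate_succ_apply']
        unfold transport
        rw [Finset.mul_sum]
        exact Finset.sum_congr rfl fun m _ => by ring
  have hk : ∀ k, ∀ s ∈ J, ∀ n ∉ S, (transport e T α)^[k] (fun n => cdot (a s n) e) n = 0 := by
    intro k
    induction k with
    | zero => exact hβ0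
    | succ k ih =>
      intro s hs n hn
      have h1 := hasDerivAt_eq_zero_of_eqOn H.isOpen hs (fun x hx => ih x hx n hn) (hdk k s hs n)
      exact (mul_eq_zero.mp h1).resolve_left (by simp)
  exact exists_convPoly (f := fun n => cdot (a t n) e) he
    (fun n hn => hS n (mem_planarSupport.mp hn).1) hA hB
    (mem_planarSupport.mp hA).2 (mem_planarSupport.mp hB).2 hAB hΘA hΘB hΘ hS
    (fun k n hn => hk k t ht n hn)

end IsPatternFlow

/-! ### Classification and independence of time -/

/-- The algebraic form of the classification. -/
def IsClassified (S : Finset E3) (b : E3 → C3) : Prop :=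
  (∃ d : E3, d ≠ 0 ∧ ∀ n ∈ S, ∃ c : ℝ, n = c • d) ∨
  (∃ e : E3, ‖e‖ = 1 ∧ (∀ n ∈ S, inner ℝ e n = (0 : ℝ)) ∧ S.Nonempty ∧
    (∀ m ∈ S, ∃ n ∈ S, brk e m n ≠ 0) ∧ ((∀ n ∈ S, alpha e b n = 0) ∨
    ∃ r : ℝ, 0 < r ∧ (∀ n ∈ planarSupport S (alpha e b), ‖n‖ = r) ∧
      4 ≤ (planarSupport S (alpha e b)).card ∧
      ∃ (K : ℕ) (c : ℕ → ℂ), ∀ n, cdot (b n) e = ∑ k ∈ Finset.range K,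
        c k * convPow (planarSupport S (alpha e b)) (alpha e b) k n)) ∨
  ((∀ d : E3, d ≠ 0 → ∃ n ∈ S, inner ℝ d n ≠ (0 : ℝ)) ∧
    ∃ (κ : ℂ) (r : ℝ), 0 < r ∧ ∀ n ∈ S, crossC (toC n) (b n) = κ • b n ∧ ‖n‖ = r)

lemma fullyBalanced_of_line {S : Finset E3} {b : E3 → C3} {d : E3} (h0 : (0 : E3) ∉ S)
    (hb : ∀ n ∈ S, cdot (b n) n = 0) (hd : ∀ n ∈ S, ∃ c : ℝ, n = c • d) : FullyBalanced S b := by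
  refine fullyBalanced_of_cdot fun m hm n hn => ?_
  obtain ⟨c, hc⟩ := hd m hm
  obtain ⟨c', hc'⟩ := hd n hn
  have hc0 : c ≠ 0 := by
    rintro rfl
    rw [zero_smul] at hc
    exact h0 (hc ▸ hm)
  have h1 : n = (c' / c) • m := by
    rw [hc, smul_smul, div_mul_cancel₀ _ hc0, ← hc']
  rw [h1, cdot_smul_right, hb m hm, mul_zero]

lemma fullyBalanced_of_alpha_eq_zero {S : Finset E3} {b : E3 → C3} {e : E3} (he : ‖e‖ = 1)
    (hS : ∀ n ∈ S, inner ℝ e n = (0 : ℝ)) (h0 : (0 : E3) ∉ S) (hb : ∀ n ∈ S, cdot (b n) n = 0)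
    (h : ∀ n ∈ S, alpha e b n = 0) : FullyBalanced S b := by
  refine fullyBalanced_of_cdot fun m hm n hn => ?_
  rw [cdot_eq_alpha he (hS m hm) (fun h => h0 (h ▸ hm)) (hb m hm), h m hm, hS n hn]; simp

lemma fullyBalanced_of_convPoly {S : Finset E3} {b : E3 → C3} {e : E3} (he : ‖e‖ = 1)
    (hS : ∀ n ∈ S, inner ℝ e n = (0 : ℝ)) (h0 : (0 : E3) ∉ S) (hb : ∀ n ∈ S, cdot (b n) n = 0)
    (hb0 : ∀ n ∉ S, b n = 0) {r : ℝ} (hr : ∀ n ∈ planarSupport S (alpha e b), ‖n‖ = r) {K : ℕ}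
    {c : ℕ → ℂ} (hc : ∀ n, cdot (b n) e = ∑ k ∈ Finset.range K,
      c k * convPow (planarSupport S (alpha e b)) (alpha e b) k n) : FullyBalanced S b :=
  fullyBalanced_of_Lop he hS h0 hb
    (fun N => by
      rw [Lop_eq_transport (fun n hn => by rw [hb0 n hn, cdot_zero_left]),
        transport_of_convPoly hc])
    (Lop_norm_sq_of_circle hr)

lemma IsClassified.fullyBalanced {S : Finset E3} {b : E3 → C3} (H : IsClassified S b)
    (h0 : (0 : E3) ∉ S) (hb : ∀ n ∈ S, cdot (b n) n = 0) (hb0 : ∀ n ∉ S, b n = 0) :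
    FullyBalanced S b := by
  rcases H with ⟨d, -, hd⟩ | ⟨e, he, hS, -, -, h | ⟨r, -, hr, -, K, c, hc⟩⟩ | ⟨-, κ, r, -, h⟩
  · exact fullyBalanced_of_line h0 hb hd
  · exact fullyBalanced_of_alpha_eq_zero he hS h0 hb h
  · exact fullyBalanced_of_convPoly he hS h0 hb hb0 hr hc
  · exact fullyBalanced_of_helical fun n hn => (h n hn).1

lemma IsPatternFlow.isClassified {J : Set ℝ} {S : Finset E3} {a : ℝ → E3 → C3}
    (H : IsPatternFlow J S a) {t : ℝ} (ht : t ∈ J) : IsClassified S (a t) := by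
  classical
  by_cases hspan3 : ∀ d : E3, d ≠ 0 → ∃ n ∈ S, inner ℝ d n ≠ (0 : ℝ)
  · exact Or.inr (Or.inr ⟨hspan3, exists_helical_of_spanning H.zero_notMem H.symm hspan3
      (H.ne_zero t ht) (H.div_free t ht) (H.conj t ht) (H.outerBalanced ht)⟩)
  push Not at hspan3
  obtain ⟨d, hd0, hd⟩ := hspan3
  have hdn : ‖d‖ ≠ 0 := norm_ne_zero_iff.mpr hd0
  obtain ⟨e, he, hS⟩ : ∃ e : E3, ‖e‖ = 1 ∧ ∀ n ∈ S, inner ℝ e n = (0 : ℝ) :=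
    ⟨(‖d‖⁻¹ : ℝ) • d, by rw [norm_smul, norm_inv, norm_norm, inv_mul_cancel₀ hdn],
      fun n hn => by rw [real_inner_smul_left, hd n hn, mul_zero]⟩
  rcases S.eq_empty_or_nonempty with hSe | hSne
  · exact Or.inl ⟨d, hd0, fun n hn => by rw [hSe] at hn; simp at hn⟩
  by_cases hspan : ∀ m ∈ S, ∃ n ∈ S, brk e m n ≠ 0
  swap
  · push Not at hspan
    obtain ⟨m, hm, hmn⟩ := hspan
    have hm0 : m ≠ 0 := fun h => H.zero_notMem (h ▸ hm)
    exact Or.inl ⟨m, hm0, fun n hn =>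
      ⟨_, eq_smul_of_brk_eq_zero he (hS m hm) (hS n hn) hm0 (hmn n hn)⟩⟩
  refine Or.inr (Or.inl ⟨e, he, hS, hSne, hspan, ?_⟩)
  by_cases hne : (planarSupport S (alpha e (a t))).Nonempty
  · right
    obtain ⟨r, hr, hcirc, A, hA, B, hB, hAB, Θ, hΘA, hΘB, -⟩ := H.circle he hS hspan ht hne
    refine ⟨r, hr, hcirc, ?_, H.convPoly he hS hspan ht hne⟩
    have hneg : ∀ n ∈ planarSupport S (alpha e (a t)), -n ∈ planarSupport S (alpha e (a t)) := by
      intro n hn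
      obtain ⟨h1, h2⟩ := mem_planarSupport.mp hn
      exact mem_planarSupport.mpr ⟨H.symm n h1, H.alpha_neg_ne_zero he hS hspan ht h1 h2⟩
    -- Both ends of the edge have `Θ`-level 1 and their negatives have level -1, so `A`, `B`, `-A`,
    -- `-B` are four distinct frequencies.
    have hlev : ∀ x y : E3, inner ℝ Θ x = (1 : ℝ) → inner ℝ Θ y = (1 : ℝ) → x ≠ -y := by
      rintro x y hx hy rfl
      rw [inner_neg_right, hy] at hx
      norm_num at hx
    have hcard : ({A, B, -A, -B} : Finset E3).card = 4 := by
      rw [Finset.card_insert_of_notMem, Finset.card_insert_of_notMem, Finset.card_pair]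
      · exact fun h => hAB (neg_injective h)
      · simp only [Finset.mem_insert, Finset.mem_singleton, not_or]
        exact ⟨hlev _ _ hΘB hΘA, hlev _ _ hΘB hΘB⟩
      · simp only [Finset.mem_insert, Finset.mem_singleton, not_or]
        exact ⟨hAB, hlev _ _ hΘA hΘA, hlev _ _ hΘA hΘB⟩
    rw [← hcard]
    refine Finset.card_le_card ?_
    intro n hn
    simp only [Finset.mem_insert, Finset.mem_singleton] at hn
    rcases hn with rfl | rfl | rfl | rfl
    · exact hA
    · exact hB
    · exact hneg _ hA
    · exact hneg _ hB
  · left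
    intro n hn
    by_contra h
    exact hne ⟨n, mem_planarSupport.mpr ⟨hn, h⟩⟩

lemma interactionSum_eq_of_subset {S E : Finset E3} {b : E3 → C3} (hE : E ⊆ S)
    (hb : ∀ n ∈ S, n ∉ E → b n = 0) (N : E3) : interactionSum S b N = interactionSum E b N := by
  classical
  unfold interactionSum
  rw [← Finset.sum_subset hE]
  · refine Finset.sum_congr rfl fun m _ => ?_
    rw [← Finset.sum_subset hE]
    intro n hn hn'
    rw [hb n hn hn']
    simp
  · intro m hm hm'
    refine Finset.sum_eq_zero fun n _ => ?_
    rw [hb m hm hm']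
    simp

/-- Nonvanishing is an open condition, so near `t₀` both sets can only grow. Maximality of the sum
of their sizes makes each of them constant. -/
lemma exists_patternFlow {I : Set ℝ} (hI : IsOpen I) {S : Finset E3} {a : ℝ → E3 → C3}
    {u : ℝ → E3 → E3} (hu : IsFiniteModeFlow I S a u) (hE : SolvesProjectedEuler I S a)
    {t₀ : ℝ} (ht₀ : t₀ ∈ I)
    (hmax : ∀ t ∈ I, (S.filter fun n => a t n ≠ 0).card +
        ((S ×ˢ S).filter fun x => cdot (a t x.1) x.2 ≠ 0).card ≤
      (S.filter fun n => a t₀ n ≠ 0).card +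
        ((S ×ˢ S).filter fun x => cdot (a t₀ x.1) x.2 ≠ 0).card) :
    ∃ J ⊆ I, t₀ ∈ J ∧ IsPatternFlow J (S.filter fun n => a t₀ n ≠ 0) a := by
  classical
  set A : ℝ → Finset E3 := fun t => S.filter fun n => a t n ≠ 0 with hA
  set B : ℝ → Finset (E3 × E3) := fun t => (S ×ˢ S).filter fun x => cdot (a t x.1) x.2 ≠ 0 with hB
  have hcont : ∀ n ∈ S, ContinuousAt (fun s => a s n) t₀ := fun n hn =>
    (hE t₀ ht₀ n (Or.inl hn)).continuousAt
  have hAev : ∀ᶠ t in nhds t₀, A t₀ ⊆ A t := by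
    have : ∀ᶠ t in nhds t₀, ∀ n ∈ A t₀, a t n ≠ 0 := by
      rw [Filter.eventually_all_finset]
      intro n hn
      obtain ⟨h1, h2⟩ := Finset.mem_filter.mp hn
      exact (hcont n h1).eventually_ne h2
    filter_upwards [this] with t ht n hn
    exact Finset.mem_filter.mpr ⟨(Finset.mem_filter.mp hn).1, ht n hn⟩
  have hBev : ∀ᶠ t in nhds t₀, B t₀ ⊆ B t := by
    have : ∀ᶠ t in nhds t₀, ∀ x ∈ B t₀, cdot (a t x.1) x.2 ≠ 0 := by
      rw [Filter.eventually_all_finset]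
      intro x hx
      obtain ⟨h1, h2⟩ := Finset.mem_filter.mp hx
      have h3 : ContinuousAt (fun s => cdot (a s x.1) x.2) t₀ :=
        ((hE t₀ ht₀ x.1 (Or.inl (Finset.mem_product.mp h1).1)).cdot x.2).continuousAt
      exact h3.eventually_ne h2
    filter_upwards [this] with t ht x hx
    exact Finset.mem_filter.mpr ⟨(Finset.mem_filter.mp hx).1, ht x hx⟩
  obtain ⟨ε, hε, hball⟩ := Metric.eventually_nhds_iff_ball.mp
    ((hAev.and hBev).and (hI.mem_nhds ht₀))
  have hJ : ∀ t ∈ Metric.ball t₀ ε, t ∈ I ∧ A t = A t₀ ∧ B t = B t₀ := by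
    intro t ht
    obtain ⟨⟨h1, h2⟩, h3⟩ := hball t ht
    have h4 := hmax t h3
    have h5 := Finset.card_le_card h1
    have h6 := Finset.card_le_card h2
    simp only [hA, hB] at h5 h6
    refine ⟨h3, (Finset.eq_of_subset_of_card_le h1 ?_).symm,
      (Finset.eq_of_subset_of_card_le h2 ?_).symm⟩
    · simp only [hA]; omega
    · simp only [hB]; omega
  have memA : ∀ {t n}, n ∈ A t ↔ n ∈ S ∧ a t n ≠ 0 := by
    intro t n; simp only [hA]; rw [Finset.mem_filter]
  have hzero : ∀ t ∈ Metric.ball t₀ ε, ∀ n ∉ A t₀, a t n = 0 := by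
    intro t ht n hn
    obtain ⟨h1, h2, -⟩ := hJ t ht
    by_cases hnS : n ∈ S
    · by_contra h
      rw [← h2] at hn
      exact hn (memA.mpr ⟨hnS, h⟩)
    · exact hu.coeff_eq_zero t h1 n hnS
  refine ⟨Metric.ball t₀ ε, fun t ht => (hJ t ht).1, Metric.mem_ball_self hε, ?_⟩
  refine ⟨Metric.isOpen_ball, (convex_ball t₀ ε).isPreconnected,
    fun h => hu.freq.zero_notMem (memA.mp h).1, ?_, ?_, hzero,
    fun t ht n hn => hu.conj t (hJ t ht).1 n (memA.mp hn).1,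
    fun t ht n hn => hu.div_free t (hJ t ht).1 n (memA.mp hn).1, ?_, ?_⟩
  · intro n hn
    obtain ⟨h1, h2⟩ := memA.mp hn
    refine memA.mpr ⟨hu.freq.symm n h1, fun h => h2 ?_⟩
    ext i
    have h3 := hu.conj t₀ ht₀ n h1 i
    rw [h] at h3
    simpa using h3.symm
  · intro t ht n hn
    have hn' : n ∈ A t₀ := hn
    rw [← (hJ t ht).2.1] at hn'
    exact (memA.mp hn').2
  · intro n hn m hm
    by_cases h : (n, m) ∈ B t₀
    · right
      intro t ht
      rw [← (hJ t ht).2.2] at h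
      exact (Finset.mem_filter.mp h).2
    · left
      intro t ht
      rw [← (hJ t ht).2.2] at h
      by_contra h1
      exact h (Finset.mem_filter.mpr ⟨Finset.mem_product.mpr ⟨(memA.mp hn).1, (memA.mp hm).1⟩, h1⟩)
  · intro t ht n hn
    rw [← interactionSum_eq_of_subset (Finset.filter_subset _ S)
      (fun n _ hn' => hzero t ht n hn') n]
    by_cases h : n ∈ S ∨ (n ≠ 0 ∧ ∃ n₁ ∈ S, ∃ n₂ ∈ S, n₁ + n₂ = n)
    · exact hE t (hJ t ht).1 n h
    · rw [not_or] at h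
      rw [interactionSum_eq_zero, helmholtzProj_zero, smul_zero, neg_zero]
      · refine (hasDerivAt_const t (0 : C3)).congr_of_eventuallyEq ?_
        filter_upwards [Metric.isOpen_ball.mem_nhds ht] with s hs
        exact hu.coeff_eq_zero s (hJ s hs).1 n h.1
      · intro m hm l hl hml
        exact absurd ⟨hn, m, hm, l, hl, hml⟩ h.2

/-- A solution of the projected Euler system is independent of time, and classified. -/
lemma steady_of_solvesProjectedEuler {I : Set ℝ} (hI : IsOpen I) (hI' : I.OrdConnected)
    (hIne : I.Nonempty) {S : Finset E3} {a : ℝ → E3 → C3} {u : ℝ → E3 → E3}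
    (hu : IsFiniteModeFlow I S a u) (hE : SolvesProjectedEuler I S a) :
    ∃ t₁ ∈ I, (∀ t ∈ I, ∀ n, a t n = a t₁ n) ∧ (∀ n ∈ S, a t₁ n ≠ 0) ∧ IsClassified S (a t₁) := by
  classical
  set F : ℝ → ℕ := fun t => (S.filter fun n => a t n ≠ 0).card +
        ((S ×ˢ S).filter fun x => cdot (a t x.1) x.2 ≠ 0).card with hF
  have hbdd : ∀ t, F t ≤ S.card + (S ×ˢ S).card := fun t =>
    add_le_add (Finset.card_filter_le _ _) (Finset.card_filter_le _ _)
  obtain ⟨t₁, ht₁, hmax⟩ : ∃ t₁ ∈ I, ∀ t ∈ I, F t ≤ F t₁ := by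
    have hfin : (F '' I).Finite := (Set.finite_Iic (S.card + (S ×ˢ S).card)).subset (by
      rintro _ ⟨t, -, rfl⟩
      exact hbdd t)
    obtain ⟨t₁, ht₁, h⟩ := Set.exists_max_image (F '' I) id hfin (hIne.image F)
    obtain ⟨t, ht, rfl⟩ := ht₁
    exact ⟨t, ht, fun s hs => h _ ⟨s, hs, rfl⟩⟩
  -- `K` is open and closed in `I`. The counts at a time of `K` equal those at `t₁` and are maximal,
  -- so the flow near it is a classified pattern flow with zero derivative. Continuity of the
  -- coefficients gives closedness.
  set K : Set ℝ := {t | t ∈ I ∧ ∀ n ∈ S, a t n = a t₁ n} with hK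
  have hFK : ∀ t ∈ K, F t = F t₁ := by
    rintro t ⟨-, ht⟩
    simp only [hF]
    congr 2
    · exact Finset.filter_congr fun n hn => by rw [ht n hn]
    · exact Finset.filter_congr fun x hx => by rw [ht x.1 (Finset.mem_product.mp hx).1]
  have hKopen : IsOpen K := by
    rw [isOpen_iff_mem_nhds]
    intro t₀ ht₀
    obtain ⟨J, hJI, ht₀J, H⟩ := exists_patternFlow hI hu hE ht₀.1
      (fun t ht => by
        have h1 := hmax t ht
        rw [← hFK t₀ ht₀] at h1
        exact h1)
    filter_upwards [H.isOpen.mem_nhds ht₀J] with t ht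
    refine ⟨hJI ht, fun n hn => ?_⟩
    rw [← ht₀.2 n hn]
    refine eq_of_hasDerivAt_zero H.isOpen H.preconn (f := fun s => a s n) (fun s hs => ?_) ht ht₀J
    have hn0 : n ≠ 0 := fun h => hu.freq.zero_notMem (h ▸ hn)
    have h1 := H.deriv s hs n hn0
    rw [(H.isClassified hs).fullyBalanced H.zero_notMem (H.div_free s hs) (H.eq_zero s hs) n hn0,
      smul_zero, neg_zero] at h1
    exact h1
  have hIK : I ⊆ K := by
    refine hI'.isPreconnected.subset_of_closure_inter_subset hKopen
      ⟨t₁, ht₁, ht₁, fun _ _ => rfl⟩ ?_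
    rintro t ⟨htK, htI⟩
    refine ⟨htI, fun n hn => ?_⟩
    by_contra hne
    have h1 : ∀ᶠ s in nhds t, a s n ≠ a t₁ n :=
      (hE t htI n (Or.inl hn)).continuousAt.eventually_ne hne
    obtain ⟨s, hs1, hs2⟩ := (mem_closure_iff_frequently.mp htK).and_eventually h1 |>.exists
    exact hs2 (hs1.2 n hn)
  have hnz : ∀ n ∈ S, a t₁ n ≠ 0 := by
    intro n hn
    obtain ⟨t, ht, h⟩ := hu.coeff_ne_zero n hn
    rwa [(hIK ht).2 n hn] at h
  refine ⟨t₁, ht₁, fun t ht n => ?_, hnz, ?_⟩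
  · by_cases hn : n ∈ S
    · exact (hIK ht).2 n hn
    · rw [hu.coeff_eq_zero t ht n hn, hu.coeff_eq_zero t₁ ht₁ n hn]
  · obtain ⟨J, -, ht₁J, H⟩ := exists_patternFlow hI hu hE ht₁ hmax
    have h1 := H.isClassified ht₁J
    rwa [Finset.filter_true_of_mem hnz] at h1

/-! ### Uniqueness of Fourier coefficients -/

lemma fourierChar3_add (m n x : E3) :
    fourierChar3 (m + n) x = fourierChar3 m x * fourierChar3 n x := by
  unfold fourierChar3
  rw [← Complex.exp_add, inner_add_left]
  congr 1
  push_cast; ring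

lemma fourierChar3_zero (x : E3) : fourierChar3 0 x = 1 := by simp [fourierChar3]

/-- The character of frequency `n` as a monoid homomorphism. -/
noncomputable def fourierHom (n : E3) : Multiplicative E3 →* ℂ where
  toFun x := fourierChar3 n x.toAdd
  map_one' := by simp [fourierChar3]
  map_mul' x y := by
    unfold fourierChar3
    rw [← Complex.exp_add, toAdd_mul, inner_add_right]
    congr 1
    push_cast; ring

lemma fourierHom_injective : Function.Injective fourierHom := by
  intro m n h
  by_contra hmn
  have hd : m - n ≠ 0 := sub_ne_zero.mpr hmn
  have hd2 : ‖m - n‖ ^ 2 ≠ 0 := pow_ne_zero 2 (norm_ne_zero_iff.mpr hd)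
  -- At this point the characters of `m` and `n` differ by the factor `exp (i π) = -1`.
  set x : E3 := (Real.pi / ‖m - n‖ ^ 2) • (m - n) with hx
  have h1 : fourierChar3 m x = fourierChar3 n x := DFunLike.congr_fun h (Multiplicative.ofAdd x)
  have h2 : fourierChar3 m x = fourierChar3 (m - n) x * fourierChar3 n x := by
    rw [← fourierChar3_add, sub_add_cancel]
  have h3 : fourierChar3 (m - n) x = -1 := by
    unfold fourierChar3
    rw [hx, inner_smul_right, real_inner_self_eq_norm_sq, div_mul_cancel₀ _ hd2, mul_comm,
      Complex.exp_pi_mul_I]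
  have h4 : fourierChar3 n x ≠ 0 := Complex.exp_ne_zero _
  rw [h3, h1] at h2
  exact h4 (by linear_combination h2 / 2)

/-- Distinct characters are linearly independent by Dedekind's theorem; no integration is needed for
arbitrary real frequencies. -/
lemma fourier_sum_eq_zero {F : Finset E3} {g : E3 → ℂ}
    (h : ∀ x, ∑ n ∈ F, g n * fourierChar3 n x = 0) : ∀ n ∈ F, g n = 0 := by
  have hli : LinearIndependent ℂ (fun n : E3 => (fourierHom n : Multiplicative E3 → ℂ)) :=
    (linearIndependent_monoidHom (Multiplicative E3) ℂ).comp fourierHom fourierHom_injective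
  refine linearIndependent_iff'.mp hli F g ?_
  funext x
  simp only [Finset.sum_apply, Pi.smul_apply, smul_eq_mul, Pi.zero_apply]
  exact h x.toAdd

/-- `f` is a trigonometric polynomial with coefficient function `g`. -/
def HasFourier (f : E3 → ℂ) (g : E3 → ℂ) : Prop :=
  ∃ F : Finset E3, (∀ n ∉ F, g n = 0) ∧ ∀ x, f x = ∑ n ∈ F, g n * fourierChar3 n x

namespace HasFourier

variable {f f' g g' : E3 → ℂ}

lemma sum_eq_of_subset {F G : Finset E3} (hFG : F ⊆ G) (hF : ∀ n ∉ F, g n = 0) (x : E3) :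
    ∑ n ∈ F, g n * fourierChar3 n x = ∑ n ∈ G, g n * fourierChar3 n x :=
  Finset.sum_subset hFG fun n _ hn => by rw [hF n hn, zero_mul]

lemma coeff_unique (h : HasFourier f g) (h' : HasFourier f g') : g = g' := by
  classical
  obtain ⟨F, hF, hf⟩ := h
  obtain ⟨G, hG, hf'⟩ := h'
  have h1 : ∀ n ∈ F ∪ G, g n - g' n = 0 := by
    refine fourier_sum_eq_zero fun x => ?_
    simp only [sub_mul, Finset.sum_sub_distrib]
    rw [← sum_eq_of_subset Finset.subset_union_left hF,
      ← sum_eq_of_subset Finset.subset_union_right hG, ← hf, ← hf', sub_self]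
  funext n
  by_cases hn : n ∈ F ∪ G
  · exact sub_eq_zero.mp (h1 n hn)
  · rw [Finset.mem_union, not_or] at hn
    rw [hF n hn.1, hG n hn.2]

lemma fun_unique (h : HasFourier f g) (h' : HasFourier f' g) : f = f' := by
  classical
  obtain ⟨F, hF, hf⟩ := h
  obtain ⟨G, hG, hf'⟩ := h'
  funext x
  rw [hf, hf', sum_eq_of_subset Finset.subset_union_left hF,
    sum_eq_of_subset Finset.subset_union_right hG]

lemma add (h : HasFourier f g) (h' : HasFourier f' g') :
    HasFourier (fun x => f x + f' x) (fun n => g n + g' n) := by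
  classical
  obtain ⟨F, hF, hf⟩ := h
  obtain ⟨G, hG, hf'⟩ := h'
  refine ⟨F ∪ G, fun n hn => ?_, fun x => ?_⟩
  · rw [Finset.mem_union, not_or] at hn
    beta_reduce
    rw [hF n hn.1, hG n hn.2, add_zero]
  · beta_reduce
    rw [hf, hf', sum_eq_of_subset Finset.subset_union_left hF,
      sum_eq_of_subset Finset.subset_union_right hG, ← Finset.sum_add_distrib]
    exact Finset.sum_congr rfl fun n _ => by ring

lemma const_mul (h : HasFourier f g) (c : ℂ) :
    HasFourier (fun x => c * f x) (fun n => c * g n) := by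
  obtain ⟨F, hF, hf⟩ := h
  refine ⟨F, fun n hn => by beta_reduce; rw [hF n hn, mul_zero], fun x => ?_⟩
  beta_reduce
  rw [hf, Finset.mul_sum]
  exact Finset.sum_congr rfl fun n _ => by ring

lemma sum {ι : Type*} (s : Finset ι) {f g : ι → E3 → ℂ} (h : ∀ i ∈ s, HasFourier (f i) (g i)) :
    HasFourier (fun x => ∑ i ∈ s, f i x) (fun n => ∑ i ∈ s, g i n) := by
  classical
  induction s using Finset.induction_on with
  | empty => exact ⟨∅, by simp, by simp⟩
  | insert i s hi ih =>
    simp only [Finset.sum_insert hi]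
    exact (h i (Finset.mem_insert_self i s)).add
      (ih fun j hj => h j (Finset.mem_insert_of_mem hj))

lemma trig_mul (h : HasFourier f g) (T : Finset E3) (a : E3 → ℂ) :
    HasFourier (fun x => (∑ m ∈ T, a m * fourierChar3 m x) * f x)
      (fun n => ∑ m ∈ T, a m * g (n - m)) := by
  classical
  obtain ⟨F, hF, hf⟩ := h
  simp only [Finset.sum_mul]
  refine HasFourier.sum T fun m _ => ?_
  refine ⟨F.map (addLeftEmbedding m), fun n hn => ?_, fun x => ?_⟩
  · beta_reduce
    rw [hF, mul_zero]
    intro h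
    exact hn (Finset.mem_map.mpr ⟨n - m, h, add_sub_cancel m n⟩)
  · beta_reduce
    rw [hf, Finset.sum_map, Finset.mul_sum]
    refine Finset.sum_congr rfl fun n _ => ?_
    rw [addLeftEmbedding_apply, fourierChar3_add, add_sub_cancel_left]
    ring

lemma pow (T : Finset E3) (a : E3 → ℂ) (k : ℕ) :
    HasFourier (fun x => (∑ m ∈ T, a m * fourierChar3 m x) ^ k) (convPow T a k) := by
  classical
  induction k with
  | zero =>
    refine ⟨{0}, fun n hn => ?_, fun x => ?_⟩
    · rw [convPow_zero, if_neg (by simpa using hn)]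
    · beta_reduce
      rw [Finset.sum_singleton, convPow_zero, if_pos rfl, fourierChar3_zero, pow_zero, mul_one]
  | succ k ih =>
    simp only [pow_succ']
    exact ih.trig_mul T a

lemma convPoly (T : Finset E3) (a : E3 → ℂ) (K : ℕ) (c : ℕ → ℂ) :
    HasFourier (fun x => ∑ k ∈ Finset.range K, c k * (∑ m ∈ T, a m * fourierChar3 m x) ^ k)
      (fun n => ∑ k ∈ Finset.range K, c k * convPow T a k n) :=
  HasFourier.sum _ fun k _ => (HasFourier.pow T a k).const_mul (c k)

end HasFourier

/-! ### The curl on the Fourier side -/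

lemma hasFDerivAt_fourierChar3 (n x : E3) : HasFDerivAt (fourierChar3 n)
    (fourierChar3 n x • (Complex.I • (Complex.ofRealCLM.comp (innerSL ℝ n)))) x := by
  have h : HasFDerivAt (fun y : E3 => Complex.I * ((inner ℝ n y : ℝ) : ℂ))
      (Complex.I • (Complex.ofRealCLM.comp (innerSL ℝ n))) x :=
    (Complex.I • (Complex.ofRealCLM.comp (innerSL ℝ n)) : E3 →L[ℝ] ℂ).hasFDerivAt
  exact h.cexp

/-- The component is the real part of the trigonometric sum, and the imaginary part vanishes
identically. The complex derivative of the sum is therefore real and equals the partial derivative.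
-/
lemma partialD_eq {S : Finset E3} {g : E3 → ℂ} {v : E3 → E3} (j k : Fin 3)
    (h : ∀ x, ((v x k : ℝ) : ℂ) = ∑ n ∈ S, g n * fourierChar3 n x) (x : E3) :
    ((partialD j k v x : ℝ) : ℂ) = ∑ n ∈ S, (Complex.I * (n j : ℂ) * g n) * fourierChar3 n x := by
  set G : E3 → ℂ := fun y => ∑ n ∈ S, g n * fourierChar3 n y with hG
  set G' : E3 →L[ℝ] ℂ := ∑ n ∈ S,
    g n • (fourierChar3 n x • (Complex.I • (Complex.ofRealCLM.comp (innerSL ℝ n)))) with hG'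
  have hd : HasFDerivAt G G' x :=
    HasFDerivAt.fun_sum fun n _ => (hasFDerivAt_fourierChar3 n x).const_mul (g n)
  have hre : HasFDerivAt (fun y => v y k) (Complex.reCLM.comp G') x := by
    have h1 := Complex.reCLM.hasFDerivAt.comp x hd
    have h2 : (fun y => v y k) = Complex.reCLM ∘ G := by
      funext y
      show v y k = (G y).re
      simp only [hG]
      rw [← h y, Complex.ofReal_re]
    rw [h2]
    exact h1
  have him : HasFDerivAt (fun _ : E3 => (0 : ℝ)) (Complex.imCLM.comp G') x := by
    have h1 := Complex.imCLM.hasFDerivAt.comp x hd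
    have h2 : (fun _ : E3 => (0 : ℝ)) = Complex.imCLM ∘ G := by
      funext y
      show 0 = (G y).im
      simp only [hG]
      rw [← h y, Complex.ofReal_im]
    rw [h2]
    exact h1
  have h0 := him.unique (hasFDerivAt_const (0 : ℝ) x)
  have h1 : ((partialD j k v x : ℝ) : ℂ) = G' (EuclideanSpace.single j 1) := by
    apply Complex.ext
    · rw [Complex.ofReal_re, partialD, hre.fderiv]; rfl
    · rw [Complex.ofReal_im]
      exact (DFunLike.congr_fun h0 (EuclideanSpace.single j 1)).symm
  rw [h1, hG', sum_apply]
  refine Finset.sum_congr rfl fun n _ => ?_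
  have h3 : inner ℝ n (EuclideanSpace.single j 1) = n j := by
    fin_cases j <;> simp [inner_eq3]
  simp only [smul_apply, ContinuousLinearMap.comp_apply, innerSL_apply_apply,
    smul_eq_mul, h3, Complex.ofRealCLM_apply]
  ring

lemma curl3_eq {S : Finset E3} {b : E3 → C3} {v : E3 → E3}
    (h : ∀ x i, ((v x i : ℝ) : ℂ) = ∑ n ∈ S, b n i * fourierChar3 n x) (x : E3) (i : Fin 3) :
    ((curl3 v x i : ℝ) : ℂ) =
      ∑ n ∈ S, (Complex.I * crossC (toC n) (b n) i) * fourierChar3 n x := by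
  have key := fun j k => partialD_eq (g := fun n => b n k) j k (fun x => h x k) x
  fin_cases i
  · show ((partialD 1 2 v x - partialD 2 1 v x : ℝ) : ℂ) =
      ∑ n ∈ S, (Complex.I * crossC (toC n) (b n) 0) * fourierChar3 n x
    rw [Complex.ofReal_sub, key, key, ← Finset.sum_sub_distrib]
    refine Finset.sum_congr rfl fun n _ => ?_
    simp only [crossC_zero, toC_apply]; ring
  · show ((partialD 2 0 v x - partialD 0 2 v x : ℝ) : ℂ) =
      ∑ n ∈ S, (Complex.I * crossC (toC n) (b n) 1) * fourierChar3 n x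
    rw [Complex.ofReal_sub, key, key, ← Finset.sum_sub_distrib]
    refine Finset.sum_congr rfl fun n _ => ?_
    simp only [crossC_one, toC_apply]; ring
  · show ((partialD 0 1 v x - partialD 1 0 v x : ℝ) : ℂ) =
      ∑ n ∈ S, (Complex.I * crossC (toC n) (b n) 2) * fourierChar3 n x
    rw [Complex.ofReal_sub, key, key, ← Finset.sum_sub_distrib]
    refine Finset.sum_congr rfl fun n _ => ?_
    simp only [crossC_two, toC_apply]; ring

lemma inner_expansion {S : Finset E3} {b : E3 → C3} {v : E3 → E3}
    (h : ∀ x i, ((v x i : ℝ) : ℂ) = ∑ n ∈ S, b n i * fourierChar3 n x) (y x : E3) :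
    ((inner ℝ y (v x) : ℝ) : ℂ) = ∑ n ∈ S, cdot (b n) y * fourierChar3 n x := by
  rw [inner_eq3]
  push_cast
  rw [h, h, h, Finset.mul_sum, Finset.mul_sum, Finset.mul_sum, ← Finset.sum_add_distrib,
    ← Finset.sum_add_distrib]
  refine Finset.sum_congr rfl fun n _ => ?_
  rw [cdot_eq3]; ring

namespace IsFiniteModeField

variable {S : Finset E3} {b : E3 → C3} {v : E3 → E3}

lemma hasFourier (H : IsFiniteModeField S b v) (i : Fin 3) :
    HasFourier (fun x => ((v x i : ℝ) : ℂ)) (fun n => b n i) :=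
  ⟨S, fun n hn => by beta_reduce; rw [H.coeff_eq_zero n hn]; rfl, fun x => H.expansion x i⟩

lemma hasFourier_inner (H : IsFiniteModeField S b v) (y : E3) :
    HasFourier (fun x => ((inner ℝ y (v x) : ℝ) : ℂ)) (fun n => cdot (b n) y) :=
  ⟨S, fun n hn => by beta_reduce; rw [H.coeff_eq_zero n hn, cdot_zero_left],
    fun x => inner_expansion H.expansion y x⟩

lemma hasFourier_curl (H : IsFiniteModeField S b v) (i : Fin 3) :
    HasFourier (fun x => ((curl3 v x i : ℝ) : ℂ))
      (fun n => Complex.I * crossC (toC n) (b n) i) :=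
  ⟨S, fun n hn => by beta_reduce; rw [H.coeff_eq_zero n hn]; fin_cases i <;> simp,
    fun x => curl3_eq H.expansion x i⟩

lemma hasFourier_inner_curl (H : IsFiniteModeField S b v) (y : E3) :
    HasFourier (fun x => ((inner ℝ y (curl3 v x) : ℝ) : ℂ))
      (fun n => Complex.I * cdot (b n) (cross3 y n)) := by
  refine ⟨S, fun n hn => by beta_reduce; rw [H.coeff_eq_zero n hn, cdot_zero_left, mul_zero], fun x => ?_⟩
  beta_reduce
  rw [inner_expansion (b := fun n => Complex.I • crossC (toC n) (b n))
    (fun x i => by simpa using curl3_eq H.expansion x i)]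
  refine Finset.sum_congr rfl fun n _ => ?_
  rw [cdot_smul_left, cdot_crossC_toC]

end IsFiniteModeField

/-! ### Translation between coefficients and fields -/

lemma isLineSupport_of_smul {S : Finset E3} {d : E3} (hd : d ≠ 0)
    (h : ∀ n ∈ S, ∃ c : ℝ, n = c • d) : IsLineSupport S :=
  ⟨Submodule.span ℝ {d}, finrank_span_singleton hd, fun n hn => by
    obtain ⟨c, hc⟩ := h n hn
    exact Submodule.mem_span_singleton.mpr ⟨c, hc.symm⟩⟩

lemma linearIndependent_triple {n₁ n₂ n₃ : E3} (h : inner ℝ (cross3 n₁ n₂) n₃ ≠ (0 : ℝ)) :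
    LinearIndependent ℝ ![n₁, n₂, n₃] := by
  rw [Fintype.linearIndependent_iff]
  intro g hg
  simp only [Fin.sum_univ_three, Matrix.cons_val_zero, Matrix.cons_val_one, Matrix.cons_val] at hg
  have e3 := congrArg (fun v => inner ℝ (cross3 n₁ n₂) v) hg
  have e1 := congrArg (fun v => inner ℝ (cross3 n₂ n₃) v) hg
  have e2 := congrArg (fun v => inner ℝ (cross3 n₃ n₁) v) hg
  simp only [inner_add_right, inner_smul_right, inner_cross3_left, inner_cross3_right, mul_zero,
    inner_zero_right, zero_add, add_zero] at e1 e2 e3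
  rw [inner_cross3_cyclic n₂ n₃ n₁] at e1
  rw [← inner_cross3_cyclic n₁ n₂ n₃] at e2
  intro i
  fin_cases i
  · exact (mul_eq_zero.mp e1).resolve_right h
  · exact (mul_eq_zero.mp e2).resolve_right h
  · exact (mul_eq_zero.mp e3).resolve_right h

lemma linearIndependent_pair {n₁ n₂ : E3} (h : cross3 n₁ n₂ ≠ 0) :
    LinearIndependent ℝ ![n₁, n₂] := by
  rw [LinearIndependent.pair_iff]
  intro s t hst
  have h1 : s • cross3 n₁ n₂ = 0 := by
    have h2 : cross3 (s • n₁ + t • n₂) n₂ = s • cross3 n₁ n₂ := by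
      apply ext3 <;> simp <;> ring
    rw [← h2, hst]
    apply ext3 <;> simp
  have h2 : t • cross3 n₁ n₂ = 0 := by
    have h2 : cross3 n₁ (s • n₁ + t • n₂) = t • cross3 n₁ n₂ := by
      apply ext3 <;> simp <;> ring
    rw [← h2, hst, cross3_zero_right]
  exact ⟨(smul_eq_zero.mp h1).resolve_right h, (smul_eq_zero.mp h2).resolve_right h⟩

namespace IsFiniteModeField

variable {S : Finset E3} {b : E3 → C3} {v : E3 → E3}

lemma coeff_planar (H : IsFiniteModeField S b v) {e : E3} (he : ‖e‖ = 1)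
    (hS : ∀ n ∈ S, inner ℝ e n = (0 : ℝ)) {n : E3} (hn : n ∈ S) :
    b n = alpha e b n • toC (cross3 e n) + cdot (b n) e • toC e := by
  have hn0 : n ≠ 0 := fun h => H.freq.zero_notMem (h ▸ hn)
  have hnC : ((‖n‖ ^ 2 : ℝ) : ℂ) ≠ 0 :=
    Complex.ofReal_ne_zero.mpr (pow_ne_zero 2 (norm_ne_zero_iff.mpr hn0))
  rw [← sub_eq_zero]
  apply eq_zero_of_cdot_eq_zero (cross3_ne_zero_of_perp he (hS n hn) hn0) <;>
    rw [cdot_sub_left, cdot_add_left, cdot_smul_left, cdot_smul_left, cdot_toC, cdot_toC]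
  · rw [inner_cross3_left, real_inner_self_eq_norm_sq, he]; simp
  · rw [H.div_free n hn, inner_cross3_right, hS n hn]; simp
  · rw [norm_cross3_of_perp he (hS n hn), ← real_inner_comm e, inner_cross3_left, alpha,
      div_mul_cancel₀ _ hnC]
    simp

lemma curl_isBeltrami (H : IsFiniteModeField S b v) {κ : ℂ}
    (h : ∀ n ∈ S, crossC (toC n) (b n) = κ • b n) : IsBeltrami v := by
  refine ⟨Complex.I * κ, fun x i => ?_⟩
  rw [curl3_eq H.expansion, H.expansion, Finset.mul_sum]
  refine Finset.sum_congr rfl fun n hn => ?_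
  rw [h n hn, PiLp.smul_apply, smul_eq_mul]; ring

lemma eq_smul_of_alpha_eq_zero (H : IsFiniteModeField S b v) {e : E3} (he : ‖e‖ = 1)
    (hS : ∀ n ∈ S, inner ℝ e n = (0 : ℝ)) (hα : ∀ n ∈ S, alpha e b n = 0) (x : E3) :
    v x = (inner ℝ e (v x) : ℝ) • e := by
  ext i
  have h1 : ((v x i : ℝ) : ℂ) = (((inner ℝ e (v x) : ℝ) * e i : ℝ) : ℂ) := by
    push_cast
    rw [H.expansion, inner_expansion H.expansion, Finset.sum_mul]
    refine Finset.sum_congr rfl fun n hn => ?_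
    conv_lhs => rw [H.coeff_planar he hS hn, hα n hn]
    simp only [zero_smul, zero_add, PiLp.smul_apply, smul_eq_mul, toC_apply]
    ring
  exact_mod_cast h1

lemma alpha_neg (H : IsFiniteModeField S b v) (e : E3) {n : E3} (hn : n ∈ S) :
    alpha e b (-n) = - starRingEnd ℂ (alpha e b n) := by
  have h := H.conj n hn
  simp only [alpha, cross3_neg_right, PiLp.neg_apply, Complex.ofReal_neg, norm_neg, map_div₀, Complex.conj_ofReal,
    cdot_eq3, h, map_add, map_mul]
  ring

lemma isVorticityPolynomialFlow (H : IsFiniteModeField S b v) {e : E3} (he : ‖e‖ = 1)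
    (hS : ∀ n ∈ S, inner ℝ e n = (0 : ℝ)) {r : ℝ} (hr : 0 < r)
    (hcirc : ∀ n ∈ planarSupport S (alpha e b), ‖n‖ = r)
    (hcard : 4 ≤ (planarSupport S (alpha e b)).card) {K : ℕ} {c : ℕ → ℂ}
    (hc : ∀ n, cdot (b n) e = ∑ k ∈ Finset.range K,
      c k * convPow (planarSupport S (alpha e b)) (alpha e b) k n) :
    IsVorticityPolynomialFlow (Submodule.span ℝ {e})ᗮ v := by
  classical
  set α := alpha e b with hα
  set T := planarSupport S α with hT
  have TS : ∀ {n}, n ∈ T → n ∈ S := fun h => (mem_planarSupport.mp h).1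
  have hsub : T ⊆ S := fun n hn => TS hn
  have hee : inner ℝ e e = (1 : ℝ) := by rw [real_inner_self_eq_norm_sq, he]; norm_num
  set d : E3 → C3 := fun n => α n • toC (cross3 e n) with hd
  have hd0 : ∀ n ∉ T, d n = 0 := by
    intro n hn
    have : α n = 0 := by
      by_cases hnS : n ∈ S
      · by_contra h
        exact hn (mem_planarSupport.mpr ⟨hnS, h⟩)
      · rw [hα, alpha, H.coeff_eq_zero n hnS, cdot_zero_left, zero_div]
    simp only [hd]
    rw [this, zero_smul]
  set vpar : E3 → E3 := fun x => v x - (inner ℝ e (v x) : ℝ) • e with hvpar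
  have hexp : ∀ x i, ((vpar x i : ℝ) : ℂ) = ∑ n ∈ T, d n i * fourierChar3 n x := by
    intro x i
    rw [Finset.sum_subset hsub fun n _ hn => by rw [hd0 n hn]; simp]
    simp only [hvpar, PiLp.sub_apply, PiLp.smul_apply, smul_eq_mul]
    push_cast
    rw [H.expansion, inner_expansion H.expansion, Finset.sum_mul, ← Finset.sum_sub_distrib]
    refine Finset.sum_congr rfl fun n hn => ?_
    have h1 := congrArg (fun w : C3 => w i) (H.coeff_planar he hS hn)
    simp only [PiLp.add_apply, PiLp.smul_apply, smul_eq_mul, toC_apply] at h1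
    simp only [hd, PiLp.smul_apply, smul_eq_mul, toC_apply]
    rw [h1]; ring
  have hpar : IsFiniteModeField T d vpar := by
    refine ⟨⟨fun h => H.freq.zero_notMem (TS h), fun n hn => ?_⟩, fun n hn h => ?_, hd0,
      fun n hn i => ?_, fun n hn => ?_, hexp⟩
    · obtain ⟨h1, h2⟩ := mem_planarSupport.mp hn
      refine mem_planarSupport.mpr ⟨H.freq.symm n h1, ?_⟩
      rw [hα, H.alpha_neg e h1, neg_ne_zero]
      exact (map_ne_zero _).mpr h2
    · have hn0 : n ≠ 0 := fun h => H.freq.zero_notMem (h ▸ TS hn)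
      rcases smul_eq_zero.mp h with h1 | h1
      · exact (mem_planarSupport.mp hn).2 h1
      · refine cross3_ne_zero_of_perp he (hS n (TS hn)) hn0 ?_
        ext i
        have := congrArg (fun w : C3 => w i) h1
        simpa using this
    · simp only [hd, PiLp.smul_apply, smul_eq_mul, toC_apply, cross3_neg_right, PiLp.neg_apply,
        map_mul, Complex.conj_ofReal]
      rw [hα, H.alpha_neg e (TS hn)]
      push_cast; ring
    · simp only [hd]
      rw [cdot_smul_left, cdot_toC, inner_cross3_right]; simp
  -- Up to a constant factor this is the stream function of the parallel part; on the circle of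
  -- radius `r` the normalized vorticity is `ω = i r Ω`.
  set Ω : E3 → ℂ := fun x => ∑ n ∈ T, α n * fourierChar3 n x with hΩ
  have hcurl : ∀ x i, ((curl3 vpar x i : ℝ) : ℂ) = Complex.I * (r : ℂ) ^ 2 * Ω x * (e i : ℂ) := by
    intro x i
    rw [curl3_eq hexp]
    simp only [hΩ]
    rw [Finset.mul_sum, Finset.sum_mul]
    refine Finset.sum_congr rfl fun n hn => ?_
    have h1 : crossC (toC n) (d n) i = α n * (r : ℂ) ^ 2 * (e i : ℂ) := by
      have h2 : n 0 * n 0 + n 1 * n 1 + n 2 * n 2 = r ^ 2 := by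
        rw [← inner_eq3, real_inner_self_eq_norm_sq, hcirc n hn]
      have h3 : e 0 * n 0 + e 1 * n 1 + e 2 * n 2 = 0 := by
        rw [← inner_eq3]; exact hS n (TS hn)
      have h2' : (n 0 : ℂ) * n 0 + n 1 * n 1 + n 2 * n 2 = (r : ℂ) ^ 2 := by exact_mod_cast h2
      have h3' : (e 0 : ℂ) * n 0 + e 1 * n 1 + e 2 * n 2 = 0 := by
        simp only [← Complex.ofReal_mul, ← Complex.ofReal_add]
        rw [h3]; exact Complex.ofReal_zero
      fin_cases i
      · show crossC (toC n) (d n) 0 = α n * (r : ℂ) ^ 2 * (e 0 : ℂ)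
        simp only [hd, crossC_zero, PiLp.smul_apply, smul_eq_mul, toC_apply, cross3_one, cross3_two]
        push_cast
        linear_combination α n * e 0 * h2' - α n * n 0 * h3'
      · show crossC (toC n) (d n) 1 = α n * (r : ℂ) ^ 2 * (e 1 : ℂ)
        simp only [hd, crossC_one, PiLp.smul_apply, smul_eq_mul, toC_apply, cross3_zero, cross3_two]
        push_cast
        linear_combination α n * e 1 * h2' - α n * n 1 * h3'
      · show crossC (toC n) (d n) 2 = α n * (r : ℂ) ^ 2 * (e 2 : ℂ)
        simp only [hd, crossC_two, PiLp.smul_apply, smul_eq_mul, toC_apply, cross3_zero, cross3_one]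
        push_cast
        linear_combination α n * e 2 * h2' - α n * n 2 * h3'
    rw [h1]; ring
  have hinner : ∀ x, ((inner ℝ e (curl3 vpar x) : ℝ) : ℂ) = Complex.I * (r : ℂ) ^ 2 * Ω x := by
    intro x
    have h1 : ((e 0 * e 0 + e 1 * e 1 + e 2 * e 2 : ℝ) : ℂ) = 1 := by
      rw [← inner_eq3, hee, Complex.ofReal_one]
    push_cast at h1
    rw [inner_eq3]
    push_cast
    rw [hcurl, hcurl, hcurl]
    linear_combination Complex.I * (r : ℂ) ^ 2 * Ω x * h1
  set ω : E3 → ℝ := fun x => inner ℝ e (curl3 vpar x) / r with hω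
  have hrC : (r : ℂ) ≠ 0 := Complex.ofReal_ne_zero.mpr hr.ne'
  have hIr : Complex.I * (r : ℂ) ≠ 0 := mul_ne_zero Complex.I_ne_zero hrC
  have hωΩ : ∀ x, Ω x = (ω x : ℂ) / (Complex.I * r) := by
    intro x
    simp only [hω]
    push_cast
    rw [hinner]
    field_simp
  -- The coefficients are rescaled from powers of `Ω` to powers of `ω`. Real parts may be taken
  -- because `ω` and the value of the polynomial are real.
  set Q : Polynomial ℝ := ∑ k ∈ Finset.range K,
    Polynomial.C (c k / (Complex.I * r) ^ k).re * Polynomial.X ^ k with hQ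
  have hval : ∀ x, ((inner ℝ e (v x) : ℝ) : ℂ) = ∑ k ∈ Finset.range K, c k * Ω x ^ k := by
    have h1 := HasFourier.convPoly T α K c
    have h2 := H.hasFourier_inner e
    rw [funext hc] at h2
    exact fun x => congrFun (h2.fun_unique h1) x
  have hQe : ∀ x, inner ℝ e (v x) = Q.eval (ω x) := by
    intro x
    have h1 := congrArg Complex.re (hval x)
    rw [Complex.ofReal_re, Complex.re_sum] at h1
    rw [h1, hQ, Polynomial.eval_finsetSum]
    refine Finset.sum_congr rfl fun k _ => ?_
    rw [hωΩ, div_pow, Polynomial.eval_mul, Polynomial.eval_C, Polynomial.eval_pow,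
      Polynomial.eval_X, mul_div_assoc', mul_comm (c k), mul_div_assoc, ← Complex.ofReal_pow,
      Complex.re_ofReal_mul, mul_comm]
  refine ⟨e, vpar, fun x => inner ℝ e (v x), T, d, r, ω, Q, 0, ?_, he, fun x => ?_, hpar, fun x => ?_,
    hr, fun n hn => ⟨?_, hcirc n hn⟩, hcard, fun x => ?_, ?_, fun x => ?_⟩
  · exact Submodule.le_orthogonal_orthogonal _ (Submodule.mem_span_singleton_self e)
  · simp only [hvpar]; abel
  · rw [Submodule.mem_orthogonal_singleton_iff_inner_right]
    simp only [hvpar]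
    rw [inner_sub_right, inner_smul_right, hee]; ring
  · rw [Submodule.mem_orthogonal_singleton_iff_inner_right]
    exact hS n (TS hn)
  · ext i
    have h1 : ((curl3 vpar x i : ℝ) : ℂ) = (((inner ℝ e (curl3 vpar x) : ℝ) * e i : ℝ) : ℂ) := by
      push_cast
      rw [hcurl, hinner]
    have h2 : r * ω x = inner ℝ e (curl3 vpar x) := by
      simp only [hω]; field_simp
    rw [h2, PiLp.smul_apply, smul_eq_mul]
    exact_mod_cast h1
  -- The polynomial already equals the normal component, which has no zero mode because `0 ∉ S`; the
  -- mean value is 0.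
  · refine ⟨insert 0 S, fun n => cdot (b n) e, Finset.mem_insert_self 0 S, fun x => ?_, ?_⟩
    · beta_reduce
      rw [← hQe, inner_expansion H.expansion, Finset.sum_insert H.freq.zero_notMem,
        H.coeff_eq_zero 0 H.freq.zero_notMem]
      simp
    · beta_reduce
      rw [H.coeff_eq_zero 0 H.freq.zero_notMem, cdot_zero_left, Complex.ofReal_zero]
  · beta_reduce
    rw [hQe, sub_zero]

lemma cases_of_isClassified (H : IsFiniteModeField S b v) (h : IsClassified S b) :
    IsLineSupport S ∨ IsPlanarCase S v ∨ IsBeltramiCase S v := by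
  rcases h with ⟨d, hd, h⟩ | ⟨e, he, hS, ⟨m, hm⟩, hspan, h⟩ | ⟨hspan, κ, r, hr, h⟩
  · exact Or.inl (isLineSupport_of_smul hd h)
  · right; left
    have he0 : e ≠ 0 := by rintro rfl; simp at he
    have hm0 : m ≠ 0 := fun h => H.freq.zero_notMem (h ▸ hm)
    obtain ⟨n, hn, hmn⟩ := hspan m hm
    refine ⟨⟨m, hm, n, hn, linearIndependent_pair fun h0 => ?_⟩, (Submodule.span ℝ {e})ᗮ, ?_,
      fun n hn => ?_, ?_⟩
    · obtain ⟨k, hk⟩ := (cross3_eq_zero_iff hm0).mp h0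
      rw [hk, brk_smul_right, brk_self, mul_zero] at hmn
      exact hmn rfl
    · have : Fact (Module.finrank ℝ E3 = 2 + 1) := ⟨by simp⟩
      exact Submodule.finrank_orthogonal_span_singleton he0
    · rw [Submodule.mem_orthogonal_singleton_iff_inner_right]
      exact hS n hn
    · rcases h with h | ⟨r, hr, hcirc, hcard, K, c, hc⟩
      · left
        intro x
        rw [H.eq_smul_of_alpha_eq_zero he hS h x]
        exact Submodule.smul_mem _ _
          (Submodule.le_orthogonal_orthogonal _ (Submodule.mem_span_singleton_self e))
      · exact Or.inr (H.isVorticityPolynomialFlow he hS hr hcirc hcard hc)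
  · right; right
    refine ⟨?_, ⟨r, hr, fun n hn => (h n hn).2⟩, H.curl_isBeltrami fun n hn => (h n hn).1⟩
    obtain ⟨n₁, h1, h1'⟩ := hspan (EuclideanSpace.single 0 1) (by
      intro h0
      have := congrArg (fun w : E3 => w 0) h0
      simp at this)
    have hn0 : n₁ ≠ 0 := fun h => H.freq.zero_notMem (h ▸ h1)
    obtain ⟨d, hd0, hd⟩ := exists_perp_ne_zero n₁
    obtain ⟨n₂, h2, h2'⟩ := hspan d hd0
    have hcr : cross3 n₁ n₂ ≠ 0 := by
      intro h0
      obtain ⟨k, hk⟩ := (cross3_eq_zero_iff hn0).mp h0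
      rw [hk, inner_smul_right, hd, mul_zero] at h2'
      exact h2' rfl
    obtain ⟨n₃, h3, h3'⟩ := hspan _ hcr
    exact ⟨n₁, h1, n₂, h2, n₃, h3, linearIndependent_triple h3'⟩

end IsFiniteModeField

lemma HasFourier.zero : HasFourier (fun _ => 0) (fun _ => 0) :=
  ⟨∅, fun _ _ => rfl, fun _ => by simp⟩

namespace IsFiniteModeField

variable {S : Finset E3} {b : E3 → C3} {v : E3 → E3}

lemma cdot_eq_zero_of_inner (H : IsFiniteModeField S b v) {y : E3}
    (h : ∀ x, inner ℝ y (v x) = (0 : ℝ)) (n : E3) : cdot (b n) y = 0 := by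
  have h1 := H.hasFourier_inner y
  simp only [h, Complex.ofReal_zero] at h1
  exact congrFun (h1.coeff_unique HasFourier.zero) n

lemma crossC_of_isBeltrami (H : IsFiniteModeField S b v) (h : IsBeltrami v) :
    ∃ κ : ℂ, ∀ n, crossC (toC n) (b n) = κ • b n := by
  obtain ⟨l, hl⟩ := h
  refine ⟨l / Complex.I, fun n => ?_⟩
  ext i
  have h1 := H.hasFourier_curl i
  simp only [hl] at h1
  have h2 := congrFun (h1.coeff_unique ((H.hasFourier i).const_mul l)) n
  rw [PiLp.smul_apply, smul_eq_mul, div_mul_eq_mul_div, eq_div_iff Complex.I_ne_zero, ← h2, mul_comm]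

lemma fullyBalanced_of_isVorticityPolynomialFlow (H : IsFiniteModeField S b v)
    {P : Submodule ℝ E3} (hSP : ∀ n ∈ S, n ∈ P) (h : IsVorticityPolynomialFlow P v) :
    FullyBalanced S b := by
  obtain ⟨e, vpar, vperp, T, d, r, ω, Q, c, heP, he, hv, hpar, hparP, hr, hT, -, hcurl, -, hQ⟩ := h
  have hee : inner ℝ e e = (1 : ℝ) := by rw [real_inner_self_eq_norm_sq, he]; norm_num
  have hP : ∀ {y}, y ∈ P → inner ℝ e y = (0 : ℝ) := fun hy =>
    Submodule.inner_left_of_mem_orthogonal hy heP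
  have hS : ∀ n ∈ S, inner ℝ e n = (0 : ℝ) := fun n hn => hP (hSP n hn)
  have hrC : (r : ℂ) ≠ 0 := Complex.ofReal_ne_zero.mpr hr.ne'
  have hperp : ∀ x, inner ℝ e (v x) = vperp x := fun x => by
    rw [hv, inner_add_right, hP (hparP x), inner_smul_right, hee, zero_add, mul_one]
  have htang : ∀ n y, inner ℝ e y = (0 : ℝ) → cdot (b n) y = cdot (d n) y := by
    intro n y hy
    have h1 := H.hasFourier_inner y
    have h2 : ∀ x, inner ℝ y (v x) = inner ℝ y (vpar x) := fun x => by
      rw [hv, inner_add_right, inner_smul_right, real_inner_comm e y, hy, mul_zero, add_zero]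
    simp only [h2] at h1
    exact congrFun (h1.coeff_unique (hpar.hasFourier_inner y)) n
  set α := alpha e b with hα
  set R := planarSupport S α with hR
  have hnorm : ∀ n ∈ R, ‖n‖ = r := by
    intro n hn
    refine (hT n ?_).2
    by_contra hnT
    refine (mem_planarSupport.mp hn).2 ?_
    rw [hα, alpha, htang n _ (by rw [← real_inner_comm]; exact inner_cross3_left e n),
      hpar.coeff_eq_zero n hnT, cdot_zero_left, zero_div]
  have hα0 : ∀ n ∉ R, α n = 0 := by
    intro n hn
    by_contra h0
    refine hn (mem_planarSupport.mpr ⟨?_, h0⟩)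
    by_contra hnS
    exact h0 (by rw [hα, alpha, H.coeff_eq_zero n hnS, cdot_zero_left, zero_div])
  set Ω : E3 → ℂ := fun x => ∑ n ∈ R, α n * fourierChar3 n x with hΩ
  have hω : ∀ x, (ω x : ℂ) = Complex.I * r * Ω x := by
    have h1 := hpar.hasFourier_inner_curl e
    have h2 : ∀ n, Complex.I * cdot (d n) (cross3 e n) = Complex.I * (r : ℂ) ^ 2 * α n := by
      intro n
      rw [← htang n _ (by rw [← real_inner_comm]; exact inner_cross3_left e n)]
      by_cases hn : n ∈ R
      · have hn0 : ((r ^ 2 : ℝ) : ℂ) ≠ 0 := by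
          push_cast; exact pow_ne_zero 2 hrC
        rw [hα, alpha, hnorm n hn, ← Complex.ofReal_pow]
        field_simp
      · have h3 := hα0 n hn
        rw [h3, mul_zero]
        rw [hα, alpha, div_eq_zero_iff] at h3
        rcases h3 with h3 | h3
        · rw [h3, mul_zero]
        · have : n = 0 := by
            rw [Complex.ofReal_eq_zero] at h3
            exact norm_eq_zero.mp (pow_eq_zero_iff two_ne_zero |>.mp h3)
          rw [this, cross3_zero_right, cdot_zero_right, mul_zero]
    have h3 : ∀ x, inner ℝ e (curl3 vpar x) = r * ω x := fun x => by
      rw [hcurl, inner_smul_right, hee, mul_one]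
    simp only [h2, h3] at h1
    have h4 : HasFourier Ω α := ⟨R, hα0, fun x => rfl⟩
    intro x
    have h5 := congrFun (h1.fun_unique (h4.const_mul (Complex.I * (r : ℂ) ^ 2))) x
    push_cast at h5
    exact mul_left_cancel₀ hrC (by linear_combination h5)
  refine fullyBalanced_of_convPoly he hS H.freq.zero_notMem H.div_free H.coeff_eq_zero hnorm
    (K := Q.natDegree + 1)
    -- The passage from `ω` to `i r Ω` rescales the coefficients, and the mean value is absorbed
    -- into the constant term.
    (c := fun k => (Q.coeff k : ℂ) * (Complex.I * r) ^ k - if k = 0 then (c : ℂ) else 0) ?_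
  refine congrFun ((H.hasFourier_inner e).coeff_unique ?_)
  convert HasFourier.convPoly R α (Q.natDegree + 1) _ using 2 with x
  rw [hperp, hQ, Polynomial.eval_eq_sum_range]
  push_cast
  simp only [sub_mul, ite_mul, zero_mul, Finset.sum_sub_distrib, Finset.sum_ite_eq',
    Finset.mem_range, Nat.succ_pos, if_true, pow_zero, mul_one]
  refine congrArg (· - (c : ℂ)) (Finset.sum_congr rfl fun k _ => ?_)
  rw [hω, mul_pow, mul_assoc]

lemma fullyBalanced_of_cases (H : IsFiniteModeField S b v)
    (h : IsLineSupport S ∨ IsPlanarCase S v ∨ IsBeltramiCase S v) : FullyBalanced S b := by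
  rcases h with ⟨L, hL, hSL⟩ | ⟨-, P, -, hSP, h | h⟩ | ⟨-, -, h⟩
  · obtain ⟨⟨d, hd⟩, -, hd'⟩ := finrank_eq_one_iff'.mp hL
    refine fullyBalanced_of_line (d := d) H.freq.zero_notMem H.div_free fun n hn => ?_
    obtain ⟨c, hc⟩ := hd' ⟨n, hSL n hn⟩
    exact ⟨c, (congrArg Subtype.val hc).symm⟩
  · exact fullyBalanced_of_cdot fun m _ n hn => H.cdot_eq_zero_of_inner
      (fun x => Submodule.inner_right_of_mem_orthogonal (hSP n hn) (h x)) m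
  · exact H.fullyBalanced_of_isVorticityPolynomialFlow hSP h
  · obtain ⟨κ, hκ⟩ := H.crossC_of_isBeltrami h
    exact fullyBalanced_of_helical fun n _ => hκ n

end IsFiniteModeField

lemma IsFiniteModeFlow.coeff_eq {I : Set ℝ} {S : Finset E3} {a : ℝ → E3 → C3} {u : ℝ → E3 → E3}
    (hu : IsFiniteModeFlow I S a u) {b : E3 → C3} {v : E3 → E3} (H : IsFiniteModeField S b v)
    {t : ℝ} (ht : t ∈ I) (huv : ∀ x, u t x = v x) (n : E3) : a t n = b n := by
  ext i
  have h : HasFourier (fun x => ((v x i : ℝ) : ℂ)) (fun n => a t n i) :=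
    ⟨S, fun n hn => by beta_reduce; rw [hu.coeff_eq_zero t ht n hn]; rfl,
      fun x => by beta_reduce; rw [← huv]; exact hu.expansion t ht x i⟩
  exact congrFun (h.coeff_unique (H.hasFourier i)) n

theorem theorem1p3 (I : Set ℝ) (hI_open : IsOpen I) (hI_conn : I.OrdConnected)
    (hI_ne : I.Nonempty) (S : Finset E3) (a : ℝ → E3 → C3) (u : ℝ → E3 → E3)
    (hu : IsFiniteModeFlow I S a u) :
    SolvesProjectedEuler I S a ↔
      ∃ (v : E3 → E3) (b : E3 → C3),
        (∀ t ∈ I, ∀ x, u t x = v x) ∧ IsFiniteModeField S b v ∧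
        (IsLineSupport S ∨ IsPlanarCase S v ∨ IsBeltramiCase S v) := by
  constructor
  · intro hE
    obtain ⟨t₁, ht₁, hconst, hne, hcl⟩ :=
      steady_of_solvesProjectedEuler hI_open hI_conn hI_ne hu hE
    have H : IsFiniteModeField S (a t₁) (u t₁) :=
      ⟨hu.freq, hne, hu.coeff_eq_zero t₁ ht₁, hu.conj t₁ ht₁, hu.div_free t₁ ht₁,
        hu.expansion t₁ ht₁⟩
    refine ⟨u t₁, a t₁, fun t ht x => ?_, H, H.cases_of_isClassified hcl⟩
    ext i
    apply Complex.ofReal_injective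
    rw [hu.expansion t ht, hu.expansion t₁ ht₁]
    exact Finset.sum_congr rfl fun n _ => by rw [hconst t ht n]
  · rintro ⟨v, b, huv, H, hcases⟩ t ht n hn
    have hb : ∀ s ∈ I, a s = b := fun s hs => funext fun m => hu.coeff_eq H hs (huv s hs) m
    have hn0 : n ≠ 0 := by
      rcases hn with hn | hn
      · exact fun h => hu.freq.zero_notMem (h ▸ hn)
      · exact hn.1
    rw [hb t ht, H.fullyBalanced_of_cases hcases n hn0, smul_zero, neg_zero]
    refine (hasDerivAt_const t (b n)).congr_of_eventuallyEq ?_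
    filter_upwards [hI_open.mem_nhds ht] with s hs
    rw [hb s hs]
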